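/- **Almost conservation law for the fifth order KdV–BBM equation.** Let $\gamma_1,\delta_1>0$, $\gamma_2,\delta_2\in\mathbb R$ and $\gamma=\frac{7}{48}$, and consider for real-valued $\eta=\eta(x,t)$ the Cauchy problem $$\partial_t\eta+\partial_x\eta-\gamma_1\partial_t\partial_x^2\eta+\gamma_2\partial_x^3\eta+\delta_1\partial_t\partial_x^4\eta+\delta_2\partial_x^5\eta=-\tfrac34\partial_x(\eta^2)-\gamma\,\partial_x^3(\eta^2)+\tfrac{7}{48}\partial_x\big((\partial_x\eta)^2\big)+\tfrac18\partial_x(\eta^3),\qquad \eta(x,0)=\eta_0(x),$$ the equation being understood in the sense of tempered distributions in $x$ for every $t$. For $\sigma\ge 0$ let $H^{\sigma,2}(\mathbb R)$ be the space of real-valued $f\in L^2(\mathbb R)$ with finite norm $\|f\|_{H^{\sigma,2}}=\|\cosh(\sigma|\xi|)(1+\xi^2)\widehat f(\xi)\|_{L^2_\xi}$ (with the unitary Fourier transform), let $D=-i\partial_x$, $v_\sigma=\cosh(\sigma|D|)\eta$, and define the modified energy $$E_\sigma(t)=\frac12\int_{\mathbb R}v_\sigma^2+\gamma_1(\partial_xv_\sigma)^2+\delta_1(\partial_x^2v_\sigma)^2\,dx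 .$$ Then there are constants $c_0,C>0$, depending only on $\gamma_1,\gamma_2,\delta_1,\delta_2$, such that the following holds for all $\sigma\ge0$ and $\eta_0\in H^{\sigma,2}(\mathbb R)$: if $0<T\le c_0\,(1+\|\eta_0\|_{H^{\sigma,2}})^{-2}$ and $\eta\in C([0,T];H^{\sigma,2}(\mathbb R))$ is a solution of the Cauchy problem on $[0,T]$, then $\sup_{0\le t\le T}E_\sigma(t)$ is finite and $$\Big|\sup_{0\le t\le T}E_\sigma(t)-E_\sigma(0)\Big|\le C\,\sigma^2\,T\,\big(1+E_\sigma(0)^{1/2}\big)E_\sigma(0)^{3/2}.$$ -/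

import Mathlib

open MeasureTheory Filter Topology Set
open scoped FourierTransform SchwartzMap

noncomputable section

namespace KdVBBM

/-- Real-valued square-integrable functions on the line. -/
abbrev L2 : Type := Lp ℝ 2 (volume : Measure ℝ)

/-- The `L²` Fourier transform of a real-valued function, with Mathlib's normalization
`𝓕 f ξ = ∫ exp (-2πi x ξ) f x dx`. In this normalization the operator `D = -i ∂ₓ` has the
symbol `2πξ`, and Plancherel's identity has constant one. -/
def hat (f : L2) : Lp ℂ 2 (volume : Measure ℝ) :=
  𝓕 (Complex.ofRealCLM.compLp f)

/-- The domain condition of the operator `m(D)`: `m(2πξ) 𝓕 f (ξ)` is square-integrable. -/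
def InDomain (m : ℝ → ℂ) (f : L2) : Prop :=
  MemLp (fun ξ : ℝ => m (2 * Real.pi * ξ) * hat f ξ) 2 volume

open Classical in
/-- The Fourier multiplier operator `m(D)`, for symbols with `m (-ξ) = conj (m ξ)`, which map
real-valued functions to real-valued functions (so that taking the real part changes nothing).
Off its domain it is given the value `0`. -/
def multiplier (m : ℝ → ℂ) (f : L2) : L2 :=
  if h : InDomain m f then Complex.reCLM.compLp (𝓕⁻ (h.toLp _)) else 0

/-- The derivative `∂ₓ = i D`. -/
def dx (f : L2) : L2 := multiplier (fun ξ => Complex.I * ξ) f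

/-- The operator `cosh(σ|D|)`. -/
def coshD (σ : ℝ) (f : L2) : L2 := multiplier (fun ξ => (Real.cosh (σ * |ξ|) : ℝ)) f

/-- The weight `cosh(σ|ξ|) ⟨ξ⟩ˢ`, where `⟨ξ⟩ = (1 + ξ²)^{1/2}`. -/
def weight (σ s ξ : ℝ) : ℝ := Real.cosh (σ * |ξ|) * (Real.sqrt (1 + ξ ^ 2)) ^ s

/-- Membership in the modified Gevrey space `H^{σ,s}(ℝ)` (for `s ≥ 0`). -/
def MemH (σ s : ℝ) (f : L2) : Prop := InDomain (fun ξ => (weight σ s ξ : ℂ)) f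

/-- The norm of `H^{σ,s}(ℝ)`. -/
def normH (σ s : ℝ) (f : L2) : ℝ :=
  (eLpNorm (fun ξ : ℝ => (weight σ s (2 * Real.pi * ξ) : ℂ) * hat f ξ) 2 volume).toReal

/-- `η ∈ C([0,T]; H^{σ,s}(ℝ))`. -/
def ContInH (σ s T : ℝ) (η : ℝ → L2) : Prop :=
  ∀ t ∈ Icc 0 T, MemH σ s (η t) ∧
    Tendsto (fun r => normH σ s (η r - η t)) (𝓝[Icc 0 T] t) (𝓝 0)

/-- `η` solves, on the time interval `[0,T]`,
`∂ₜη + ∂ₓη - γ₁ ∂ₜ∂ₓ²η + γ₂ ∂ₓ³η + δ₁ ∂ₜ∂ₓ⁴η + δ₂ ∂ₓ⁵η`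
`  = -(3/4) ∂ₓ(η²) - γ ∂ₓ³(η²) + (7/48) ∂ₓ((∂ₓη)²) + (1/8) ∂ₓ(η³)`, `η(0) = η₀`,
the equation being understood in the sense of tempered distributions in `x`, at every time. -/
structure IsSolution (γ γ₁ γ₂ δ₁ δ₂ T : ℝ) (η₀ : L2) (η : ℝ → L2) : Prop where
  initial : η 0 = η₀
  equation : ∀ φ : 𝓢(ℝ, ℝ), ∀ t ∈ Icc 0 T,
    HasDerivWithinAt
      (fun r => ∫ x, η r x * (φ x - γ₁ * iteratedDeriv 2 φ x + δ₁ * iteratedDeriv 4 φ x))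
      ((∫ x, η t x * (deriv φ x + γ₂ * iteratedDeriv 3 φ x + δ₂ * iteratedDeriv 5 φ x))
        + (3 / 4) * (∫ x, (η t x) ^ 2 * deriv φ x)
        + γ * (∫ x, (η t x) ^ 2 * iteratedDeriv 3 φ x)
        - (7 / 48) * (∫ x, (dx (η t) x) ^ 2 * deriv φ x)
        - (1 / 8) * (∫ x, (η t x) ^ 3 * deriv φ x))
      (Icc 0 T) t

/-- The modified energy
`½ ∫ v² + γ₁ (∂ₓv)² + δ₁ (∂ₓ²v)² dx` of `f`, where `v = cosh(σ|D|) f`. -/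
def energy (γ₁ δ₁ σ : ℝ) (f : L2) : ℝ :=
  (1 / 2) * ∫ x, ((coshD σ f x) ^ 2 + γ₁ * (dx (coshD σ f) x) ^ 2
    + δ₁ * (dx (dx (coshD σ f)) x) ^ 2)

end KdVBBM

end

noncomputable section

namespace KdVBBM

open scoped ComplexConjugate ContDiff

/-! ### The `L²` Fourier transform tested against Schwartz functions -/

/-! Work on the Fourier side with k = 2πξ, a = cosh(σk) η̂ and b = sinh(σk) η̂. By Plancherel the
energy is ½ ∫ (1 + γ₁k² + δ₁k⁴)|a|², comparable to X², where X is the `L²` norm of (1 + k²) a, that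
is, the norm of `H^{σ,2}`. In the time derivative of the energy the linear terms are purely
imaginary and drop out, which leaves the real part of the integral of `flux`.

The addition formulas for cosh and sinh split this flux. The terms with `a` alone are those of the
unweighted equation and cancel (`J_self_self_kmul`, `J_kmul_self_kmul_kmul`, `J_self_conv_kmul`);
the second of these cancellations is what fixes γ = 7/48. Every other term contains exactly two
factors `b`, and |b| ≤ min(1, σ) ⟨k⟩ |a| (`norm_shmul_le`), so the flux integral is at most min(1,
σ)² times a multiple of X³ + X⁴ (`flux_estimate`). This is the source of σ².

The equation holds only weakly and η has just two derivatives in `L²`, so the energy cannot be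
differentiated directly. The unknown is multiplied by (1 + εk²)⁻¹, after which the right-hand side
is a locally Lipschitz function with values in `L²` and the weak derivative becomes a strong one
(`regRhs_sub_bound`, `hasDerivWithinAt_of_weak`). Dominated convergence as ε → 0 gives the balance
law `fourierEnergy_sub`.

Finally, a continuity argument (`le_mul_of_integral_bound`) shows X(t) ≤ κ X(0) for T ≤ c₀(1 +
X(0))⁻². There min(1, σ) is bounded by 1, so that c₀ does not depend on σ; inserting this bound into
the balance law, now with min(1, σ) ≤ σ, gives the claim. -/

theorem integral_mul_fourier (F : Lp ℂ 2 (volume : Measure ℝ)) (θ : 𝓢(ℝ, ℂ)) :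
    ∫ ξ, θ ξ * 𝓕 F ξ = ∫ x, 𝓕 (θ : ℝ → ℂ) x * F x := by
  have := congrArg (fun u => u θ) (Lp.fourier_toTemperedDistribution_eq F)
  simp only [TemperedDistribution.fourier_apply, Lp.toTemperedDistribution_apply,
    smul_eq_mul] at this
  rw [← this]
  rfl

/-- The `L²` transform is not given by an integral, so both sides are tested against smooth
compactly supported functions. The transform then falls on the test function, where conjugation is a
reflection of the frequency in the Fourier integral. -/
theorem fourier_conj_ae (F G : Lp ℂ 2 (volume : Measure ℝ))
    (h : ∀ᵐ x, G x = conj (F x)) : ∀ᵐ ξ, 𝓕 G ξ = conj (𝓕 F (-ξ)) := by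
  have hF : MemLp (fun ξ => conj (𝓕 F (-ξ))) 2 (volume : Measure ℝ) := by
    have h1 : MemLp (fun ξ => 𝓕 F (-ξ)) 2 (volume : Measure ℝ) :=
      (Lp.memLp (𝓕 F)).comp_measurePreserving (Measure.measurePreserving_neg volume)
    exact h1.star
  refine ae_eq_of_integral_contDiff_smul_eq ((Lp.memLp (𝓕 G)).locallyIntegrable (by norm_num))
    (hF.locallyIntegrable (by norm_num)) fun ψ hψ hc => ?_
  let θ : 𝓢(ℝ, ℂ) := HasCompactSupport.toSchwartzMap (f := fun x => (ψ x : ℂ))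
    (hc.comp_left (g := fun y : ℝ => (y : ℂ)) (by simp)) (Complex.ofRealCLM.contDiff.comp hψ)
  let θ' : 𝓢(ℝ, ℂ) := HasCompactSupport.toSchwartzMap (f := fun x => (ψ (-x) : ℂ))
    ((hc.comp_homeomorph (Homeomorph.neg ℝ)).comp_left (g := fun y : ℝ => (y : ℂ)) (by simp))
    (Complex.ofRealCLM.contDiff.comp (hψ.comp contDiff_neg))
  have e1 : ∫ x, ψ x • 𝓕 G x = ∫ x, 𝓕 (θ : ℝ → ℂ) x * conj (F x) := by
    rw [show (∫ x, ψ x • 𝓕 G x) = ∫ x, θ x * 𝓕 G x from rfl, integral_mul_fourier]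
    refine integral_congr_ae ?_
    filter_upwards [h] with x hx
    rw [hx]
  have e2 : ∫ x, ψ x • conj (𝓕 F (-x)) = conj (∫ x, θ' x * 𝓕 F x) := by
    rw [← integral_conj, ← integral_neg_eq_self]
    refine integral_congr_ae (Eventually.of_forall fun x => ?_)
    have : θ' x = (ψ (-x) : ℂ) := rfl
    simp [this]
  -- Since ψ is real, conjugating the Fourier integral only reverses the character, which the
  -- reflection in θ' undoes.
  have e3 : ∀ x, conj (𝓕 (θ' : ℝ → ℂ) x) = 𝓕 (θ : ℝ → ℂ) x := by
    intro x
    rw [Real.fourier_real_eq, Real.fourier_real_eq, ← integral_conj, ← integral_neg_eq_self]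
    refine integral_congr_ae (Eventually.of_forall fun y => ?_)
    simp only [Circle.smul_def, smul_eq_mul, map_mul, neg_mul, neg_neg]
    rw [← Circle.coe_inv_eq_conj, ← AddChar.map_neg_eq_inv]
    have h1 : θ' (-y) = (ψ (- -y) : ℂ) := rfl
    have h2 : θ y = (ψ y : ℂ) := rfl
    simp [h1, h2]
  rw [e1, e2, integral_mul_fourier, ← integral_conj]
  refine integral_congr_ae (Eventually.of_forall fun x => ?_)
  simp [e3]

theorem fourierInv_conj_ae (F G : Lp ℂ 2 (volume : Measure ℝ))
    (h : ∀ᵐ ξ, G ξ = conj (F (-ξ))) : ∀ᵐ x, (𝓕⁻ G) x = conj ((𝓕⁻ F) x) := by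
  let L : ℂ →L[ℝ] ℂ := Complex.conjCLE.toContinuousLinearMap
  have hL : ∀ᵐ x, (L.compLp (𝓕⁻ F)) x = conj ((𝓕⁻ F) x) := L.coeFn_compLp _
  have h1 := fourier_conj_ae (𝓕⁻ F) (L.compLp (𝓕⁻ F)) hL
  rw [FourierTransform.fourier_fourierInv_eq] at h1
  have h2 : 𝓕 (L.compLp (𝓕⁻ F)) = G := by
    apply Lp.ext
    filter_upwards [h, h1] with ξ h h1
    rw [h, h1]
  rw [← h2, FourierTransform.fourierInv_fourier_eq]
  exact hL

/-- The Fourier transform of a real-valued function is Hermitian. -/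
theorem hat_neg_ae (f : L2) : ∀ᵐ ξ, hat f (-ξ) = conj (hat f ξ) := by
  have h := Complex.ofRealCLM.coeFn_compLp f
  have h1 := fourier_conj_ae (Complex.ofRealCLM.compLp f) (Complex.ofRealCLM.compLp f) (by
    filter_upwards [h] with x hx
    rw [hx]; simp)
  filter_upwards [h1] with x hx
  rw [hat, hx, Complex.conj_conj]

theorem norm_hat (f : L2) : ‖hat f‖ = ‖f‖ := by
  rw [hat, Lp.norm_fourier_eq, Lp.norm_def, Lp.norm_def]
  congr 1
  refine eLpNorm_congr_norm_ae ?_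
  filter_upwards [Complex.ofRealCLM.coeFn_compLp f] with x hx
  rw [hx]; simp

theorem hat_sub (f g : L2) : hat (f - g) = hat f - hat g := by
  have : Complex.ofRealCLM.compLp (f - g)
      = Complex.ofRealCLM.compLp f - Complex.ofRealCLM.compLp g :=
    map_sub (Complex.ofRealCLM.compLpL 2 (volume : Measure ℝ)) f g
  rw [hat, this]
  exact map_sub (Lp.fourierTransformₗᵢ ℝ ℂ) _ _

/-- A Hermitian symbol keeps the transform Hermitian, so the inverse transform is already real and
the real part taken in `multiplier` loses nothing. -/
theorem hat_multiplier (m : ℝ → ℂ) (hm : ∀ ξ, m (-ξ) = conj (m ξ)) (f : L2) (h : InDomain m f) :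
    ∀ᵐ ξ, hat (multiplier m f) ξ = m (2 * Real.pi * ξ) * hat f ξ := by
  set F : Lp ℂ 2 (volume : Measure ℝ) := h.toLp _ with hF
  have hFe : ∀ᵐ ξ, F ξ = m (2 * Real.pi * ξ) * hat f ξ := h.coeFn_toLp
  have hneg : ∀ᵐ ξ, F (-ξ) = m (2 * Real.pi * -ξ) * hat f (-ξ) :=
    (Measure.measurePreserving_neg volume).quasiMeasurePreserving.ae hFe
  have hherm : ∀ᵐ ξ, F ξ = conj (F (-ξ)) := by
    filter_upwards [hFe, hneg, hat_neg_ae f] with ξ h1 h2 h3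
    rw [h1, h2, h3, mul_neg, hm]
    simp
  have hreal := fourierInv_conj_ae F F hherm
  have : Complex.ofRealCLM.compLp (Complex.reCLM.compLp (𝓕⁻ F)) = 𝓕⁻ F := by
    apply Lp.ext
    filter_upwards [hreal, Complex.ofRealCLM.coeFn_compLp (Complex.reCLM.compLp (𝓕⁻ F)),
      Complex.reCLM.coeFn_compLp (𝓕⁻ F)] with x h1 h2 h3
    rw [h2, h3]
    exact Complex.conj_eq_iff_re.1 h1.symm
  rw [multiplier, dif_pos h, hat, this, FourierTransform.fourier_fourierInv_eq]
  exact hFe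

/-- Plancherel's identity for real-valued functions. -/
theorem integral_sq_eq_integral_hat (f : L2) : ∫ x, f x ^ 2 = ∫ ξ, ‖hat f ξ‖ ^ 2 := by
  have h1 : ∫ x, f x ^ 2 = ‖f‖ ^ 2 := by
    rw [← real_inner_self_eq_norm_sq, L2.inner_def]
    simp [sq]
  have h2 : ∫ x, ‖hat f x‖ ^ 2 = ‖hat f‖ ^ 2 := by
    have h3 : inner ℂ (hat f) (hat f) = ((‖hat f‖ ^ 2 : ℝ) : ℂ) := by
      rw [inner_self_eq_norm_sq_to_K]; norm_cast
    rw [L2.inner_def] at h3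
    have h4 : ∀ x, inner ℂ (hat f x) (hat f x) = ((‖hat f x‖ ^ 2 : ℝ) : ℂ) := fun x => by
      rw [inner_self_eq_norm_sq_to_K]; norm_cast
    simp_rw [h4] at h3
    rw [integral_complex_ofReal] at h3
    exact_mod_cast h3
  rw [h1, h2, norm_hat]

/-! ### Integrable Fourier transforms: inversion, and products as convolutions -/

theorem integral_mul_fourierInv_eq {f g : ℝ → ℂ} (hf : Integrable f) (hg : Integrable g) :
    ∫ x, f x * 𝓕⁻ g x = ∫ ξ, 𝓕⁻ f ξ * g ξ := by
  have e := VectorFourier.integral_fourierIntegral_smul_eq_flip (L := -innerₗ ℝ)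
    (μ := (volume : Measure ℝ)) (ν := (volume : Measure ℝ)) Real.continuous_fourierChar
    (by exact continuous_inner.neg) hf hg
  simp only [smul_eq_mul] at e
  have hL : (-innerₗ ℝ).flip = -innerₗ ℝ := by
    ext; simp
  rw [hL] at e
  exact e.symm

/-- A function whose Fourier transform is integrable is the inverse Fourier integral of it. -/
theorem coe_ae_eq_fourierInv (f : L2) (hf : Integrable (hat f)) :
    ∀ᵐ x, (f x : ℂ) = 𝓕⁻ (hat f : ℝ → ℂ) x := by
  have hcont : Continuous (𝓕⁻ (hat f : ℝ → ℂ)) := by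
    have : 𝓕⁻ (hat f : ℝ → ℂ) = fun x => 𝓕 (hat f : ℝ → ℂ) (-x) := by
      ext x; rw [Real.fourierInv_eq_fourier_neg]
    rw [this]
    exact (VectorFourier.fourierIntegral_continuous Real.continuous_fourierChar
      (by exact continuous_inner) hf).comp continuous_neg
  have h0 := Complex.ofRealCLM.coeFn_compLp f
  suffices h : ∀ᵐ x, (Complex.ofRealCLM.compLp f) x = 𝓕⁻ (hat f : ℝ → ℂ) x by
    filter_upwards [h, h0] with x h1 h2
    rw [← h1, h2]; rfl
  refine ae_eq_of_integral_contDiff_smul_eq ((Lp.memLp _).locallyIntegrable (by norm_num))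
    hcont.locallyIntegrable fun ψ hψ hc => ?_
  let θ : 𝓢(ℝ, ℂ) := HasCompactSupport.toSchwartzMap (f := fun x => (ψ x : ℂ))
    (hc.comp_left (g := fun y : ℝ => (y : ℂ)) (by simp)) (Complex.ofRealCLM.contDiff.comp hψ)
  have e1 : ∫ x, ψ x • (Complex.ofRealCLM.compLp f) x = ∫ ξ, 𝓕⁻ (θ : ℝ → ℂ) ξ * hat f ξ := by
    have := integral_mul_fourier (Complex.ofRealCLM.compLp f) (𝓕⁻ θ)
    rw [← SchwartzMap.fourier_coe, FourierTransform.fourier_fourierInv_eq,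
      SchwartzMap.fourierInv_coe] at this
    exact this.symm
  rw [e1]
  exact (integral_mul_fourierInv_eq θ.integrable hf).symm

/-- The convolution of two complex-valued functions on the line. -/
def conv (f g : ℝ → ℂ) (ξ : ℝ) : ℂ := ∫ ζ, f ζ * g (ξ - ζ)

theorem conv_eq_convolution (f g : ℝ → ℂ) :
    conv f g = convolution f g (ContinuousLinearMap.mul ℂ ℂ) volume := rfl

theorem integrable_conv {f g : ℝ → ℂ} (hf : Integrable f) (hg : Integrable g) :
    Integrable (conv f g) := by
  rw [conv_eq_convolution]
  exact hf.integrable_convolution (ContinuousLinearMap.mul ℂ ℂ) hg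

theorem fourierInv_conv {f g : ℝ → ℂ} (hf : Integrable f) (hg : Integrable g) (x : ℝ) :
    𝓕⁻ (conv f g) x = 𝓕⁻ f x * 𝓕⁻ g x := by
  simp only [Real.fourierInv_eq_fourier_neg]
  exact Real.fourier_mul_convolution_eq hf hg (-x)

/-- `h` is the inverse Fourier integral of the integrable function `G`. -/
def HasFourier (h : ℝ → ℝ) (G : ℝ → ℂ) : Prop :=
  Integrable G ∧ ∀ᵐ x, (h x : ℂ) = 𝓕⁻ G x

theorem HasFourier.mul {h k : ℝ → ℝ} {G K : ℝ → ℂ} (hh : HasFourier h G) (hk : HasFourier k K) :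
    HasFourier (fun x => h x * k x) (conv G K) := by
  refine ⟨integrable_conv hh.1 hk.1, ?_⟩
  filter_upwards [hh.2, hk.2] with x h1 h2
  rw [fourierInv_conv hh.1 hk.1, ← h1, ← h2]
  push_cast; rfl

theorem continuous_fourierInv {G : ℝ → ℂ} (hG : Integrable G) : Continuous (𝓕⁻ G) := by
  have : 𝓕⁻ G = fun x => 𝓕 G (-x) := by
    ext x; rw [Real.fourierInv_eq_fourier_neg]
  rw [this]
  exact (VectorFourier.fourierIntegral_continuous Real.continuous_fourierChar
    (by exact continuous_inner) hG).comp continuous_neg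

theorem norm_fourierInv_le (G : ℝ → ℂ) (x : ℝ) : ‖𝓕⁻ G x‖ ≤ ∫ ξ, ‖G ξ‖ :=
  VectorFourier.norm_fourierIntegral_le_integral_norm Real.fourierChar volume (-innerₗ ℝ) G x

/-- The equation is tested with real functions of x, whereas test functions in ξ have complex
transforms. Real and imaginary parts are paired separately and reassembled into one complex
identity. -/
theorem HasFourier.integral_fourier {h : ℝ → ℝ} {G : ℝ → ℂ} (hh : HasFourier h G)
    (θ : 𝓢(ℝ, ℂ)) :
    ((∫ x, h x * (𝓕 (θ : ℝ → ℂ) x).re : ℝ) : ℂ)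
      + Complex.I * ((∫ x, h x * (𝓕 (θ : ℝ → ℂ) x).im : ℝ) : ℂ) = ∫ ξ, G ξ * θ ξ := by
  have hψ : Integrable (𝓕 (θ : ℝ → ℂ)) := (𝓕 θ).integrable
  have h1 : ∫ x, 𝓕 (θ : ℝ → ℂ) x * 𝓕⁻ G x = ∫ ξ, G ξ * θ ξ := by
    rw [integral_mul_fourierInv_eq hψ hh.1]
    have : 𝓕⁻ (𝓕 (θ : ℝ → ℂ)) = θ := by
      rw [← SchwartzMap.fourier_coe, ← SchwartzMap.fourierInv_coe,
        FourierTransform.fourierInv_fourier_eq]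
    rw [this]
    exact integral_congr_ae (Eventually.of_forall fun x => mul_comm _ _)
  have hint : Integrable (fun x => 𝓕 (θ : ℝ → ℂ) x * 𝓕⁻ G x) := by
    refine hψ.mul_bdd (c := ∫ ξ, ‖G ξ‖) (continuous_fourierInv hh.1).aestronglyMeasurable
      (Eventually.of_forall fun x => norm_fourierInv_le G x)
  rw [← h1, ← integral_re_add_im hint]
  simp only [RCLike.re_to_complex, RCLike.im_to_complex, RCLike.I_to_complex]
  rw [mul_comm Complex.I]
  have r1 : ∫ x, h x * (𝓕 (θ : ℝ → ℂ) x).re = ∫ x, (𝓕 (θ : ℝ → ℂ) x * 𝓕⁻ G x).re := by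
    refine integral_congr_ae ?_
    filter_upwards [hh.2] with x hx
    rw [← hx]; simp [mul_comm]
  have r2 : ∫ x, h x * (𝓕 (θ : ℝ → ℂ) x).im = ∫ x, (𝓕 (θ : ℝ → ℂ) x * 𝓕⁻ G x).im := by
    refine integral_congr_ae ?_
    filter_upwards [hh.2] with x hx
    rw [← hx]; simp [mul_comm]
  rw [r1, r2]
  rfl

/-! ### The equation on the Fourier side -/

/-- The symbol `1 + γ₁ k² + δ₁ k⁴` at `k = 2πξ`. -/
def symb (γ₁ δ₁ ξ : ℝ) : ℝ := 1 + γ₁ * (2 * Real.pi * ξ) ^ 2 + δ₁ * (2 * Real.pi * ξ) ^ 4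

/-- Multiplication by `k = 2πξ`. -/
def kmul (g : ℝ → ℂ) (ξ : ℝ) : ℂ := ((2 * Real.pi * ξ : ℝ) : ℂ) * g ξ

/-- The nonlinearity of the equation on the Fourier side, up to the factor `-i k`. -/
def nonlin (γ : ℝ) (g : ℝ → ℂ) (ξ : ℝ) : ℂ :=
  ((3 / 4 - γ * (2 * Real.pi * ξ) ^ 2 : ℝ) : ℂ) * conv g g ξ
    + (7 / 48) * conv (kmul g) (kmul g) ξ - (1 / 8) * conv g (conv g g) ξ

/-- The right-hand side of the equation on the Fourier side. -/
def rhs (γ γ₂ δ₂ : ℝ) (g : ℝ → ℂ) (ξ : ℝ) : ℂ :=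
  -Complex.I * ((2 * Real.pi * ξ : ℝ) : ℂ) *
    (((1 - γ₂ * (2 * Real.pi * ξ) ^ 2 + δ₂ * (2 * Real.pi * ξ) ^ 4 : ℝ) : ℂ) * g ξ + nonlin γ g ξ)

theorem iteratedDeriv_clm_comp (L : ℂ →L[ℝ] ℝ) (φ : 𝓢(ℝ, ℂ)) (n : ℕ) (x : ℝ) :
    iteratedDeriv n (SchwartzMap.postcompCLM L φ : 𝓢(ℝ, ℝ)) x = L (iteratedDeriv n φ x) := by
  have : ((SchwartzMap.postcompCLM L φ : 𝓢(ℝ, ℝ)) : ℝ → ℝ) = L ∘ φ := rfl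
  rw [this, iteratedDeriv_eq_iteratedFDeriv, iteratedDeriv_eq_iteratedFDeriv,
    L.iteratedFDeriv_comp_left (φ.smooth n).contDiffAt le_rfl]
  rfl

/-- The product of a smooth function and a smooth compactly supported one, as a Schwartz
function. -/
def schwartzMul (p θ : ℝ → ℂ) (hp : ContDiff ℝ ∞ p) (hθ : ContDiff ℝ ∞ θ)
    (hc : HasCompactSupport θ) : 𝓢(ℝ, ℂ) :=
  HasCompactSupport.toSchwartzMap (f := fun ξ => p ξ * θ ξ) hc.mul_left (hp.mul hθ)

theorem iteratedDeriv_fourier_smooth (θ : ℝ → ℂ) (hθ : ContDiff ℝ ∞ θ)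
    (hc : HasCompactSupport θ) (n : ℕ) :
    iteratedDeriv n (𝓕 θ) = 𝓕 (fun ξ => (-2 * Real.pi * Complex.I * ξ) ^ n * θ ξ) := by
  refine Real.iteratedDeriv_fourier (N := ⊤) (fun m _ => ?_) le_top
  refine Continuous.integrable_of_hasCompactSupport ?_ ?_
  · exact (continuous_id.pow m).smul hθ.continuous
  · exact hc.smul_left (f := fun x : ℝ => x ^ m)

/-- The two factors i in (∂ₓη)² turn the sign of the gradient term; hence the plus sign in front of
7/48 in `nonlin`. -/
theorem conv_I_mul (f : ℝ → ℂ) (ξ : ℝ) :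
    conv (fun ζ => Complex.I * f ζ) (fun ζ => Complex.I * f ζ) ξ = -conv f f ξ := by
  rw [conv, conv, ← integral_neg]
  refine integral_congr_ae (Eventually.of_forall fun ζ => ?_)
  linear_combination (f ζ * f (ξ - ζ)) * Complex.I_mul_I

theorem integrable_mul_of_hasCompactSupport {G θ : ℝ → ℂ} (hG : Integrable G)
    (hθ : Continuous θ) (hc : HasCompactSupport θ) : Integrable (fun ξ => G ξ * θ ξ) := by
  obtain ⟨C, hC⟩ := hθ.bounded_above_of_compact_support hc
  exact hG.mul_bdd (c := C) hθ.aestronglyMeasurable (Eventually.of_forall hC)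

theorem fourier_linear_combination {f g h : ℝ → ℂ} (c d : ℂ) (hf : Integrable f)
    (hg : Integrable g) (hh : Integrable h) (x : ℝ) :
    𝓕 (fun ξ => f ξ + c * g ξ + d * h ξ) x = 𝓕 f x + c * 𝓕 g x + d * 𝓕 h x := by
  have i1 := (Real.fourierIntegral_convergent_iff (μ := volume) x).2 hf
  have i2 := (Real.fourierIntegral_convergent_iff (μ := volume) x).2 hg
  have i3 := (Real.fourierIntegral_convergent_iff (μ := volume) x).2 hh
  simp only [Real.fourier_eq]
  rw [← integral_const_mul, ← integral_const_mul, ← integral_add i1 (i2.const_mul c),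
    ← integral_add]
  · refine integral_congr_ae (Eventually.of_forall fun y => ?_)
    simp only [Circle.smul_def, smul_eq_mul]
    ring
  · exact i1.add (i2.const_mul c)
  · exact i3.const_mul d

theorem integral_linear_combination {f₁ f₂ f₃ f₄ f₅ : ℝ → ℂ} (c₂ c₃ c₄ c₅ : ℂ)
    (h₁ : Integrable f₁) (h₂ : Integrable f₂) (h₃ : Integrable f₃) (h₄ : Integrable f₄)
    (h₅ : Integrable f₅) :
    ∫ x, (f₁ x + c₂ * f₂ x + c₃ * f₃ x + c₄ * f₄ x + c₅ * f₅ x)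
      = (∫ x, f₁ x) + c₂ * (∫ x, f₂ x) + c₃ * (∫ x, f₃ x) + c₄ * (∫ x, f₄ x)
        + c₅ * (∫ x, f₅ x) := by
  have k₂ := h₂.const_mul c₂
  have k₃ := h₃.const_mul c₃
  have k₄ := h₄.const_mul c₄
  have k₅ := h₅.const_mul c₅
  have l₂ : Integrable fun x => f₁ x + c₂ * f₂ x := h₁.add k₂
  have l₃ : Integrable fun x => f₁ x + c₂ * f₂ x + c₃ * f₃ x := l₂.add k₃
  have l₄ : Integrable fun x => f₁ x + c₂ * f₂ x + c₃ * f₃ x + c₄ * f₄ x := l₃.add k₄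
  rw [integral_add l₄ k₅, integral_add l₃ k₄, integral_add l₂ k₃, integral_add h₁ k₂]
  simp only [integral_const_mul]

/-- The equation on the Fourier side, tested against smooth compactly supported functions. -/
theorem IsSolution.hasDerivWithinAt_hat {γ γ₁ γ₂ δ₁ δ₂ T : ℝ} {η₀ : L2} {η : ℝ → L2}
    (hsol : IsSolution γ γ₁ γ₂ δ₁ δ₂ T η₀ η)
    (hη : ∀ t ∈ Icc 0 T, HasFourier (η t) (hat (η t)))
    (hdx : ∀ t ∈ Icc 0 T, HasFourier (dx (η t)) (fun ξ => Complex.I * kmul (hat (η t)) ξ))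
    (θ : ℝ → ℂ) (hθ : ContDiff ℝ ∞ θ) (hc : HasCompactSupport θ) {t : ℝ} (ht : t ∈ Icc 0 T) :
    HasDerivWithinAt (fun r => ∫ ξ, hat (η r) ξ * ((symb γ₁ δ₁ ξ : ℂ) * θ ξ))
      (∫ ξ, rhs γ γ₂ δ₂ (hat (η t)) ξ * θ ξ) (Icc 0 T) t := by
  -- `q n` is the factor that n derivatives of 𝓕 θ put in front of θ.
  let q : ℕ → ℝ → ℂ := fun n ξ => (-2 * Real.pi * Complex.I * ξ) ^ n
  have hq : ∀ n, ContDiff ℝ ∞ (q n) := fun n =>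
    (contDiff_const.mul Complex.ofRealCLM.contDiff).pow n
  let S : (p : ℝ → ℂ) → ContDiff ℝ ∞ p → 𝓢(ℝ, ℂ) := fun p hp => schwartzMul p θ hp hθ hc
  let Θ : 𝓢(ℝ, ℂ) := HasCompactSupport.toSchwartzMap hc hθ
  -- With the test function 𝓕 θ in x, each pairing in the equation becomes a pairing with θ in ξ.
  let φ : 𝓢(ℝ, ℂ) := 𝓕 Θ
  have hφ : (φ : ℝ → ℂ) = 𝓕 θ := rfl
  have hq0 : ∀ x, φ x = 𝓕 (fun ξ => q 0 ξ * θ ξ) x := fun x => by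
    rw [hφ]; simp [q]
  have hqn : ∀ n x, iteratedDeriv n φ x = 𝓕 (fun ξ => q n ξ * θ ξ) x := fun n x => by
    rw [hφ, iteratedDeriv_fourier_smooth θ hθ hc]
  have hqd : ∀ x, deriv φ x = 𝓕 (fun ξ => q 1 ξ * θ ξ) x := fun x => by
    rw [← hqn, iteratedDeriv_one]
  have hqi : ∀ n, Integrable (fun ξ => q n ξ * θ ξ) := fun n => (S (q n) (hq n)).integrable
  -- the three linear combinations of derivatives of `φ` which occur
  let pA : ℝ → ℂ := fun ξ => q 0 ξ - γ₁ * q 2 ξ + δ₁ * q 4 ξ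
  let pB : ℝ → ℂ := fun ξ => q 1 ξ + γ₂ * q 3 ξ + δ₂ * q 5 ξ
  have hpA : ContDiff ℝ ∞ pA :=
    ((hq 0).sub (contDiff_const.mul (hq 2))).add (contDiff_const.mul (hq 4))
  have hpB : ContDiff ℝ ∞ pB :=
    ((hq 1).add (contDiff_const.mul (hq 3))).add (contDiff_const.mul (hq 5))
  have hA : ∀ x, 𝓕 (S pA hpA : ℝ → ℂ) x
      = φ x - γ₁ * iteratedDeriv 2 φ x + δ₁ * iteratedDeriv 4 φ x := by
    intro x
    have := fourier_linear_combination (-γ₁ : ℂ) (δ₁ : ℂ) (hqi 0) (hqi 2) (hqi 4) x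
    rw [hq0, hqn, hqn, sub_eq_add_neg, ← neg_mul, ← this]
    refine congrArg (fun f : ℝ → ℂ => 𝓕 f x) (funext fun ξ => ?_)
    change pA ξ * θ ξ = _
    simp only [pA]; ring
  have hB : ∀ x, 𝓕 (S pB hpB : ℝ → ℂ) x
      = deriv φ x + γ₂ * iteratedDeriv 3 φ x + δ₂ * iteratedDeriv 5 φ x := by
    intro x
    have := fourier_linear_combination (γ₂ : ℂ) (δ₂ : ℂ) (hqi 1) (hqi 3) (hqi 5) x
    rw [hqd, hqn, hqn, ← this]
    refine congrArg (fun f : ℝ → ℂ => 𝓕 f x) (funext fun ξ => ?_)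
    change pB ξ * θ ξ = _
    simp only [pB]; ring
  have hC : ∀ x, 𝓕 (S (q 1) (hq 1) : ℝ → ℂ) x = deriv φ x := fun x => (hqd x).symm
  have hD : ∀ x, 𝓕 (S (q 3) (hq 3) : ℝ → ℂ) x = iteratedDeriv 3 φ x := fun x => (hqn 3 x).symm
  have hre := hsol.equation (SchwartzMap.postcompCLM Complex.reCLM φ) t ht
  have him := hsol.equation (SchwartzMap.postcompCLM Complex.imCLM φ) t ht
  simp only [← iteratedDeriv_one, iteratedDeriv_clm_comp] at hre him
  simp only [iteratedDeriv_one] at hre him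
  have h := hre.ofReal_comp.add ((him.ofReal_comp).const_mul Complex.I)
  have h1 := (hη t ht)
  have h2 : HasFourier (fun x => η t x ^ 2) (conv (hat (η t)) (hat (η t))) := by simpa only [sq] using h1.mul h1
  have h3 : HasFourier (fun x => η t x ^ 3)
      (conv (hat (η t)) (conv (hat (η t)) (hat (η t)))) := by
    simpa only [show ∀ y : ℝ, y ^ 3 = y * y ^ 2 from fun y => by ring] using h1.mul h2
  have hd : HasFourier (fun x => dx (η t) x ^ 2)
      (conv (fun ξ => Complex.I * kmul (hat (η t)) ξ) fun ξ => Complex.I * kmul (hat (η t)) ξ) := by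
    simpa only [sq] using (hdx t ht).mul (hdx t ht)
  have e1 := h1.integral_fourier (S pB hpB)
  have e2 := h2.integral_fourier (S (q 1) (hq 1))
  have e2' := h2.integral_fourier (S (q 3) (hq 3))
  have e3 := h3.integral_fourier (S (q 1) (hq 1))
  have ed := hd.integral_fourier (S (q 1) (hq 1))
  simp only [hB, hC, hD, Complex.add_re, Complex.add_im, Complex.re_ofReal_mul,
    Complex.im_ofReal_mul] at e1 e2 e2' e3 ed
  have hL : ∀ r ∈ Icc 0 T, ∫ ξ, hat (η r) ξ * ((symb γ₁ δ₁ ξ : ℂ) * θ ξ)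
      = ((∫ x, η r x * ((φ x).re - γ₁ * (iteratedDeriv 2 φ x).re
          + δ₁ * (iteratedDeriv 4 φ x).re) : ℝ) : ℂ)
        + Complex.I * ((∫ x, η r x * ((φ x).im - γ₁ * (iteratedDeriv 2 φ x).im
          + δ₁ * (iteratedDeriv 4 φ x).im) : ℝ) : ℂ) := fun r hr => by
    have e := (hη r hr).integral_fourier (S pA hpA)
    simp only [hA, Complex.add_re, Complex.add_im, Complex.sub_re, Complex.sub_im,
      Complex.re_ofReal_mul, Complex.im_ofReal_mul] at e
    rw [e]
    refine integral_congr_ae (Eventually.of_forall fun ξ => ?_)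
    change _ = hat (η r) ξ * (pA ξ * θ ξ)
    simp only [symb, pA, q]
    push_cast
    ring_nf
    simp only [Complex.I_sq, Complex.I_pow_four]
    ring
  refine (h.congr hL (hL t ht)).congr_deriv ?_
  simp only [Complex.reCLM_apply, Complex.imCLM_apply]
  push_cast
  have hS : ∀ (p : ℝ → ℂ) (hp : ContDiff ℝ ∞ p) {G : ℝ → ℂ}, Integrable G →
      Integrable fun ξ => G ξ * S p hp ξ := fun p hp G hG =>
    integrable_mul_of_hasCompactSupport hG (S p hp).continuous hc.mul_left
  have key := integral_linear_combination (3 / 4 : ℂ) (γ : ℂ) (-7 / 48 : ℂ) (-1 / 8 : ℂ)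
    (hS pB hpB h1.1) (hS (q 1) (hq 1) h2.1) (hS (q 3) (hq 3) h2.1) (hS (q 1) (hq 1) hd.1)
    (hS (q 1) (hq 1) h3.1)
  symm
  refine Eq.trans (Eq.trans ?_ key) ?_
  · refine integral_congr_ae (Eventually.of_forall fun ξ => ?_)
    simp only [rhs, nonlin, conv_I_mul]
    change _ = hat (η t) ξ * (pB ξ * θ ξ) + 3 / 4 * (conv _ _ ξ * (q 1 ξ * θ ξ))
      + γ * (conv _ _ ξ * (q 3 ξ * θ ξ)) + -7 / 48 * (-conv _ _ ξ * (q 1 ξ * θ ξ))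
      + -1 / 8 * (conv _ _ ξ * (q 1 ξ * θ ξ))
    simp only [pB, q]
    push_cast
    ring_nf
    simp only [show Complex.I ^ 3 = -Complex.I from Complex.I_pow_three,
      show Complex.I ^ 5 = Complex.I by rw [pow_succ, Complex.I_pow_four, one_mul]]
    ring
  · rw [← e1, ← e2, ← e2', ← e3, ← ed]
    ring

/-! ### From weak to strong derivatives -/

/-- A weak derivative, tested on a dense set, which is continuous is a strong derivative. -/
theorem hasDerivWithinAt_of_weak {X : Type*} [NormedAddCommGroup X] [InnerProductSpace ℂ X]
    [NormedSpace ℝ X] [IsScalarTower ℝ ℂ X]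
    {D : Set X} (hD : Dense D) {u h : ℝ → X} {I : Set ℝ} (hI : Convex ℝ I)
    (hh : ContinuousOn h I)
    (hw : ∀ d ∈ D, ∀ t ∈ I,
      HasDerivWithinAt (fun r => inner ℂ d (u r)) (inner ℂ d (h t)) I t)
    {t : ℝ} (ht : t ∈ I) : HasDerivWithinAt u (h t) I t := by
  rw [hasDerivWithinAt_iff_isLittleO, Asymptotics.isLittleO_iff]
  intro c hc
  obtain ⟨δ, hδ, hδ'⟩ := Metric.continuousOn_iff.1 hh t ht c hc
  filter_upwards [inter_mem_nhdsWithin I (Metric.ball_mem_nhds t hδ)] with r hr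
  set s := I ∩ Metric.ball t δ
  have hs : Convex ℝ s := hI.inter (convex_ball t δ)
  have hts : t ∈ s := ⟨ht, Metric.mem_ball_self hδ⟩
  set v := u r - u t - (r - t) • h t
  -- Mean value inequality for the scalar function z ↦ ⟨d, u z⟩ - z⟨d, h t⟩. The bound depends on
  -- `d` only through its norm, so it survives passage to the closure of `D`.
  have key : ∀ d ∈ D, ‖inner ℂ d v‖ ≤ ‖d‖ * c * ‖r - t‖ := by
    intro d hd
    have hder : ∀ z ∈ s, HasDerivWithinAt
        (fun z : ℝ => inner ℂ d (u z) - z * inner ℂ d (h t)) (inner ℂ d (h z - h t)) s z := by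
      intro z hz
      have h1 := (hw d hd z hz.1).mono (inter_subset_left : s ⊆ I)
      have h2 : HasDerivWithinAt (fun z : ℝ => (z : ℂ) * inner ℂ d (h t))
          (1 * inner ℂ d (h t)) s z :=
        (Complex.ofRealCLM.hasDerivAt.hasDerivWithinAt).mul_const _
      rw [inner_sub_right]
      have h3 := h1.sub h2
      rw [one_mul] at h3
      exact h3
    have hb : ∀ z ∈ s, ‖inner ℂ d (h z - h t)‖ ≤ ‖d‖ * c := by
      intro z hz
      refine (norm_inner_le_norm _ _).trans (mul_le_mul_of_nonneg_left ?_ (norm_nonneg _))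
      rw [← dist_eq_norm]
      exact (hδ' z hz.1 hz.2).le
    have := hs.norm_image_sub_le_of_norm_hasDerivWithin_le hder hb hts hr
    have h3 : (r - t) • h t = ((r - t : ℝ) : ℂ) • h t := (RCLike.real_smul_eq_coe_smul _ _)
    have h4 : inner ℂ d v = inner ℂ d (u r) - r * inner ℂ d (h t)
        - (inner ℂ d (u t) - t * inner ℂ d (h t)) := by
      rw [show v = u r - u t - ((r - t : ℝ) : ℂ) • h t by rw [← h3], inner_sub_right,
        inner_sub_right, inner_smul_right]
      push_cast
      ring
    rw [h4]
    exact this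
  have all : ∀ d : X, ‖inner ℂ d v‖ ≤ ‖d‖ * c * ‖r - t‖ := by
    have hcl : IsClosed {d : X | ‖inner ℂ d v‖ ≤ ‖d‖ * c * ‖r - t‖} := by
      refine isClosed_le ?_ ?_
      · exact (continuous_id.inner continuous_const).norm
      · fun_prop
    intro d
    exact hcl.closure_subset_iff.2 key (hD d)
  -- By density the remainder `v` may be tested against itself, which recovers its norm.
  have hv := all v
  rw [inner_self_eq_norm_sq_to_K] at hv
  by_cases h0 : ‖v‖ = 0
  · rw [h0]; positivity
  · have hpos : 0 < ‖v‖ := lt_of_le_of_ne (norm_nonneg _) (Ne.symm h0)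
    have : ‖v‖ * ‖v‖ ≤ ‖v‖ * (c * ‖r - t‖) := by
      simpa [sq, mul_assoc] using hv
    exact le_of_mul_le_mul_left this hpos

/-! ### `L²` norms, convolutions and trilinear forms -/

/-- The `L²` norm. -/
def n2 (f : ℝ → ℂ) : ℝ := (eLpNorm f 2 volume).toReal

theorem n2_nonneg (f : ℝ → ℂ) : 0 ≤ n2 f := ENNReal.toReal_nonneg

theorem integral_norm_sq_eq {f : ℝ → ℂ} (hf : MemLp f 2) : ∫ ξ, ‖f ξ‖ ^ 2 = n2 f ^ 2 := by
  have h := hf.eLpNorm_eq_integral_rpow_norm (by norm_num) (by norm_num)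
  have h0 : 0 ≤ ∫ ξ, ‖f ξ‖ ^ 2 := integral_nonneg fun ξ => by positivity
  rw [n2, h, ENNReal.toReal_ofReal (by positivity)]
  simp only [ENNReal.toReal_ofNat, Real.rpow_two]
  rw [← Real.rpow_natCast, ← Real.rpow_mul h0]
  norm_num

theorem n2_add_le {f g : ℝ → ℂ} (hf : MemLp f 2) (hg : MemLp g 2) :
    n2 (fun ξ => f ξ + g ξ) ≤ n2 f + n2 g := by
  rw [n2, n2, n2, ← ENNReal.toReal_add hf.2.ne hg.2.ne]
  exact ENNReal.toReal_mono (ENNReal.add_ne_top.2 ⟨hf.2.ne, hg.2.ne⟩)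
    (eLpNorm_add_le hf.1 hg.1 (by norm_num))

theorem memLp_of_norm_le {f F : ℝ → ℂ} {m : ℝ} (hf : AEStronglyMeasurable f)
    (hF : MemLp F 2) (h : ∀ ξ, ‖f ξ‖ ≤ m * ‖F ξ‖) : MemLp f 2 :=
  hF.of_le_mul hf (Eventually.of_forall h)

theorem n2_le_of_norm_le {f F : ℝ → ℂ} {m : ℝ} (hm : 0 ≤ m)
    (hF : MemLp F 2) (h : ∀ ξ, ‖f ξ‖ ≤ m * ‖F ξ‖) : n2 f ≤ m * n2 F := by
  have := eLpNorm_le_mul_eLpNorm_of_ae_le_mul (p := 2) (μ := volume) (Eventually.of_forall h)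
  rw [n2, n2, ← ENNReal.toReal_ofReal hm, ← ENNReal.toReal_mul]
  exact ENNReal.toReal_mono (ENNReal.mul_ne_top ENNReal.ofReal_ne_top hF.2.ne) this

theorem integrable_mul_of_memLp {f g : ℝ → ℂ} (hf : MemLp f 2) (hg : MemLp g 2) :
    Integrable (fun ξ => f ξ * g ξ) := hf.integrable_mul hg

theorem integral_norm_mul_le {f g : ℝ → ℂ} (hf : MemLp f 2) (hg : MemLp g 2) :
    ∫ ξ, ‖f ξ * g ξ‖ ≤ n2 f * n2 g := by
  have h := integral_mul_norm_le_Lp_mul_Lq (μ := volume) (f := f) (g := g)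
    Real.HolderConjugate.two_two (by simpa using hf) (by simpa using hg)
  simp only [norm_mul]
  refine h.trans (le_of_eq ?_)
  have e : ∀ {k : ℝ → ℂ}, MemLp k 2 → (∫ a, ‖k a‖ ^ (2 : ℝ)) ^ (1 / 2 : ℝ) = n2 k := by
    intro k hk
    simp only [Real.rpow_two]
    rw [integral_norm_sq_eq hk, ← Real.sqrt_eq_rpow, Real.sqrt_sq (n2_nonneg k)]
  rw [e hf, e hg]

theorem memLp_comp_sub_left {g : ℝ → ℂ} (hg : MemLp g 2) (ξ : ℝ) :
    MemLp (fun ζ => g (ξ - ζ)) 2 :=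
  hg.comp_measurePreserving (Measure.measurePreserving_sub_left volume ξ)

theorem n2_comp_sub_left {g : ℝ → ℂ} (hg : MemLp g 2) (ξ : ℝ) :
    n2 (fun ζ => g (ξ - ζ)) = n2 g := by
  rw [n2, n2]
  congr 1
  exact eLpNorm_comp_measurePreserving hg.1 (Measure.measurePreserving_sub_left volume ξ)

theorem integrable_conv_integrand {f g : ℝ → ℂ} (hf : MemLp f 2) (hg : MemLp g 2) (ξ : ℝ) :
    Integrable (fun ζ => f ζ * g (ξ - ζ)) :=
  integrable_mul_of_memLp hf (memLp_comp_sub_left hg ξ)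

theorem norm_conv_le {f g : ℝ → ℂ} (hf : MemLp f 2) (hg : MemLp g 2) (ξ : ℝ) :
    ‖conv f g ξ‖ ≤ n2 f * n2 g := by
  refine (norm_integral_le_integral_norm _).trans ?_
  have := integral_norm_mul_le hf (memLp_comp_sub_left hg ξ)
  rwa [n2_comp_sub_left hg] at this

theorem conv_comm (f g : ℝ → ℂ) (ξ : ℝ) : conv f g ξ = conv g f ξ := by
  rw [conv, conv, ← integral_sub_left_eq_self _ volume ξ]
  refine integral_congr_ae (Eventually.of_forall fun ζ => ?_)
  simp [mul_comm]

theorem norm_conv_le_of_bounded {f g : ℝ → ℂ} {B : ℝ} (hf : Integrable f)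
    (hg : ∀ ξ, ‖g ξ‖ ≤ B) (ξ : ℝ) : ‖conv f g ξ‖ ≤ (∫ ζ, ‖f ζ‖) * B := by
  rw [← integral_mul_const]
  refine norm_integral_le_of_norm_le (hf.norm.mul_const B) (Eventually.of_forall fun ζ => ?_)
  rw [norm_mul]
  exact mul_le_mul_of_nonneg_left (hg _) (norm_nonneg _)

theorem memLp_two_of_integrable_of_bounded {f : ℝ → ℂ} {B : ℝ} (hf : Integrable f)
    (hB : ∀ ξ, ‖f ξ‖ ≤ B) : MemLp f 2 := by
  rw [memLp_two_iff_integrable_sq_norm hf.1]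
  refine (hf.norm.const_mul B).mono' (hf.1.norm.pow 2) (Eventually.of_forall fun ξ => ?_)
  rw [Real.norm_of_nonneg (by positivity), sq]
  exact mul_le_mul_of_nonneg_right (hB ξ) (norm_nonneg _)

theorem memLp_conv {f g : ℝ → ℂ} (hf : Integrable f) (hg : Integrable g) (hf2 : MemLp f 2)
    (hg2 : MemLp g 2) : MemLp (conv f g) 2 :=
  memLp_two_of_integrable_of_bounded (integrable_conv hf hg) (norm_conv_le hf2 hg2)

/-- The integrand of the trilinear form `∬ f(x) g(y) h(-x-y) dx dy`. -/
def tri (f g h : ℝ → ℂ) (p : ℝ × ℝ) : ℂ := f p.1 * g p.2 * h (-p.1 - p.2)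

/-- On the plane x + y + z = 0 this map exchanges the second and third frequencies. Together with
the coordinate swap it generates all permutations of the arguments of `J`. -/
theorem measurePreserving_third :
    MeasurePreserving (fun p : ℝ × ℝ => (p.1, -p.1 - p.2)) (volume.prod volume)
      (volume.prod volume) := by
  refine (MeasurePreserving.id volume).skew_product (g := fun x y => -x - y) (by fun_prop)
    (Eventually.of_forall fun x => ?_)
  exact (Measure.measurePreserving_sub_left volume (-x)).map_eq

/-- Passes to the convolution variables (ζ, ξ - ζ), in which the trilinear form is a pairing with a
convolution. -/
theorem measurePreserving_shear :
    MeasurePreserving (fun p : ℝ × ℝ => (p.1, p.2 - p.1)) (volume.prod volume)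
      (volume.prod volume) := by
  refine (MeasurePreserving.id volume).skew_product (g := fun x y => y - x) (by fun_prop)
    (Eventually.of_forall fun x => ?_)
  exact (measurePreserving_sub_right volume x).map_eq

theorem integral_comp_eq_of_measurePreserving {φ : ℝ × ℝ → ℝ × ℝ} {F : ℝ × ℝ → ℂ}
    (hφ : MeasurePreserving φ (volume.prod volume) (volume.prod volume))
    (hF : AEStronglyMeasurable F (volume.prod volume)) : ∫ p, F (φ p) = ∫ p, F p := by
  have := integral_map (f := F) hφ.measurable.aemeasurable (by rw [hφ.map_eq]; exact hF)
  rw [hφ.map_eq] at this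
  exact this.symm

theorem tri_third (f g h : ℝ → ℂ) (p : ℝ × ℝ) :
    tri f g h (p.1, -p.1 - p.2) = tri f h g p := by
  simp only [tri]
  rw [show -p.1 - (-p.1 - p.2) = p.2 by ring]
  ring

theorem tri_swap (f g h : ℝ → ℂ) (p : ℝ × ℝ) : tri f g h p.swap = tri g f h p := by
  simp only [tri, Prod.fst_swap, Prod.snd_swap]
  rw [show -p.2 - p.1 = -p.1 - p.2 by ring]
  ring

theorem integrable_tri_third {f g h : ℝ → ℂ} (hi : Integrable (tri f g h)) :
    Integrable (tri f h g) := by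
  have := measurePreserving_third.integrable_comp_of_integrable hi
  exact this.congr (Eventually.of_forall fun p => tri_third f g h p)

theorem integrable_tri_swap {f g h : ℝ → ℂ} (hi : Integrable (tri f g h)) :
    Integrable (tri g f h) := by
  have := (Measure.measurePreserving_swap (μ := (volume : Measure ℝ))
    (ν := (volume : Measure ℝ))).integrable_comp_of_integrable hi
  exact this.congr (Eventually.of_forall fun p => tri_swap f g h p)

/-- The trilinear form `∬ f(x) g(y) h(-x-y) dx dy`. -/
def J (f g h : ℝ → ℂ) : ℂ := ∫ p, tri f g h p

theorem J_third {f g h : ℝ → ℂ} (hi : Integrable (tri f g h)) : J f h g = J f g h := by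
  rw [J, J]
  simp_rw [← tri_third f g h]
  exact integral_comp_eq_of_measurePreserving measurePreserving_third hi.1

theorem J_swap (f g h : ℝ → ℂ) : J g f h = J f g h := by
  rw [J, J]
  simp_rw [← tri_swap f g h]
  exact integral_prod_swap (tri f g h)

theorem aestronglyMeasurable_tri {f g h : ℝ → ℂ} (hf : AEStronglyMeasurable f)
    (hg : AEStronglyMeasurable g) (hh : AEStronglyMeasurable h) :
    AEStronglyMeasurable (tri f g h) := by
  have h3 : AEStronglyMeasurable (fun p : ℝ × ℝ => h (-p.1 - p.2)) (volume.prod volume) :=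
    (hh.comp_snd (μ := (volume : Measure ℝ))).comp_quasiMeasurePreserving
      measurePreserving_third.quasiMeasurePreserving
  exact ((hf.comp_fst (ν := (volume : Measure ℝ))).mul
    (hg.comp_snd (μ := (volume : Measure ℝ)))).mul h3

theorem integral_norm_tri_slice_le {f g h : ℝ → ℂ} (hg : MemLp g 2) (hh : MemLp h 2) (x : ℝ) :
    ∫ y, ‖tri f g h (x, y)‖ ≤ ‖f x‖ * (n2 g * n2 h) := by
  have h1 := integral_norm_mul_le hg (memLp_comp_sub_left hh (-x))
  rw [n2_comp_sub_left hh] at h1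
  refine le_trans (le_of_eq ?_) (mul_le_mul_of_nonneg_left h1 (norm_nonneg (f x)))
  rw [← integral_const_mul]
  refine integral_congr_ae (Eventually.of_forall fun y => ?_)
  simp [tri, mul_assoc]

theorem integrable_tri {f g h : ℝ → ℂ} (hf : Integrable f) (hg : MemLp g 2) (hh : MemLp h 2) :
    Integrable (tri f g h) := by
  have hm := aestronglyMeasurable_tri hf.1 hg.1 hh.1
  refine (integrable_prod_iff hm).2 ⟨Eventually.of_forall fun x => ?_, ?_⟩
  · have := (integrable_mul_of_memLp hg (memLp_comp_sub_left hh (-x))).const_mul (f x)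
    refine this.congr (Eventually.of_forall fun y => ?_)
    simp [tri, mul_assoc]
  · refine (hf.norm.mul_const (n2 g * n2 h)).mono' ?_ (Eventually.of_forall fun x => ?_)
    · exact hm.norm.integral_prod_right'
    · rw [Real.norm_of_nonneg (integral_nonneg fun y => norm_nonneg _)]
      exact integral_norm_tri_slice_le hg hh x

theorem norm_J_le {f g h : ℝ → ℂ} (hf : Integrable f) (hg : MemLp g 2) (hh : MemLp h 2) :
    ‖J f g h‖ ≤ (∫ x, ‖f x‖) * (n2 g * n2 h) := by
  have hi := (integrable_tri hf hg hh).norm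
  refine (norm_integral_le_integral_norm _).trans ?_
  rw [← integral_mul_const]
  refine le_trans (le_of_eq (integral_prod _ hi)) ?_
  refine integral_mono hi.integral_prod_left (hf.norm.mul_const _) fun x => ?_
  exact integral_norm_tri_slice_le hg hh x

theorem tri_shear (f g h : ℝ → ℂ) (p : ℝ × ℝ) :
    tri f g h (p.1, p.2 - p.1) = h (-p.2) * (f p.1 * g (p.2 - p.1)) := by
  simp only [tri]
  rw [show -p.1 - (p.2 - p.1) = -p.2 by ring]
  ring

theorem integrable_tri_shear {f g h : ℝ → ℂ} (hi : Integrable (tri f g h)) :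
    Integrable (fun p : ℝ × ℝ => h (-p.2) * (f p.1 * g (p.2 - p.1)))
      (volume.prod volume) := by
  have := measurePreserving_shear.integrable_comp_of_integrable hi
  exact this.congr (Eventually.of_forall fun p => tri_shear f g h p)

theorem integrable_mul_conv {f g h : ℝ → ℂ} (hi : Integrable (tri f g h)) :
    Integrable (fun ξ => h (-ξ) * conv f g ξ) := by
  refine (integrable_tri_shear hi).integral_prod_right.congr (Eventually.of_forall fun ξ => ?_)
  simp only [conv, integral_const_mul]

theorem integral_mul_conv {f g h : ℝ → ℂ} (hi : Integrable (tri f g h)) :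
    ∫ ξ, h (-ξ) * conv f g ξ = J f g h := by
  have h1 : J f g h = ∫ p : ℝ × ℝ, h (-p.2) * (f p.1 * g (p.2 - p.1)) := by
    rw [J]
    simp_rw [← tri_shear f g h]
    exact (integral_comp_eq_of_measurePreserving measurePreserving_shear hi.1).symm
  rw [h1]
  refine Eq.trans ?_ (integral_prod_symm _ (integrable_tri_shear hi)).symm
  simp only [conv, integral_const_mul]

/-- The Leibniz rule for the trilinear form. -/
theorem J_kmul {f g h : ℝ → ℂ} (h1 : Integrable (tri (kmul f) g h))
    (h2 : Integrable (tri f (kmul g) h)) (h3 : Integrable (tri f g (kmul h))) :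
    J (kmul f) g h + J f (kmul g) h + J f g (kmul h) = 0 := by
  have h12 : Integrable fun p => tri (kmul f) g h p + tri f (kmul g) h p := h1.add h2
  rw [J, J, J, ← integral_add h1 h2, ← integral_add h12 h3]
  -- The three frequencies sum to zero, so the integrand vanishes pointwise.
  refine integral_eq_zero_of_ae (Eventually.of_forall fun p => ?_)
  simp only [tri, kmul, Pi.zero_apply]
  push_cast
  ring

/-- Leibniz rule: the frequency ξ is the sum of ζ and ξ - ζ under the convolution integral. -/
theorem kmul_conv {f g : ℝ → ℂ} (hf : MemLp f 2) (hg : MemLp g 2) (hkf : MemLp (kmul f) 2)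
    (hkg : MemLp (kmul g) 2) (ξ : ℝ) :
    kmul (conv f g) ξ = conv (kmul f) g ξ + conv f (kmul g) ξ := by
  rw [conv, conv, ← integral_add (integrable_conv_integrand hkf hg ξ)
    (integrable_conv_integrand hf hkg ξ), kmul, conv, ← integral_const_mul]
  refine integral_congr_ae (Eventually.of_forall fun ζ => ?_)
  simp only [kmul]
  push_cast
  ring

theorem kmul_conv_self {f : ℝ → ℂ} (hf : MemLp f 2) (hkf : MemLp (kmul f) 2) (ξ : ℝ) :
    kmul (conv f f) ξ = 2 * conv (kmul f) f ξ := by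
  rw [kmul_conv hf hf hkf hkf, conv_comm f]
  ring

/-! ### Weights -/

/-- The square `1 + k²` of the Japanese bracket at `k = 2πξ`. -/
def brk (ξ : ℝ) : ℝ := 1 + (2 * Real.pi * ξ) ^ 2

theorem one_le_brk (ξ : ℝ) : 1 ≤ brk ξ := by
  rw [brk]; nlinarith [sq_nonneg (2 * Real.pi * ξ)]

theorem brk_pos (ξ : ℝ) : 0 < brk ξ := one_pos.trans_le (one_le_brk ξ)

theorem continuous_brk : Continuous brk := by unfold brk; fun_prop

/-- The Japanese bracket `(1 + k²)^{1/2}` at `k = 2πξ`. -/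
def jb (ξ : ℝ) : ℝ := Real.sqrt (brk ξ)

theorem jb_mul_self (ξ : ℝ) : jb ξ * jb ξ = brk ξ := Real.mul_self_sqrt (brk_pos ξ).le

theorem one_le_jb (ξ : ℝ) : 1 ≤ jb ξ := Real.one_le_sqrt.2 (one_le_brk ξ)

theorem jb_pos (ξ : ℝ) : 0 < jb ξ := one_pos.trans_le (one_le_jb ξ)

theorem continuous_jb : Continuous jb := continuous_brk.sqrt

theorem abs_k_le_jb (ξ : ℝ) : |2 * Real.pi * ξ| ≤ jb ξ := by
  apply Real.abs_le_sqrt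
  rw [brk]; linarith

/-- The function `ξ ↦ ⟨k⟩⁻¹`. -/
def jbInv (ξ : ℝ) : ℂ := ((jb ξ)⁻¹ : ℝ)

theorem norm_jbInv (ξ : ℝ) : ‖jbInv ξ‖ = (jb ξ)⁻¹ := by
  rw [jbInv, Complex.norm_real, Real.norm_of_nonneg (inv_nonneg.2 (jb_pos ξ).le)]

theorem memLp_jbInv : MemLp jbInv 2 := by
  have hc : Continuous jbInv :=
    Complex.continuous_ofReal.comp (continuous_jb.inv₀ fun ξ => (jb_pos ξ).ne')
  rw [memLp_two_iff_integrable_sq_norm hc.aestronglyMeasurable]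
  have h := integrable_inv_one_add_sq.comp_mul_left' (R := 2 * Real.pi) (by positivity)
  refine h.congr (Eventually.of_forall fun ξ => ?_)
  simp only [norm_jbInv]
  rw [inv_pow, sq (jb ξ), jb_mul_self, brk]

/-- The norm of `⟨k⟩⁻¹` in `L²`. -/
def jbConst : ℝ := n2 jbInv

theorem jbConst_nonneg : 0 ≤ jbConst := n2_nonneg _

/-- Cauchy–Schwarz against ⟨k⟩⁻¹ ∈ `L²`. This is the one-dimensional Sobolev embedding on the
Fourier side: one spare derivative in `L²` makes the transform integrable. -/
theorem integrable_of_norm_le_jb {f F : ℝ → ℂ} {m : ℝ} (hf : AEStronglyMeasurable f)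
    (hF : MemLp F 2) (h : ∀ ξ, ‖f ξ‖ ≤ m * ((jb ξ)⁻¹ * ‖F ξ‖)) : Integrable f := by
  refine ((integrable_mul_of_memLp memLp_jbInv hF).norm.const_mul m).mono' hf
    (Eventually.of_forall fun ξ => ?_)
  rw [norm_mul, norm_jbInv]
  exact h ξ

theorem integral_norm_le_jb {f F : ℝ → ℂ} {m : ℝ} (hm : 0 ≤ m) (hf : AEStronglyMeasurable f)
    (hF : MemLp F 2) (h : ∀ ξ, ‖f ξ‖ ≤ m * ((jb ξ)⁻¹ * ‖F ξ‖)) :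
    ∫ ξ, ‖f ξ‖ ≤ m * (jbConst * n2 F) := by
  refine le_trans ?_ (mul_le_mul_of_nonneg_left (integral_norm_mul_le memLp_jbInv hF) hm)
  rw [← integral_const_mul]
  refine integral_mono (integrable_of_norm_le_jb hf hF h).norm
    ((integrable_mul_of_memLp memLp_jbInv hF).norm.const_mul m) fun ξ => ?_
  simp only [norm_mul, norm_jbInv]
  exact h ξ

/-- Multiplication by `1 + k²`. -/
def wmul (a : ℝ → ℂ) (ξ : ℝ) : ℂ := (brk ξ : ℂ) * a ξ

theorem norm_wmul (a : ℝ → ℂ) (ξ : ℝ) : ‖wmul a ξ‖ = brk ξ * ‖a ξ‖ := by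
  rw [wmul, norm_mul, Complex.norm_real, Real.norm_of_nonneg (brk_pos ξ).le]

theorem norm_kmul (a : ℝ → ℂ) (ξ : ℝ) : ‖kmul a ξ‖ = |2 * Real.pi * ξ| * ‖a ξ‖ := by
  rw [kmul, norm_mul, Complex.norm_real, Real.norm_eq_abs]

theorem norm_kmul_le (a : ℝ → ℂ) (ξ : ℝ) : ‖kmul a ξ‖ ≤ jb ξ * ‖a ξ‖ := by
  rw [norm_kmul]
  exact mul_le_mul_of_nonneg_right (abs_k_le_jb ξ) (norm_nonneg _)

theorem aestronglyMeasurable_kmul {a : ℝ → ℂ} (ha : AEStronglyMeasurable a) :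
    AEStronglyMeasurable (kmul a) :=
  AEStronglyMeasurable.mul
    (Complex.continuous_ofReal.comp (continuous_const.mul continuous_id)).aestronglyMeasurable ha

theorem aestronglyMeasurable_of_wmul {a : ℝ → ℂ} (ha : AEStronglyMeasurable (wmul a)) :
    AEStronglyMeasurable a := by
  have h : Continuous fun ξ => ((brk ξ)⁻¹ : ℂ) :=
    (Complex.continuous_ofReal.comp continuous_brk).inv₀ fun ξ => by
      simpa using (brk_pos ξ).ne'
  refine (h.aestronglyMeasurable.mul ha).congr (Eventually.of_forall fun ξ => ?_)
  have : (brk ξ : ℂ) ≠ 0 := by exact_mod_cast (brk_pos ξ).ne'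
  simp only [wmul, Pi.mul_apply]
  field_simp

/-- Consequences of a pointwise bound `|f| ≤ m ⟨k⟩ |a|`. -/
theorem bounds_of_le_jb {f a : ℝ → ℂ} {m : ℝ} (hm : 0 ≤ m) (hf : AEStronglyMeasurable f)
    (ha : MemLp (wmul a) 2) (h : ∀ ξ, ‖f ξ‖ ≤ m * (jb ξ * ‖a ξ‖)) :
    MemLp f 2 ∧ MemLp (kmul f) 2 ∧ Integrable f ∧ n2 f ≤ m * n2 (wmul a) ∧
      n2 (kmul f) ≤ m * n2 (wmul a) ∧ ∫ ξ, ‖f ξ‖ ≤ m * (jbConst * n2 (wmul a)) := by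
  have h1 : ∀ ξ, ‖f ξ‖ ≤ m * ((jb ξ)⁻¹ * ‖wmul a ξ‖) := fun ξ => by
    rw [norm_wmul, ← jb_mul_self]
    have := (jb_pos ξ).ne'
    field_simp
    rw [mul_assoc]
    exact h ξ
  have h2 : ∀ ξ, ‖kmul f ξ‖ ≤ m * ‖wmul a ξ‖ := fun ξ => by
    refine (norm_kmul_le f ξ).trans ?_
    rw [norm_wmul, ← jb_mul_self]
    calc jb ξ * ‖f ξ‖ ≤ jb ξ * (m * (jb ξ * ‖a ξ‖)) :=
          mul_le_mul_of_nonneg_left (h ξ) (jb_pos ξ).le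
      _ = _ := by ring
  have h3 : ∀ ξ, ‖f ξ‖ ≤ m * ‖wmul a ξ‖ := fun ξ => by
    refine (h1 ξ).trans (mul_le_mul_of_nonneg_left ?_ hm)
    exact mul_le_of_le_one_left (norm_nonneg _) (inv_le_one_of_one_le₀ (one_le_jb ξ))
  exact ⟨memLp_of_norm_le hf ha h3, memLp_of_norm_le (aestronglyMeasurable_kmul hf) ha h2,
    integrable_of_norm_le_jb hf ha h1, n2_le_of_norm_le hm ha h3, n2_le_of_norm_le hm ha h2,
    integral_norm_le_jb hm hf ha h1⟩

theorem bounds_self {a : ℝ → ℂ} (ha : MemLp (wmul a) 2) :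
    MemLp a 2 ∧ MemLp (kmul a) 2 ∧ Integrable a ∧ n2 a ≤ n2 (wmul a) ∧
      n2 (kmul a) ≤ n2 (wmul a) ∧ ∫ ξ, ‖a ξ‖ ≤ jbConst * n2 (wmul a) := by
  have := bounds_of_le_jb (f := a) zero_le_one (aestronglyMeasurable_of_wmul ha.1) ha fun ξ => by
    rw [one_mul]
    exact le_mul_of_one_le_left (norm_nonneg _) (one_le_jb ξ)
  simpa only [one_mul] using this

theorem bounds_kmul {a : ℝ → ℂ} (ha : MemLp (wmul a) 2) :
    MemLp (kmul a) 2 ∧ MemLp (kmul (kmul a)) 2 ∧ Integrable (kmul a) ∧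
      n2 (kmul a) ≤ n2 (wmul a) ∧ n2 (kmul (kmul a)) ≤ n2 (wmul a) ∧
      ∫ ξ, ‖kmul a ξ‖ ≤ jbConst * n2 (wmul a) := by
  have := bounds_of_le_jb (f := kmul a) zero_le_one
    (aestronglyMeasurable_kmul (aestronglyMeasurable_of_wmul ha.1)) ha fun ξ => by
      rw [one_mul]; exact norm_kmul_le a ξ
  simpa only [one_mul] using this

/-! ### Cancellations -/

/-- This is ∫ u² ∂ₓu = 0: by symmetry the three terms of the Leibniz rule `J_kmul` coincide. -/
theorem J_self_self_kmul {a : ℝ → ℂ} (ha : MemLp (wmul a) 2) : J a a (kmul a) = 0 := by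
  obtain ⟨a2, k2, a1, -⟩ := bounds_self ha
  have i3 : Integrable (tri a a (kmul a)) := integrable_tri a1 a2 k2
  have i2 : Integrable (tri a (kmul a) a) := integrable_tri a1 k2 a2
  have i1 : Integrable (tri (kmul a) a a) := integrable_tri_swap i2
  have h := J_kmul i1 i2 i3
  rw [J_swap a (kmul a) a, J_third i3] at h
  linear_combination h / 3

/-- Corresponds to 2 ∫ u ∂ₓu ∂ₓ²u = -∫ (∂ₓu)³. In the Leibniz rule for the triple (ka, a, ka) the
two terms with a second derivative agree by symmetry. -/
theorem J_kmul_self_kmul_kmul {a : ℝ → ℂ} (ha : MemLp (wmul a) 2) :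
    2 * J (kmul a) a (kmul (kmul a)) = -J (kmul a) (kmul a) (kmul a) := by
  obtain ⟨a2, k2, a1, -⟩ := bounds_self ha
  obtain ⟨-, kk2, k1, -⟩ := bounds_kmul ha
  have i3 : Integrable (tri (kmul a) a (kmul (kmul a))) := integrable_tri k1 a2 kk2
  have i2 : Integrable (tri (kmul a) (kmul a) (kmul a)) := integrable_tri k1 k2 k2
  have i1' : Integrable (tri a (kmul (kmul a)) (kmul a)) := integrable_tri a1 kk2 k2
  have i1 : Integrable (tri (kmul (kmul a)) a (kmul a)) := integrable_tri_swap i1'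
  have h := J_kmul i1 i2 i3
  have e : J (kmul (kmul a)) a (kmul a) = J (kmul a) a (kmul (kmul a)) := by
    rw [J_swap a, J_third (integrable_tri_third i1'), J_swap (kmul a)]
  rw [e] at h
  linear_combination h

/-- This is ∫ u³ ∂ₓu = 0. The Leibniz rule for (a, a, a∗a) has two equal terms, and the third, with
the factor k on a∗a, is the integral of an odd function. -/
theorem J_self_conv_kmul {a : ℝ → ℂ} (ha : MemLp (wmul a) 2) :
    J a (conv a a) (kmul a) = 0 := by
  obtain ⟨a2, k2, a1, -⟩ := bounds_self ha
  obtain ⟨-, -, k1, -⟩ := bounds_kmul ha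
  have A2 : MemLp (conv a a) 2 := memLp_conv a1 a1 a2 a2
  have KA2 : MemLp (kmul (conv a a)) 2 := by
    have : kmul (conv a a) = fun ξ => 2 * conv (kmul a) a ξ := funext (kmul_conv_self a2 k2)
    rw [this]
    exact (memLp_conv k1 a1 k2 a2).const_mul 2
  have i1 : Integrable (tri (kmul a) a (conv a a)) := integrable_tri k1 a2 A2
  have i2 : Integrable (tri a (kmul a) (conv a a)) := integrable_tri a1 k2 A2
  have i3 : Integrable (tri a a (kmul (conv a a))) := integrable_tri a1 a2 KA2
  have h := J_kmul i1 i2 i3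
  have h3 : J a a (kmul (conv a a)) = 0 := by
    rw [← integral_mul_conv i3]
    have : ∫ ξ, kmul (conv a a) (-ξ) * conv a a ξ = -∫ ξ, kmul (conv a a) (-ξ) * conv a a ξ := by
      rw [← integral_neg, ← integral_neg_eq_self]
      refine integral_congr_ae (Eventually.of_forall fun ξ => ?_)
      simp only [kmul]
      push_cast
      ring_nf
    exact self_eq_neg.1 this
  rw [h3, J_swap a (kmul a)] at h
  rw [J_third i2]
  linear_combination h / 2

/-! ### Hyperbolic weights -/

theorem abs_sinh_le_cosh (x : ℝ) : |Real.sinh x| ≤ Real.cosh x := by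
  apply abs_le_of_sq_le_sq _ (Real.cosh_pos x).le
  rw [Real.cosh_sq]; linarith

/-- Mean value inequality between 0 and x, where the derivative cosh is at most cosh x. -/
theorem abs_sinh_le (x : ℝ) : |Real.sinh x| ≤ |x| * Real.cosh x := by
  have h := (convex_Icc (-|x|) |x|).norm_image_sub_le_of_norm_hasDerivWithin_le
    (f := Real.sinh) (f' := Real.cosh) (C := Real.cosh x) (x := 0) (y := x)
    (fun y _ => (Real.hasDerivAt_sinh y).hasDerivWithinAt) (fun y hy => ?_)
    ⟨by simp, by simp⟩ ⟨neg_abs_le x, le_abs_self x⟩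
  · simpa [mul_comm] using h
  · rw [Real.norm_of_nonneg (Real.cosh_pos y).le, Real.cosh_le_cosh]
    exact abs_le.2 hy

/-- Multiplication by `cosh(σk)`. -/
def chmul (σ : ℝ) (g : ℝ → ℂ) (ξ : ℝ) : ℂ := (Real.cosh (σ * (2 * Real.pi * ξ)) : ℂ) * g ξ

/-- Multiplication by `sinh(σk)`. -/
def shmul (σ : ℝ) (g : ℝ → ℂ) (ξ : ℝ) : ℂ := (Real.sinh (σ * (2 * Real.pi * ξ)) : ℂ) * g ξ

theorem norm_chmul (σ : ℝ) (g : ℝ → ℂ) (ξ : ℝ) :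
    ‖chmul σ g ξ‖ = Real.cosh (σ * (2 * Real.pi * ξ)) * ‖g ξ‖ := by
  rw [chmul, norm_mul, Complex.norm_real, Real.norm_of_nonneg (Real.cosh_pos _).le]

/-- The factor σ comes from |sinh y| ≤ |y| cosh y and costs one factor ⟨k⟩. The factor 1, from |sinh
y| ≤ cosh y, keeps later constants uniform for large σ. -/
theorem norm_shmul_le {σ : ℝ} (hσ : 0 ≤ σ) (g : ℝ → ℂ) (ξ : ℝ) :
    ‖shmul σ g ξ‖ ≤ min 1 σ * (jb ξ * ‖chmul σ g ξ‖) := by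
  rw [shmul, norm_mul, Complex.norm_real, Real.norm_eq_abs, norm_chmul]
  set k := 2 * Real.pi * ξ with hk
  have hkj : |k| ≤ jb ξ := abs_k_le_jb ξ
  have hc := Real.cosh_pos (σ * k)
  have h : |Real.sinh (σ * k)| ≤ min 1 σ * jb ξ * Real.cosh (σ * k) := by
    rcases le_total 1 σ with h1 | h1
    · rw [min_eq_left h1, one_mul]
      exact (abs_sinh_le_cosh _).trans (le_mul_of_one_le_left hc.le (one_le_jb ξ))
    · rw [min_eq_right h1]
      refine (abs_sinh_le _).trans (mul_le_mul_of_nonneg_right ?_ hc.le)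
      rw [abs_mul, abs_of_nonneg hσ]
      exact mul_le_mul_of_nonneg_left hkj hσ
  calc _ ≤ min 1 σ * jb ξ * Real.cosh (σ * k) * ‖g ξ‖ :=
        mul_le_mul_of_nonneg_right h (norm_nonneg _)
    _ = _ := by ring

theorem kmul_chmul (σ : ℝ) (g : ℝ → ℂ) : kmul (chmul σ g) = chmul σ (kmul g) := by
  ext ξ; simp only [kmul, chmul]; ring

theorem kmul_shmul (σ : ℝ) (g : ℝ → ℂ) : kmul (shmul σ g) = shmul σ (kmul g) := by
  ext ξ; simp only [kmul, shmul]; ring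

theorem continuous_cosh_weight (σ : ℝ) :
    Continuous fun ξ : ℝ => (Real.cosh (σ * (2 * Real.pi * ξ)) : ℂ) :=
  Complex.continuous_ofReal.comp (Real.continuous_cosh.comp (by fun_prop))

theorem aestronglyMeasurable_of_chmul {σ : ℝ} {g : ℝ → ℂ}
    (h : AEStronglyMeasurable (chmul σ g)) : AEStronglyMeasurable g := by
  have hc := (continuous_cosh_weight σ).inv₀ fun ξ => by
    exact_mod_cast (Real.cosh_pos (σ * (2 * Real.pi * ξ))).ne'
  refine (hc.aestronglyMeasurable.mul h).congr (Eventually.of_forall fun ξ => ?_)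
  have : (Real.cosh (σ * (2 * Real.pi * ξ)) : ℂ) ≠ 0 := by
    exact_mod_cast (Real.cosh_pos (σ * (2 * Real.pi * ξ))).ne'
  simp only [chmul, Pi.mul_apply, Pi.inv_apply]
  exact inv_mul_cancel_left₀ this _

theorem aestronglyMeasurable_shmul {σ : ℝ} {g : ℝ → ℂ} (h : AEStronglyMeasurable g) :
    AEStronglyMeasurable (shmul σ g) :=
  AEStronglyMeasurable.mul (Complex.continuous_ofReal.comp
    (Real.continuous_sinh.comp (by fun_prop : Continuous fun ξ : ℝ => σ * (2 * Real.pi * ξ)))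
    ).aestronglyMeasurable h

/-- The addition formula for cosh under the convolution integral. The sinh–sinh term is exactly the
failure of the weight to commute with products, and it is quadratic in sinh. -/
theorem chmul_conv {σ : ℝ} {f g : ℝ → ℂ} {ξ : ℝ}
    (h1 : Integrable fun ζ => chmul σ f ζ * chmul σ g (ξ - ζ))
    (h2 : Integrable fun ζ => shmul σ f ζ * shmul σ g (ξ - ζ)) :
    chmul σ (conv f g) ξ = conv (chmul σ f) (chmul σ g) ξ + conv (shmul σ f) (shmul σ g) ξ := by
  rw [conv, conv, ← integral_add h1 h2, chmul, conv, ← integral_const_mul]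
  refine integral_congr_ae (Eventually.of_forall fun ζ => ?_)
  have e : σ * (2 * Real.pi * ξ) = σ * (2 * Real.pi * ζ) + σ * (2 * Real.pi * (ξ - ζ)) := by ring
  simp only [chmul, shmul]
  rw [e, Real.cosh_add]
  push_cast
  ring

theorem shmul_conv {σ : ℝ} {f g : ℝ → ℂ} {ξ : ℝ}
    (h1 : Integrable fun ζ => shmul σ f ζ * chmul σ g (ξ - ζ))
    (h2 : Integrable fun ζ => chmul σ f ζ * shmul σ g (ξ - ζ)) :
    shmul σ (conv f g) ξ = conv (shmul σ f) (chmul σ g) ξ + conv (chmul σ f) (shmul σ g) ξ := by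
  rw [conv, conv, ← integral_add h1 h2, shmul, conv, ← integral_const_mul]
  refine integral_congr_ae (Eventually.of_forall fun ζ => ?_)
  have e : σ * (2 * Real.pi * ξ) = σ * (2 * Real.pi * ζ) + σ * (2 * Real.pi * (ξ - ζ)) := by ring
  simp only [chmul, shmul]
  rw [e, Real.sinh_add]
  push_cast
  ring

theorem conv_add_right {f g h : ℝ → ℂ} (hf : MemLp f 2) (hg : MemLp g 2) (hh : MemLp h 2)
    (ξ : ℝ) : conv f (fun ζ => g ζ + h ζ) ξ = conv f g ξ + conv f h ξ := by
  rw [conv, conv, conv, ← integral_add (integrable_conv_integrand hf hg ξ)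
    (integrable_conv_integrand hf hh ξ)]
  simp only [mul_add]

/-! ### The flux of the modified energy -/

section nonlinear

variable {σ : ℝ} {g : ℝ → ℂ}

theorem bounds_shmul (hσ : 0 ≤ σ) (ha : MemLp (wmul (chmul σ g)) 2) :
    MemLp (shmul σ g) 2 ∧ MemLp (kmul (shmul σ g)) 2 ∧ Integrable (shmul σ g) ∧
      n2 (shmul σ g) ≤ min 1 σ * n2 (wmul (chmul σ g)) ∧
      n2 (kmul (shmul σ g)) ≤ min 1 σ * n2 (wmul (chmul σ g)) ∧
      ∫ ξ, ‖shmul σ g ξ‖ ≤ min 1 σ * (jbConst * n2 (wmul (chmul σ g))) :=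
  bounds_of_le_jb (le_min zero_le_one hσ) (aestronglyMeasurable_shmul
    (aestronglyMeasurable_of_chmul (aestronglyMeasurable_of_wmul ha.1))) ha (norm_shmul_le hσ g)

/-- The nonlinearity after multiplication by `cosh(σk)`, in terms of `a = cosh(σk) g` and
`b = sinh(σk) g`. -/
theorem chmul_nonlin (hσ : 0 ≤ σ) (ha : MemLp (wmul (chmul σ g)) 2) (γ ξ : ℝ) :
    chmul σ (nonlin γ g) ξ =
      ((3 / 4 - γ * (2 * Real.pi * ξ) ^ 2 : ℝ) : ℂ) *
        (conv (chmul σ g) (chmul σ g) ξ + conv (shmul σ g) (shmul σ g) ξ)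
      + (7 / 48) * (conv (kmul (chmul σ g)) (kmul (chmul σ g)) ξ
        + conv (kmul (shmul σ g)) (kmul (shmul σ g)) ξ)
      - (1 / 8) * (conv (chmul σ g) (conv (chmul σ g) (chmul σ g)) ξ
        + conv (chmul σ g) (conv (shmul σ g) (shmul σ g)) ξ
        + 2 * conv (shmul σ g) (conv (chmul σ g) (shmul σ g)) ξ) := by
  obtain ⟨a2, ka2, a1, -⟩ := bounds_self ha
  obtain ⟨b2, kb2, b1, -⟩ := bounds_shmul hσ ha
  have e1 : ∀ ξ, chmul σ (conv g g) ξ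
      = conv (chmul σ g) (chmul σ g) ξ + conv (shmul σ g) (shmul σ g) ξ := fun ξ =>
    chmul_conv (integrable_conv_integrand a2 a2 ξ) (integrable_conv_integrand b2 b2 ξ)
  have e1' : ∀ ξ, shmul σ (conv g g) ξ
      = conv (chmul σ g) (shmul σ g) ξ + conv (chmul σ g) (shmul σ g) ξ := fun ξ => by
    rw [shmul_conv (integrable_conv_integrand b2 a2 ξ) (integrable_conv_integrand a2 b2 ξ),
      conv_comm (shmul σ g)]
  have e2 : chmul σ (conv (kmul g) (kmul g)) ξ = conv (kmul (chmul σ g)) (kmul (chmul σ g)) ξ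
      + conv (kmul (shmul σ g)) (kmul (shmul σ g)) ξ := by
    rw [kmul_chmul, kmul_shmul] at *
    exact chmul_conv (integrable_conv_integrand ka2 ka2 ξ) (integrable_conv_integrand kb2 kb2 ξ)
  have A2 := memLp_conv a1 a1 a2 a2
  have B2 := memLp_conv b1 b1 b2 b2
  have AB2 := memLp_conv a1 b1 a2 b2
  have f1 : chmul σ (conv g g) = fun ξ => conv (chmul σ g) (chmul σ g) ξ
      + conv (shmul σ g) (shmul σ g) ξ := funext e1
  have f2 : shmul σ (conv g g) = fun ξ => conv (chmul σ g) (shmul σ g) ξ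
      + conv (chmul σ g) (shmul σ g) ξ := funext e1'
  -- The addition formulas are used twice: cosh of a sum of three frequencies has one term without
  -- sinh and three terms with two sinh factors, two of which agree by symmetry.
  have e3 : chmul σ (conv g (conv g g)) ξ
      = conv (chmul σ g) (conv (chmul σ g) (chmul σ g)) ξ
        + conv (chmul σ g) (conv (shmul σ g) (shmul σ g)) ξ
        + 2 * conv (shmul σ g) (conv (chmul σ g) (shmul σ g)) ξ := by
    rw [chmul_conv, f1, f2, conv_add_right a2 A2 B2, conv_add_right b2 AB2 AB2]
    · ring
    · rw [f1]; exact integrable_conv_integrand a2 (A2.add B2) ξ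
    · rw [f2]; exact integrable_conv_integrand b2 (AB2.add AB2) ξ
  rw [← e1, ← e2, ← e3]
  simp only [chmul, nonlin]
  ring

/-- The integrand of the time derivative of the energy. -/
def flux (σ γ : ℝ) (g : ℝ → ℂ) (ξ : ℝ) : ℂ :=
  conj (chmul σ g ξ) * (-Complex.I * ((2 * Real.pi * ξ : ℝ) : ℂ) * chmul σ (nonlin γ g) ξ)

theorem integral_norm_add_le {u v : ℝ → ℂ} (hu : Integrable u) (hv : Integrable v) :
    ∫ ξ, ‖u ξ + v ξ‖ ≤ (∫ ξ, ‖u ξ‖) + ∫ ξ, ‖v ξ‖ := by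
  rw [← integral_add hu.norm hv.norm]
  exact integral_mono (hu.add hv).norm (hu.norm.add hv.norm) fun ξ => norm_add_le _ _

theorem integral_norm_const_mul (c : ℂ) (u : ℝ → ℂ) : ∫ ξ, ‖c * u ξ‖ = ‖c‖ * ∫ ξ, ‖u ξ‖ := by
  simp only [norm_mul, integral_const_mul]

theorem integral_norm_linear_combination_le {f₁ f₂ f₃ f₄ f₅ : ℝ → ℂ} (c₂ c₃ c₄ c₅ : ℂ)
    (h₁ : Integrable f₁) (h₂ : Integrable f₂) (h₃ : Integrable f₃) (h₄ : Integrable f₄)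
    (h₅ : Integrable f₅) :
    ∫ x, ‖f₁ x + c₂ * f₂ x + c₃ * f₃ x + c₄ * f₄ x + c₅ * f₅ x‖
      ≤ (∫ x, ‖f₁ x‖) + ‖c₂‖ * (∫ x, ‖f₂ x‖) + ‖c₃‖ * (∫ x, ‖f₃ x‖) + ‖c₄‖ * (∫ x, ‖f₄ x‖)
        + ‖c₅‖ * (∫ x, ‖f₅ x‖) := by
  have k₂ := h₂.const_mul c₂
  have k₃ := h₃.const_mul c₃
  have k₄ := h₄.const_mul c₄
  have k₅ := h₅.const_mul c₅
  simp only [← integral_norm_const_mul]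
  have l₂ : Integrable fun x => f₁ x + c₂ * f₂ x := h₁.add k₂
  have l₃ : Integrable fun x => f₁ x + c₂ * f₂ x + c₃ * f₃ x := l₂.add k₃
  have l₄ : Integrable fun x => f₁ x + c₂ * f₂ x + c₃ * f₃ x + c₄ * f₄ x := l₃.add k₄
  have n₂ := integral_norm_add_le h₁ k₂
  have n₃ := integral_norm_add_le l₂ k₃
  have n₄ := integral_norm_add_le l₃ k₄
  have n₅ := integral_norm_add_le l₄ k₅
  linarith

/-- The `L¹`–`L²`–`L²` bound for the absolute value of the pairing. Unlike the bound on `J`, it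
controls the flux density itself, as needed for domination in the limit ε → 0. -/
theorem integral_norm_mul_conv_le {f g h : ℝ → ℂ} (hf : Integrable f) (hg : MemLp g 2)
    (hh : MemLp h 2) :
    ∫ ξ, ‖h (-ξ) * conv f g ξ‖ ≤ (∫ x, ‖f x‖) * (n2 g * n2 h) := by
  have hi := integrable_tri hf hg hh
  have hs := (integrable_tri_shear hi).norm
  have h1 : ∫ ξ, ‖h (-ξ) * conv f g ξ‖ ≤ ∫ ξ, ∫ ζ, ‖h (-ξ) * (f ζ * g (ξ - ζ))‖ := by
    refine integral_mono (integrable_mul_conv hi).norm hs.integral_prod_right fun ξ => ?_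
    simp only [conv]
    rw [← integral_const_mul]
    exact norm_integral_le_integral_norm _
  refine h1.trans ?_
  rw [← integral_prod_symm _ hs, integral_prod _ hs, ← integral_mul_const]
  refine integral_mono hs.integral_prod_left (hf.norm.mul_const _) fun ζ => ?_
  have h2 := integral_norm_tri_slice_le (f := f) hg hh ζ
  rw [← integral_sub_right_eq_self _ ζ] at h2
  refine le_trans (le_of_eq (integral_congr_ae (Eventually.of_forall fun ξ => ?_))) h2
  simp only [← tri_shear f g h (ζ, ξ)]

theorem integrable_and_integral_norm_mul_le {f G : ℝ → ℂ} {B : ℝ} (hf : Integrable f)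
    (hG : AEStronglyMeasurable G) (hB : ∀ ξ, ‖G ξ‖ ≤ B) :
    Integrable (fun ξ => f (-ξ) * G ξ) ∧ ∫ ξ, ‖f (-ξ) * G ξ‖ ≤ (∫ ξ, ‖f ξ‖) * B := by
  have hf' := hf.comp_neg
  have hi : Integrable fun ξ => f (-ξ) * G ξ := hf'.mul_bdd (c := B) hG (Eventually.of_forall hB)
  refine ⟨hi, ?_⟩
  rw [← integral_neg_eq_self (fun ξ => ‖f ξ‖), ← integral_mul_const]
  refine integral_mono hi.norm (hf'.norm.mul_const B) fun ξ => ?_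
  simp only [norm_mul]
  exact mul_le_mul_of_nonneg_left (hB ξ) (norm_nonneg _)

set_option maxHeartbeats 1000000 in
/-- The integral of the flux is of second order in `σ`. -/
theorem flux_estimate (hσ : 0 ≤ σ) (ha : MemLp (wmul (chmul σ g)) 2)
    (hherm : ∀ᵐ ξ, g (-ξ) = conj (g ξ)) :
    Integrable (flux σ (7 / 48) g) ∧
      (∫ ξ, ‖flux σ (7 / 48) g ξ‖ ≤ 4 * (jbConst * n2 (wmul (chmul σ g)) ^ 3
        + jbConst ^ 2 * n2 (wmul (chmul σ g)) ^ 4)) ∧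
      ‖∫ ξ, flux σ (7 / 48) g ξ‖ ≤ (min 1 σ) ^ 2 * (2 * jbConst * n2 (wmul (chmul σ g)) ^ 3
        + jbConst ^ 2 * n2 (wmul (chmul σ g)) ^ 4) := by
  obtain ⟨a2, ka2, a1, na2, nka2, na1⟩ := bounds_self ha
  obtain ⟨-, kka2, ka1, -, nkka2, nka1⟩ := bounds_kmul ha
  obtain ⟨b2, kb2, b1, nb2, nkb2, nb1⟩ := bounds_shmul hσ ha
  have hherm' : ∀ᵐ ξ, conj (chmul σ g ξ) = chmul σ g (-ξ) := by
    filter_upwards [hherm] with ξ h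
    simp only [chmul, h, map_mul, Complex.conj_ofReal, mul_neg, Real.cosh_neg]
  have fe := fun ξ => chmul_nonlin hσ ha (7 / 48) ξ
  have kc := kmul_conv_self a2 ka2
  have kcb := kmul_conv_self b2 kb2
  have zA := J_self_self_kmul ha
  have zB := J_kmul_self_kmul_kmul ha
  have zC := J_self_conv_kmul ha
  set m := min 1 σ with hm
  have hm0 : 0 ≤ m := le_min zero_le_one hσ
  set X := n2 (wmul (chmul σ g)) with hX
  have hX0 : 0 ≤ X := n2_nonneg _
  have hC0 := jbConst_nonneg
  set a := chmul σ g with ha'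
  set b := shmul σ g with hb'
  have tA : ∀ {f : ℝ → ℂ}, MemLp f 2 → Integrable (tri f f (kmul a)) := fun hf =>
    integrable_tri_third (integrable_tri_swap (integrable_tri ka1 hf hf))
  have tB : ∀ {f : ℝ → ℂ}, Integrable f → MemLp (kmul f) 2 →
      Integrable (tri (kmul f) f (kmul (kmul a))) := fun hf hkf =>
    integrable_tri_swap (integrable_tri hf hkf kka2)
  have A2 := memLp_conv a1 a1 a2 a2
  have tC : Integrable (tri a (conv a a) (kmul a)) := integrable_tri a1 A2 ka2
  -- The terms from η³ that contain `b` need no symmetrization: `ka` is integrable, and the double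
  -- convolutions are bounded.
  obtain ⟨iD, bD⟩ := integrable_and_integral_norm_mul_le ka1
    (integrable_conv a1 (integrable_conv b1 b1)).1
    (norm_conv_le_of_bounded a1 (norm_conv_le b2 b2))
  obtain ⟨iE, bE⟩ := integrable_and_integral_norm_mul_le ka1
    (integrable_conv b1 (integrable_conv a1 b1)).1
    (norm_conv_le_of_bounded b1 (norm_conv_le a2 b2))
  have i1 := integrable_mul_conv (tA a2)
  have i2 := integrable_mul_conv (tA b2)
  have i3 := integrable_mul_conv (tB a1 ka2)
  have i4 := integrable_mul_conv (tB b1 kb2)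
  have i5 := integrable_mul_conv (tA ka2)
  have i6 := integrable_mul_conv (tA kb2)
  have i7 := integrable_mul_conv tC
  have v1 := integral_mul_conv (tA a2)
  have v2 := integral_mul_conv (tA b2)
  have v3 := integral_mul_conv (tB a1 ka2)
  have v4 := integral_mul_conv (tB b1 kb2)
  have v5 := integral_mul_conv (tA ka2)
  have v6 := integral_mul_conv (tA kb2)
  have v7 := integral_mul_conv tC
  have k1 : Integrable fun ξ => (3 / 4 : ℂ) * (kmul a (-ξ) * conv a a ξ
      + kmul a (-ξ) * conv b b ξ) := (i1.add i2).const_mul _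
  have k2 : Integrable fun ξ => kmul (kmul a) (-ξ) * conv (kmul a) a ξ
      + kmul (kmul a) (-ξ) * conv (kmul b) b ξ := i3.add i4
  have k3 : Integrable fun ξ => kmul a (-ξ) * conv (kmul a) (kmul a) ξ
      + kmul a (-ξ) * conv (kmul b) (kmul b) ξ := i5.add i6
  have k4 : Integrable fun ξ => kmul a (-ξ) * conv a (conv a a) ξ
      + kmul a (-ξ) * conv a (conv b b) ξ := i7.add iD
  have key := integral_linear_combination (7 / 24 : ℂ) (7 / 48 : ℂ) (-1 / 8 : ℂ) (-1 / 4 : ℂ)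
    k1 k2 k3 k4 iE
  have kint := ((((k1.add (k2.const_mul (7 / 24 : ℂ))).add (k3.const_mul (7 / 48 : ℂ))).add
    (k4.const_mul (-1 / 8 : ℂ))).add (iE.const_mul (-1 / 4 : ℂ))).const_mul Complex.I
  -- The term γ∂ₓ³(η²) brings a factor k³. Two powers stay on the outer factor, and the third enters
  -- the convolution as k(a∗a) = 2(ka)∗a; so two derivatives of `a` suffice, and 7/24 = 2 · 7/48.
  have hflux : ∀ᵐ ξ, flux σ (7 / 48) g ξ = Complex.I *
      ((3 / 4 : ℂ) * (kmul a (-ξ) * conv a a ξ + kmul a (-ξ) * conv b b ξ)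
      + (7 / 24 : ℂ) * (kmul (kmul a) (-ξ) * conv (kmul a) a ξ
        + kmul (kmul a) (-ξ) * conv (kmul b) b ξ)
      + (7 / 48 : ℂ) * (kmul a (-ξ) * conv (kmul a) (kmul a) ξ
        + kmul a (-ξ) * conv (kmul b) (kmul b) ξ)
      + (-1 / 8 : ℂ) * (kmul a (-ξ) * conv a (conv a a) ξ + kmul a (-ξ) * conv a (conv b b) ξ)
      + (-1 / 4 : ℂ) * (kmul a (-ξ) * conv b (conv a b) ξ)) := by
    filter_upwards [hherm'] with ξ h
    have q1 := kc ξ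
    have q2 := kcb ξ
    rw [flux, fe, ← ha', h]
    simp only [kmul] at q1 q2 ⊢
    push_cast at q1 q2 ⊢
    linear_combination (7 / 48 * Complex.I * (2 * Real.pi * ξ) ^ 2 * a (-ξ)) * (q1 + q2)
  refine ⟨kint.congr (hflux.mono fun ξ h => h.symm), ?_, ?_⟩
  · have hm1 : m ≤ 1 := min_le_left _ _
    have hmX : m * X ≤ X := mul_le_of_le_one_left hX0 hm1
    have na : ∀ {f : ℝ → ℂ}, Integrable f → MemLp f 2 → n2 f ≤ X →
        ∫ ξ, ‖kmul a (-ξ) * conv f f ξ‖ ≤ jbConst * X ^ 3 := by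
      intro f hf hf2 hn
      refine (integrable_and_integral_norm_mul_le ka1 (integrable_conv hf hf).1
        (norm_conv_le hf2 hf2)).2.trans ?_
      have := n2_nonneg f
      calc _ ≤ jbConst * X * (X * X) := by gcongr
        _ = _ := by ring
    have nb : ∀ {f : ℝ → ℂ}, Integrable f → MemLp (kmul f) 2 → n2 (kmul f) ≤ X →
        ∫ ξ, ‖f ξ‖ ≤ jbConst * X →
        ∫ ξ, ‖kmul (kmul a) (-ξ) * conv (kmul f) f ξ‖ ≤ jbConst * X ^ 3 := by
      intro f hf hkf hn hn1
      simp only [conv_comm (kmul f) f]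
      refine (integral_norm_mul_conv_le hf hkf kka2).trans ?_
      have := n2_nonneg (kmul f)
      have := n2_nonneg (kmul (kmul a))
      calc _ ≤ jbConst * X * (X * X) := by gcongr
        _ = _ := by ring
    have nc : ∀ {f h k : ℝ → ℂ}, Integrable f → Integrable h → Integrable k → MemLp h 2 →
        MemLp k 2 → ∫ ξ, ‖f ξ‖ ≤ jbConst * X → n2 h ≤ X → n2 k ≤ X →
        ∫ ξ, ‖kmul a (-ξ) * conv f (conv h k) ξ‖ ≤ jbConst ^ 2 * X ^ 4 := by
      intro f h k hf hh hk hh2 hk2 nf nh nk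
      refine (integrable_and_integral_norm_mul_le ka1 (integrable_conv hf
        (integrable_conv hh hk)).1 (norm_conv_le_of_bounded hf (norm_conv_le hh2 hk2))).2.trans ?_
      have := n2_nonneg h
      have := n2_nonneg k
      have : 0 ≤ ∫ ξ, ‖f ξ‖ := integral_nonneg fun ξ => norm_nonneg _
      calc _ ≤ jbConst * X * ((jbConst * X) * (X * X)) := by gcongr
        _ = _ := by ring
    -- The bound of `b` by ⟨k⟩|a| is too costly here; |b| ≤ |a| gives the integrability of `kb` from
    -- that of `ka`.
    have kb1 : Integrable (kmul b) := by
      refine ka1.norm.mono' kb2.1 (Eventually.of_forall fun ξ => ?_)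
      rw [norm_kmul, norm_kmul]
      refine mul_le_mul_of_nonneg_left ?_ (abs_nonneg _)
      rw [hb', ha', norm_chmul, shmul, norm_mul, Complex.norm_real, Real.norm_eq_abs]
      exact mul_le_mul_of_nonneg_right (abs_sinh_le_cosh _) (norm_nonneg _)
    have nb1' : ∫ ξ, ‖b ξ‖ ≤ jbConst * X :=
      nb1.trans (mul_le_of_le_one_left (by positivity) hm1)
    have nb2' := nb2.trans hmX
    have nkb2' := nkb2.trans hmX
    rw [integral_congr_ae (hflux.mono fun ξ h => congrArg norm h), integral_norm_const_mul,
      Complex.norm_I, one_mul]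
    have hle := integral_norm_linear_combination_le (7 / 24 : ℂ) (7 / 48 : ℂ) (-1 / 8 : ℂ)
      (-1 / 4 : ℂ) k1 k2 k3 k4 iE
    rw [integral_norm_const_mul] at hle
    have w1 := integral_norm_add_le i1 i2
    have w2 := integral_norm_add_le i3 i4
    have w3 := integral_norm_add_le i5 i6
    have w4 := integral_norm_add_le i7 iD
    have x1 := na a1 a2 na2
    have x2 := na b1 b2 nb2'
    have x3 := nb a1 ka2 nka2 na1
    have x4 := nb b1 kb2 nkb2' nb1'
    have x5 := na ka1 ka2 nka2
    have x6 := na kb1 kb2 nkb2'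
    have x7 := nc a1 a1 a1 a2 a2 na1 na2 na2
    have x8 := nc a1 b1 b1 b2 b2 na1 nb2' nb2'
    have x9 := nc b1 a1 b1 a2 b2 nb1' na2 nb2'
    have p3 : 0 ≤ jbConst * X ^ 3 := by positivity
    have p4 : 0 ≤ jbConst ^ 2 * X ^ 4 := by positivity
    have c1 : ‖(3 / 4 : ℂ)‖ = 3 / 4 := by norm_num
    have c2 : ‖(7 / 24 : ℂ)‖ = 7 / 24 := by norm_num
    have c3 : ‖(7 / 48 : ℂ)‖ = 7 / 48 := by norm_num
    have c4 : ‖(-1 / 8 : ℂ)‖ = 1 / 8 := by norm_num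
    have c5 : ‖(-1 / 4 : ℂ)‖ = 1 / 4 := by norm_num
    rw [c1, c2, c3, c4, c5] at hle
    linarith
  -- For the signed integral the cancellations apply: `zA` and `zC` remove the terms of η² and η³
  -- with `a` alone, and the derivative terms are left to `zB`.
  rw [integral_congr_ae hflux, integral_const_mul, key, integral_const_mul, integral_add i1 i2,
    integral_add i3 i4, integral_add i5 i6, integral_add i7 iD, v1, v2, v3, v4, v5, v6, v7,
    norm_mul, Complex.norm_I, one_mul, zA, zC]
  have bA : ∀ {f : ℝ → ℂ}, MemLp f 2 → n2 f ≤ m * X →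
      ‖J f f (kmul a)‖ ≤ m ^ 2 * (jbConst * X ^ 3) := by
    intro f hf hn
    rw [← J_third (tA hf), ← J_swap f (kmul a) f]
    refine (norm_J_le ka1 hf hf).trans ?_
    have := n2_nonneg f
    calc _ ≤ jbConst * X * ((m * X) * (m * X)) := by gcongr
      _ = _ := by ring
  have bB : ‖J (kmul b) b (kmul (kmul a))‖ ≤ m ^ 2 * (jbConst * X ^ 3) := by
    rw [J_swap b]
    refine (norm_J_le b1 kb2 kka2).trans ?_
    have h1 := n2_nonneg (kmul b)
    have h2 := n2_nonneg (kmul (kmul a))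
    calc _ ≤ m * (jbConst * X) * ((m * X) * X) := by gcongr
      _ = _ := by ring
  have bD' : ‖∫ ξ, kmul a (-ξ) * conv a (conv b b) ξ‖ ≤ m ^ 2 * (jbConst ^ 2 * X ^ 4) := by
    refine (norm_integral_le_integral_norm _).trans (bD.trans ?_)
    have h1 := n2_nonneg b
    have h2 : 0 ≤ ∫ ξ, ‖a ξ‖ := integral_nonneg fun ξ => norm_nonneg _
    calc _ ≤ jbConst * X * ((jbConst * X) * ((m * X) * (m * X))) := by gcongr
      _ = _ := by ring
  have bE' : ‖∫ ξ, kmul a (-ξ) * conv b (conv a b) ξ‖ ≤ m ^ 2 * (jbConst ^ 2 * X ^ 4) := by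
    refine (norm_integral_le_integral_norm _).trans (bE.trans ?_)
    have h1 := n2_nonneg b
    have h3 := n2_nonneg a
    have h2 : 0 ≤ ∫ ξ, ‖b ξ‖ := integral_nonneg fun ξ => norm_nonneg _
    calc _ ≤ jbConst * X * ((m * (jbConst * X)) * (X * (m * X))) := by gcongr
      _ = _ := by ring
  have b1' := bA b2 nb2
  have b3' := bA kb2 nkb2
  -- The two remaining terms in `a` alone have coefficients 7/24 and 7/48, in the ratio 2 : 1 that
  -- `zB` requires. This is where the value γ = 7/48 acts; all surviving terms contain two factors
  -- `b`.
  have e : (3 / 4 : ℂ) * (0 + J b b (kmul a))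
      + 7 / 24 * (J (kmul a) a (kmul (kmul a)) + J (kmul b) b (kmul (kmul a)))
      + 7 / 48 * (J (kmul a) (kmul a) (kmul a) + J (kmul b) (kmul b) (kmul a))
      + -1 / 8 * (0 + ∫ ξ, kmul a (-ξ) * conv a (conv b b) ξ)
      + -1 / 4 * ∫ ξ, kmul a (-ξ) * conv b (conv a b) ξ
      = (3 / 4 : ℝ) * J b b (kmul a) + (7 / 24 : ℝ) * J (kmul b) b (kmul (kmul a))
      + (7 / 48 : ℝ) * J (kmul b) (kmul b) (kmul a)
      + (-1 / 8 : ℝ) * (∫ ξ, kmul a (-ξ) * conv a (conv b b) ξ)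
      + (-1 / 4 : ℝ) * ∫ ξ, kmul a (-ξ) * conv b (conv a b) ξ := by
    push_cast
    linear_combination (7 / 48 : ℂ) * zB
  rw [e]
  refine (norm_add_le _ _).trans ?_
  refine (add_le_add_left ((norm_add_le _ _).trans (add_le_add_left ((norm_add_le _ _).trans
    (add_le_add_left (norm_add_le _ _) _)) _)) _).trans ?_
  simp only [norm_mul, Complex.norm_real, Real.norm_eq_abs]
  norm_num [abs_of_nonneg]
  have p3 : 0 ≤ m ^ 2 * (jbConst * X ^ 3) := by positivity
  have p4 : 0 ≤ m ^ 2 * (jbConst ^ 2 * X ^ 4) := by positivity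
  -- The coefficients add up to 3/4 + 7/24 + 7/48 ≤ 2 for X³ and 1/8 + 1/4 ≤ 1 for X⁴.
  linarith

end nonlinear

/-! ### Continuity of the nonlinearity -/

/-- The weight is submultiplicative up to a factor 2, so weighted convolution bounds follow from
unweighted ones. -/
theorem cosh_add_le (x y : ℝ) : Real.cosh (x + y) ≤ 2 * (Real.cosh x * Real.cosh y) := by
  rw [Real.cosh_add]
  have h1 := abs_sinh_le_cosh x
  have h2 := abs_sinh_le_cosh y
  have : Real.sinh x * Real.sinh y ≤ Real.cosh x * Real.cosh y :=
    (le_abs_self _).trans (by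
      rw [abs_mul]; exact mul_le_mul h1 h2 (abs_nonneg _) (Real.cosh_pos x).le)
  linarith

theorem norm_chmul_conv_le_integral {σ : ℝ} {f g : ℝ → ℂ} {ξ : ℝ}
    (h : Integrable fun ζ => chmul σ f ζ * chmul σ g (ξ - ζ)) :
    ‖chmul σ (conv f g) ξ‖ ≤ 2 * ∫ ζ, ‖chmul σ f ζ * chmul σ g (ξ - ζ)‖ := by
  rw [chmul, conv, ← integral_const_mul, ← integral_const_mul]
  refine norm_integral_le_of_norm_le (h.norm.const_mul 2) (Eventually.of_forall fun ζ => ?_)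
  have e : σ * (2 * Real.pi * ξ) = σ * (2 * Real.pi * ζ) + σ * (2 * Real.pi * (ξ - ζ)) := by ring
  rw [norm_mul, norm_mul, norm_mul, norm_chmul, norm_chmul, Complex.norm_real,
    Real.norm_of_nonneg (Real.cosh_pos _).le, e]
  calc _ ≤ 2 * (Real.cosh (σ * (2 * Real.pi * ζ)) * Real.cosh (σ * (2 * Real.pi * (ξ - ζ)))) *
        (‖f ζ‖ * ‖g (ξ - ζ)‖) := by
        gcongr
        exact cosh_add_le _ _
    _ = _ := by ring

theorem norm_chmul_conv_le {σ : ℝ} {f g : ℝ → ℂ} (hf : MemLp (chmul σ f) 2)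
    (hg : MemLp (chmul σ g) 2) (ξ : ℝ) :
    ‖chmul σ (conv f g) ξ‖ ≤ 2 * (n2 (chmul σ f) * n2 (chmul σ g)) := by
  refine (norm_chmul_conv_le_integral (integrable_conv_integrand hf hg ξ)).trans ?_
  have := integral_norm_mul_le hf (memLp_comp_sub_left hg ξ)
  rw [n2_comp_sub_left hg] at this
  linarith

theorem norm_chmul_conv_le_of_bounded {σ : ℝ} {f g : ℝ → ℂ} {B : ℝ}
    (hf : Integrable (chmul σ f)) (hg : AEStronglyMeasurable (chmul σ g))
    (hB : ∀ ξ, ‖chmul σ g ξ‖ ≤ B) (ξ : ℝ) :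
    ‖chmul σ (conv f g) ξ‖ ≤ 2 * ((∫ ζ, ‖chmul σ f ζ‖) * B) := by
  have hi : Integrable fun ζ => chmul σ f ζ * chmul σ g (ξ - ζ) :=
    hf.mul_bdd (c := B) (hg.comp_quasiMeasurePreserving
      (Measure.measurePreserving_sub_left volume ξ).quasiMeasurePreserving)
      (Eventually.of_forall fun ζ => hB _)
  refine (norm_chmul_conv_le_integral hi).trans (mul_le_mul_of_nonneg_left ?_ (by norm_num))
  rw [← integral_mul_const]
  refine integral_mono hi.norm (hf.norm.mul_const B) fun ζ => ?_
  simp only [norm_mul]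
  exact mul_le_mul_of_nonneg_left (hB _) (norm_nonneg _)

theorem conv_self_sub {f g : ℝ → ℂ} (hf : MemLp f 2) (hg : MemLp g 2) (ξ : ℝ) :
    conv f f ξ - conv g g ξ = conv (f - g) f ξ + conv g (f - g) ξ := by
  rw [conv, conv, conv, conv, ← integral_sub (integrable_conv_integrand hf hf ξ)
    (integrable_conv_integrand hg hg ξ), ← integral_add
    (integrable_conv_integrand (hf.sub hg) hf ξ) (integrable_conv_integrand hg (hf.sub hg) ξ)]
  refine integral_congr_ae (Eventually.of_forall fun ζ => ?_)
  simp only [Pi.sub_apply]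
  ring

theorem chmul_sub (σ : ℝ) (f g : ℝ → ℂ) (ξ : ℝ) :
    chmul σ (f - g) ξ = chmul σ f ξ - chmul σ g ξ := by
  simp only [chmul, Pi.sub_apply]; ring

theorem kmul_sub (f g : ℝ → ℂ) : kmul (f - g) = kmul f - kmul g := by
  ext ξ; simp only [kmul, Pi.sub_apply]; ring

theorem memLp_of_chmul {σ : ℝ} {f : ℝ → ℂ} (hf : MemLp (chmul σ f) 2) : MemLp f 2 := by
  refine memLp_of_norm_le (m := 1) (aestronglyMeasurable_of_chmul hf.1) hf fun ξ => ?_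
  rw [one_mul, norm_chmul]
  exact le_mul_of_one_le_left (norm_nonneg _) (Real.one_le_cosh _)

theorem integrable_of_chmul {σ : ℝ} {f : ℝ → ℂ} (hf : Integrable (chmul σ f)) :
    Integrable f := by
  refine hf.norm.mono' (aestronglyMeasurable_of_chmul hf.1) (Eventually.of_forall fun ξ => ?_)
  rw [norm_chmul]
  exact le_mul_of_one_le_left (norm_nonneg _) (Real.one_le_cosh _)

theorem wmul_chmul_sub (σ : ℝ) (f g : ℝ → ℂ) :
    wmul (chmul σ (f - g)) = wmul (chmul σ f) - wmul (chmul σ g) := by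
  ext ξ; simp only [wmul, chmul, Pi.sub_apply]; ring

theorem aestronglyMeasurable_chmul {σ : ℝ} {g : ℝ → ℂ} (h : AEStronglyMeasurable g) :
    AEStronglyMeasurable (chmul σ g) :=
  (continuous_cosh_weight σ).aestronglyMeasurable.mul h

/-- Polarization f∗f - g∗g = (f-g)∗f + g∗(f-g), each piece estimated by Cauchy–Schwarz. -/
theorem norm_chmul_conv_self_sub_le {σ B d : ℝ} {f g : ℝ → ℂ} (hf : MemLp (chmul σ f) 2)
    (hg : MemLp (chmul σ g) 2) (nf : n2 (chmul σ f) ≤ B) (ng : n2 (chmul σ g) ≤ B)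
    (nd : n2 (chmul σ (f - g)) ≤ d) (ξ : ℝ) :
    ‖chmul σ (conv f f - conv g g) ξ‖ ≤ 4 * (B * d) := by
  have hd : MemLp (chmul σ (f - g)) 2 := by
    rw [show chmul σ (f - g) = chmul σ f - chmul σ g from funext (chmul_sub σ f g)]
    exact hf.sub hg
  have h1 := norm_chmul_conv_le hd hf ξ
  have h2 := norm_chmul_conv_le hg hd ξ
  have e : chmul σ (conv f f - conv g g) ξ
      = chmul σ (conv (f - g) f) ξ + chmul σ (conv g (f - g)) ξ := by
    simp only [chmul, Pi.sub_apply]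
    rw [conv_self_sub (memLp_of_chmul hf) (memLp_of_chmul hg)]
    ring
  rw [e]
  have p1 := n2_nonneg (chmul σ f)
  have p2 := n2_nonneg (chmul σ g)
  have p3 := n2_nonneg (chmul σ (f - g))
  have q1 : n2 (chmul σ (f - g)) * n2 (chmul σ f) ≤ d * B :=
    mul_le_mul nd nf p1 (p3.trans nd)
  have q2 : n2 (chmul σ g) * n2 (chmul σ (f - g)) ≤ B * d :=
    mul_le_mul ng nd p3 (p2.trans ng)
  calc _ ≤ _ := norm_add_le _ _
    _ ≤ 4 * (B * d) := by linarith

/-- The Lipschitz constant of the nonlinearity on balls. -/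
def lipConst (γ B : ℝ) : ℝ := 4 * (1 + |γ|) * B + B + 2 * jbConst * B ^ 2

/-- All the convolutions are pointwise bounded; the growth `brk ξ` comes only from the multiplier
3/4 - γk². -/
theorem norm_chmul_nonlin_sub_le {σ γ B : ℝ} {f g : ℝ → ℂ} (hf : MemLp (wmul (chmul σ f)) 2)
    (hg : MemLp (wmul (chmul σ g)) 2) (nf : n2 (wmul (chmul σ f)) ≤ B)
    (ng : n2 (wmul (chmul σ g)) ≤ B) (ξ : ℝ) :
    ‖chmul σ (nonlin γ f) ξ - chmul σ (nonlin γ g) ξ‖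
      ≤ brk ξ * (lipConst γ B * n2 (wmul (chmul σ (f - g)))) := by
  have hd : MemLp (wmul (chmul σ (f - g))) 2 := by
    rw [wmul_chmul_sub]; exact hf.sub hg
  obtain ⟨f2, kf2, f1, nf2, nkf2, nf1⟩ := bounds_self hf
  obtain ⟨g2, kg2, g1, ng2, nkg2, ng1⟩ := bounds_self hg
  obtain ⟨d2, kd2, d1, nd2, nkd2, nd1⟩ := bounds_self hd
  set d := n2 (wmul (chmul σ (f - g))) with hd'
  have d0 : 0 ≤ d := n2_nonneg _
  have B0 : 0 ≤ B := (n2_nonneg _).trans nf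
  have C0 := jbConst_nonneg
  have b1 := norm_chmul_conv_self_sub_le f2 g2 (nf2.trans nf) (ng2.trans ng) nd2
  rw [kmul_chmul] at kf2 kg2 kd2 nkf2 nkg2 nkd2
  rw [kmul_sub] at kd2 nkd2
  have b2 := norm_chmul_conv_self_sub_le kf2 kg2 (nkf2.trans nf) (nkg2.trans ng) nkd2 ξ
  have if1 := integrable_of_chmul f1
  have ig1 := integrable_of_chmul g1
  have m1 := aestronglyMeasurable_chmul (σ := σ) (integrable_conv if1 if1).1
  have m2 := aestronglyMeasurable_chmul (σ := σ)
    ((integrable_conv if1 if1).sub (integrable_conv ig1 ig1)).1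
  have b3 := norm_chmul_conv_le_of_bounded d1 m1 (norm_chmul_conv_le f2 f2) ξ
  have b4 := norm_chmul_conv_le_of_bounded g1 m2 b1 ξ
  have e : chmul σ (nonlin γ f) ξ - chmul σ (nonlin γ g) ξ
      = ((3 / 4 - γ * (2 * Real.pi * ξ) ^ 2 : ℝ) : ℂ) * chmul σ (conv f f - conv g g) ξ
      + ((7 / 48 : ℝ) : ℂ) * chmul σ (conv (kmul f) (kmul f) - conv (kmul g) (kmul g)) ξ
      + ((-1 / 8 : ℝ) : ℂ) * (chmul σ (conv (f - g) (conv f f)) ξ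
        + chmul σ (conv g (conv f f - conv g g)) ξ) := by
    have F2 := memLp_of_chmul f2
    have G2 := memLp_of_chmul g2
    have FF2 := memLp_conv if1 if1 F2 F2
    have GG2 := memLp_conv ig1 ig1 G2 G2
    have : conv f (conv f f) ξ - conv g (conv g g) ξ
        = conv (f - g) (conv f f) ξ + conv g (conv f f - conv g g) ξ := by
      rw [conv, conv, conv, conv, ← integral_sub (integrable_conv_integrand F2 FF2 ξ)
        (integrable_conv_integrand G2 GG2 ξ), ← integral_add
        (integrable_conv_integrand (F2.sub G2) FF2 ξ)
        (integrable_conv_integrand G2 (FF2.sub GG2) ξ)]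
      refine integral_congr_ae (Eventually.of_forall fun ζ => ?_)
      simp only [Pi.sub_apply]
      ring
    simp only [chmul, nonlin, Pi.sub_apply]
    push_cast
    linear_combination (-1 / 8 * Complex.cosh (σ * (2 * Real.pi * ξ))) * this
  have hk : |3 / 4 - γ * (2 * Real.pi * ξ) ^ 2| ≤ (1 + |γ|) * brk ξ := by
    have h0 := sq_nonneg (2 * Real.pi * ξ)
    calc _ ≤ |3 / 4| + |γ * (2 * Real.pi * ξ) ^ 2| := abs_sub _ _
      _ = 3 / 4 + |γ| * (2 * Real.pi * ξ) ^ 2 := by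
        rw [abs_mul, abs_of_nonneg h0, abs_of_nonneg (by norm_num : (0 : ℝ) ≤ 3 / 4)]
      _ ≤ _ := by
        rw [brk]; nlinarith [abs_nonneg γ]
  have c1 : ‖((3 / 4 - γ * (2 * Real.pi * ξ) ^ 2 : ℝ) : ℂ) * chmul σ (conv f f - conv g g) ξ‖
      ≤ (1 + |γ|) * brk ξ * (4 * (B * d)) := by
    rw [norm_mul, Complex.norm_real, Real.norm_eq_abs]
    exact mul_le_mul hk (b1 ξ) (norm_nonneg _) (by have := brk_pos ξ; positivity)
  have c2 : ‖((7 / 48 : ℝ) : ℂ) * chmul σ (conv (kmul f) (kmul f) - conv (kmul g) (kmul g)) ξ‖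
      ≤ B * d := by
    rw [norm_mul, Complex.norm_real, Real.norm_eq_abs, abs_of_nonneg (by norm_num)]
    have := mul_nonneg B0 d0
    linarith
  have c3 : ‖((-1 / 8 : ℝ) : ℂ) * (chmul σ (conv (f - g) (conv f f)) ξ
        + chmul σ (conv g (conv f f - conv g g)) ξ)‖ ≤ 2 * (jbConst * (B ^ 2 * d)) := by
    rw [norm_mul, Complex.norm_real, Real.norm_eq_abs]
    have t3 : ‖chmul σ (conv (f - g) (conv f f)) ξ‖ ≤ 4 * (jbConst * (B ^ 2 * d)) := by
      refine b3.trans ?_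
      have p := n2_nonneg (chmul σ f)
      calc _ ≤ 2 * (jbConst * d * (2 * (B * B))) := by
            gcongr <;> exact nf2.trans nf
        _ = _ := by ring
    have t4 : ‖chmul σ (conv g (conv f f - conv g g)) ξ‖ ≤ 8 * (jbConst * (B ^ 2 * d)) := by
      refine b4.trans ?_
      calc _ ≤ 2 * (jbConst * B * (4 * (B * d))) := by
            gcongr
            exact ng1.trans (mul_le_mul_of_nonneg_left ng C0)
        _ = _ := by ring
    have t5 := norm_add_le (chmul σ (conv (f - g) (conv f f)) ξ)
      (chmul σ (conv g (conv f f - conv g g)) ξ)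
    have : |(-1 / 8 : ℝ)| = 1 / 8 := by norm_num [abs_of_neg]
    rw [this]
    have : 0 ≤ jbConst * (B ^ 2 * d) := by positivity
    linarith
  rw [e]
  refine (norm_add_le _ _).trans ((add_le_add_left (norm_add_le _ _) _).trans ?_)
  have hb := one_le_brk ξ
  have r2 : B * d ≤ brk ξ * (B * d) := le_mul_of_one_le_left (by positivity) hb
  have r3 : 2 * (jbConst * (B ^ 2 * d)) ≤ brk ξ * (2 * (jbConst * (B ^ 2 * d))) :=
    le_mul_of_one_le_left (by positivity) hb
  calc _ ≤ (1 + |γ|) * brk ξ * (4 * (B * d)) + brk ξ * (B * d)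
        + brk ξ * (2 * (jbConst * (B ^ 2 * d))) := by linarith
    _ = _ := by rw [lipConst]; ring

/-! ### The symbol -/

section symbol

variable {γ₁ δ₁ : ℝ}

/-- The constant in the lower bound of the symbol by `(1 + k²)²`. -/
def ellConst (γ₁ δ₁ : ℝ) : ℝ := min 1 (min (γ₁ / 2) δ₁)

theorem ellConst_pos (hγ₁ : 0 < γ₁) (hδ₁ : 0 < δ₁) : 0 < ellConst γ₁ δ₁ :=
  lt_min one_pos (lt_min (by positivity) hδ₁)

/-- The halved γ₁ accounts for the middle term of (1 + k²)² = 1 + 2k² + k⁴. -/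
theorem ellConst_mul_le_symb (ξ : ℝ) : ellConst γ₁ δ₁ * brk ξ ^ 2 ≤ symb γ₁ δ₁ ξ := by
  have h1 : ellConst γ₁ δ₁ ≤ 1 := min_le_left _ _
  have h2 : ellConst γ₁ δ₁ ≤ γ₁ / 2 := (min_le_right _ _).trans (min_le_left _ _)
  have h3 : ellConst γ₁ δ₁ ≤ δ₁ := (min_le_right _ _).trans (min_le_right _ _)
  rw [symb, brk]
  set k := 2 * Real.pi * ξ
  have k2 : 0 ≤ k ^ 2 := by positivity
  have k4 : 0 ≤ k ^ 4 := by positivity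
  nlinarith [mul_le_mul_of_nonneg_right h2 k2, mul_le_mul_of_nonneg_right h3 k4]

theorem symb_le (hγ₁ : 0 < γ₁) (hδ₁ : 0 < δ₁) (ξ : ℝ) :
    symb γ₁ δ₁ ξ ≤ (1 + γ₁ + δ₁) * brk ξ ^ 2 := by
  rw [symb, brk]
  set k := 2 * Real.pi * ξ
  have k2 : 0 ≤ k ^ 2 := by positivity
  have k4 : 0 ≤ k ^ 4 := by positivity
  nlinarith [mul_nonneg hγ₁.le k2, mul_nonneg hγ₁.le k4, mul_nonneg hδ₁.le k2,
    mul_nonneg hδ₁.le k4]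

theorem symb_pos (hγ₁ : 0 < γ₁) (hδ₁ : 0 < δ₁) (ξ : ℝ) : 0 < symb γ₁ δ₁ ξ := by
  rw [symb]; positivity

theorem contDiff_symb : ContDiff ℝ ∞ (symb γ₁ δ₁) := by
  unfold symb; fun_prop

/-- The square root of the symbol. -/
def rsymb (γ₁ δ₁ ξ : ℝ) : ℝ := Real.sqrt (symb γ₁ δ₁ ξ)

theorem rsymb_pos (hγ₁ : 0 < γ₁) (hδ₁ : 0 < δ₁) (ξ : ℝ) : 0 < rsymb γ₁ δ₁ ξ :=
  Real.sqrt_pos.2 (symb_pos hγ₁ hδ₁ ξ)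

theorem rsymb_mul_self (hγ₁ : 0 < γ₁) (hδ₁ : 0 < δ₁) (ξ : ℝ) :
    rsymb γ₁ δ₁ ξ * rsymb γ₁ δ₁ ξ = symb γ₁ δ₁ ξ :=
  Real.mul_self_sqrt (symb_pos hγ₁ hδ₁ ξ).le

theorem contDiff_rsymb (hγ₁ : 0 < γ₁) (hδ₁ : 0 < δ₁) : ContDiff ℝ ∞ (rsymb γ₁ δ₁) :=
  contDiff_symb.sqrt fun ξ => (symb_pos hγ₁ hδ₁ ξ).ne'

theorem rsymb_le (hγ₁ : 0 < γ₁) (hδ₁ : 0 < δ₁) (ξ : ℝ) :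
    rsymb γ₁ δ₁ ξ ≤ Real.sqrt (1 + γ₁ + δ₁) * brk ξ := by
  have := Real.sqrt_le_sqrt (symb_le hγ₁ hδ₁ ξ)
  rwa [Real.sqrt_mul (by positivity), Real.sqrt_sq (brk_pos ξ).le] at this

theorem le_rsymb (hγ₁ : 0 < γ₁) (hδ₁ : 0 < δ₁) (ξ : ℝ) :
    Real.sqrt (ellConst γ₁ δ₁) * brk ξ ≤ rsymb γ₁ δ₁ ξ := by
  have := Real.sqrt_le_sqrt (ellConst_mul_le_symb (γ₁ := γ₁) (δ₁ := δ₁) ξ)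
  rwa [Real.sqrt_mul (ellConst_pos hγ₁ hδ₁).le, Real.sqrt_sq (brk_pos ξ).le] at this

/-- The regularizing factor `(1 + εk²)⁻¹`. -/
def reg (ε ξ : ℝ) : ℝ := (1 + ε * (2 * Real.pi * ξ) ^ 2)⁻¹

theorem reg_pos {ε : ℝ} (hε : 0 ≤ ε) (ξ : ℝ) : 0 < reg ε ξ := by
  rw [reg]; positivity

theorem reg_le_one {ε : ℝ} (hε : 0 ≤ ε) (ξ : ℝ) : reg ε ξ ≤ 1 := by
  apply inv_le_one_of_one_le₀
  have : 0 ≤ ε * (2 * Real.pi * ξ) ^ 2 := by positivity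
  linarith

theorem reg_le {ε : ℝ} (hε : 0 < ε) (hε1 : ε ≤ 1) (ξ : ℝ) : reg ε ξ ≤ ε⁻¹ * (brk ξ)⁻¹ := by
  rw [reg, ← mul_inv]
  apply inv_anti₀ (mul_pos hε (brk_pos ξ))
  rw [brk]
  nlinarith

theorem contDiff_reg {ε : ℝ} (hε : 0 ≤ ε) : ContDiff ℝ ∞ (reg ε) := by
  unfold reg
  refine ContDiff.inv (by fun_prop) fun ξ => ?_
  positivity

end symbol

/-! ### The regularized flow in `L²` -/

open Classical in
/-- The class in `L²` of a square-integrable function, and `0` for other functions. -/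
def toL2 (f : ℝ → ℂ) : Lp ℂ 2 (volume : Measure ℝ) :=
  if h : MemLp f 2 volume then h.toLp f else 0

theorem coeFn_toL2 {f : ℝ → ℂ} (h : MemLp f 2) : toL2 f =ᵐ[volume] f := by
  rw [toL2, dif_pos h]; exact h.coeFn_toLp

theorem norm_toL2 {f : ℝ → ℂ} (h : MemLp f 2) : ‖toL2 f‖ = n2 f := by
  rw [toL2, dif_pos h, Lp.norm_toLp, n2]

theorem toL2_sub {f g : ℝ → ℂ} (hf : MemLp f 2) (hg : MemLp g 2) :
    toL2 f - toL2 g = toL2 (f - g) := by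
  rw [toL2, toL2, toL2, dif_pos hf, dif_pos hg, dif_pos (hf.sub hg), MemLp.toLp_sub]

theorem inner_toL2 {f g : ℝ → ℂ} (hf : MemLp f 2) (hg : MemLp g 2) :
    inner ℂ (toL2 f) (toL2 g) = ∫ ξ, conj (f ξ) * g ξ := by
  rw [L2.inner_def]
  refine integral_congr_ae ?_
  filter_upwards [coeFn_toL2 hf, coeFn_toL2 hg] with ξ h1 h2
  rw [h1, h2, RCLike.inner_apply, mul_comm]

section flow

variable {σ γ γ₁ γ₂ δ₁ δ₂ : ℝ}

/-- The regularized unknown. -/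
def regState (σ γ₁ δ₁ ε : ℝ) (g : ℝ → ℂ) (ξ : ℝ) : ℂ :=
  ((reg ε ξ * rsymb γ₁ δ₁ ξ : ℝ) : ℂ) * chmul σ g ξ

/-- The time derivative of the regularized unknown. -/
def regRhs (σ γ γ₁ γ₂ δ₁ δ₂ ε : ℝ) (g : ℝ → ℂ) (ξ : ℝ) : ℂ :=
  ((reg ε ξ * (rsymb γ₁ δ₁ ξ)⁻¹ : ℝ) : ℂ) * chmul σ (rhs γ γ₂ δ₂ g) ξ

theorem memLp_regState (hγ₁ : 0 < γ₁) (hδ₁ : 0 < δ₁) {ε : ℝ} (hε : 0 ≤ ε) {g : ℝ → ℂ}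
    (hg : MemLp (wmul (chmul σ g)) 2) : MemLp (regState σ γ₁ δ₁ ε g) 2 := by
  have hc : Continuous fun ξ => ((reg ε ξ * rsymb γ₁ δ₁ ξ : ℝ) : ℂ) :=
    Complex.continuous_ofReal.comp ((contDiff_reg hε).continuous.mul
      (contDiff_rsymb hγ₁ hδ₁).continuous)
  refine memLp_of_norm_le (m := Real.sqrt (1 + γ₁ + δ₁))
    (hc.aestronglyMeasurable.mul (aestronglyMeasurable_of_wmul hg.1)) hg fun ξ => ?_
  rw [regState, norm_mul, norm_wmul, Complex.norm_real, Real.norm_of_nonneg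
    (mul_pos (reg_pos hε ξ) (rsymb_pos hγ₁ hδ₁ ξ)).le, ← mul_assoc]
  refine mul_le_mul_of_nonneg_right ?_ (norm_nonneg _)
  calc _ ≤ 1 * rsymb γ₁ δ₁ ξ :=
        mul_le_mul_of_nonneg_right (reg_le_one hε ξ) (rsymb_pos hγ₁ hδ₁ ξ).le
    _ ≤ _ := by rw [one_mul]; exact rsymb_le hγ₁ hδ₁ ξ

theorem chmul_rhs (g : ℝ → ℂ) (ξ : ℝ) : chmul σ (rhs γ γ₂ δ₂ g) ξ =
    -Complex.I * ((2 * Real.pi * ξ : ℝ) : ℂ) *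
      (((1 - γ₂ * (2 * Real.pi * ξ) ^ 2 + δ₂ * (2 * Real.pi * ξ) ^ 4 : ℝ) : ℂ) * chmul σ g ξ
        + chmul σ (nonlin γ g) ξ) := by
  simp only [chmul, rhs]; ring

theorem abs_dispersion_le (ξ : ℝ) :
    |1 - γ₂ * (2 * Real.pi * ξ) ^ 2 + δ₂ * (2 * Real.pi * ξ) ^ 4|
      ≤ (1 + |γ₂| + |δ₂|) * brk ξ ^ 2 := by
  set k := 2 * Real.pi * ξ with hk
  have k2 : 0 ≤ k ^ 2 := by positivity
  have k4 : 0 ≤ k ^ 4 := by positivity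
  calc _ ≤ |1 - γ₂ * k ^ 2| + |δ₂ * k ^ 4| := abs_add_le _ _
    _ ≤ |1| + |γ₂ * k ^ 2| + |δ₂ * k ^ 4| := by gcongr; exact abs_sub _ _
    _ = 1 + |γ₂| * k ^ 2 + |δ₂| * k ^ 4 := by
      rw [abs_mul, abs_mul, abs_of_nonneg k2, abs_of_nonneg k4, abs_one]
    _ ≤ _ := by
      rw [brk, ← hk]
      nlinarith [mul_nonneg (abs_nonneg γ₂) k2, mul_nonneg (abs_nonneg γ₂) k4,
        mul_nonneg (abs_nonneg δ₂) k2, mul_nonneg (abs_nonneg δ₂) k4, abs_nonneg γ₂,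
        abs_nonneg δ₂]

theorem aestronglyMeasurable_regRhs (hγ₁ : 0 < γ₁) (hδ₁ : 0 < δ₁) {ε : ℝ} (hε : 0 ≤ ε)
    {g : ℝ → ℂ} (hg : MemLp (wmul (chmul σ g)) 2) :
    AEStronglyMeasurable (regRhs σ γ γ₁ γ₂ δ₁ δ₂ ε g) := by
  have hc : Continuous fun ξ => ((reg ε ξ * (rsymb γ₁ δ₁ ξ)⁻¹ : ℝ) : ℂ) :=
    Complex.continuous_ofReal.comp ((contDiff_reg hε).continuous.mul
      ((contDiff_rsymb hγ₁ hδ₁).continuous.inv₀ fun ξ => (rsymb_pos hγ₁ hδ₁ ξ).ne'))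
  have hk : Continuous fun ξ : ℝ => -Complex.I * ((2 * Real.pi * ξ : ℝ) : ℂ) := by fun_prop
  have hp : Continuous fun ξ : ℝ =>
      ((1 - γ₂ * (2 * Real.pi * ξ) ^ 2 + δ₂ * (2 * Real.pi * ξ) ^ 4 : ℝ) : ℂ) := by fun_prop
  have hq : Continuous fun ξ : ℝ => ((3 / 4 - γ * (2 * Real.pi * ξ) ^ 2 : ℝ) : ℂ) := by fun_prop
  have mg := aestronglyMeasurable_of_chmul (aestronglyMeasurable_of_wmul hg.1)
  have i1 := integrable_of_chmul (bounds_self hg).2.2.1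
  have ik : Integrable (kmul g) := by
    have := (bounds_kmul hg).2.2.1
    rw [kmul_chmul] at this
    exact integrable_of_chmul this
  have hn : AEStronglyMeasurable (nonlin γ g) :=
    ((hq.aestronglyMeasurable.mul (integrable_conv i1 i1).1).add
      ((integrable_conv ik ik).1.const_mul _)).sub
      ((integrable_conv i1 (integrable_conv i1 i1)).1.const_mul _)
  exact hc.aestronglyMeasurable.mul (aestronglyMeasurable_chmul
    (hk.aestronglyMeasurable.mul ((hp.aestronglyMeasurable.mul mg).add hn)))

/-- The Lipschitz constant of `regRhs` on balls. -/
def regLip (γ γ₁ γ₂ δ₁ δ₂ ε B : ℝ) : ℝ :=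
  (ε⁻¹ * (Real.sqrt (ellConst γ₁ δ₁))⁻¹) * (1 + |γ₂| + |δ₂| + lipConst γ B * jbConst)

/-- A count of powers of ⟨k⟩. The inverse root of the symbol and the regularization gain two each.
The linear part costs five, and the one left over is covered by the weight (1 + k²). The nonlinear
part is bounded by ⟨k⟩³, which leaves ⟨k⟩⁻¹ ∈ `L²`; without the regularization neither estimate
would close. -/
theorem regRhs_sub_bound (hγ₁ : 0 < γ₁) (hδ₁ : 0 < δ₁) {ε B : ℝ} (hε : 0 < ε) (hε1 : ε ≤ 1)
    {f g : ℝ → ℂ} (hf : MemLp (wmul (chmul σ f)) 2) (hg : MemLp (wmul (chmul σ g)) 2)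
    (nf : n2 (wmul (chmul σ f)) ≤ B) (ng : n2 (wmul (chmul σ g)) ≤ B) :
    MemLp (regRhs σ γ γ₁ γ₂ δ₁ δ₂ ε f - regRhs σ γ γ₁ γ₂ δ₁ δ₂ ε g) 2 ∧
    n2 (regRhs σ γ γ₁ γ₂ δ₁ δ₂ ε f - regRhs σ γ γ₁ γ₂ δ₁ δ₂ ε g)
      ≤ regLip γ γ₁ γ₂ δ₁ δ₂ ε B * n2 (wmul (chmul σ (f - g))) := by
  have hd : MemLp (wmul (chmul σ (f - g))) 2 := by
    rw [wmul_chmul_sub]; exact hf.sub hg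
  have B0 : 0 ≤ B := (n2_nonneg _).trans nf
  have C0 := jbConst_nonneg
  have L0 : 0 ≤ lipConst γ B := by rw [lipConst]; positivity
  set d := n2 (wmul (chmul σ (f - g))) with hd'
  have d0 : 0 ≤ d := n2_nonneg _
  set P := 1 + |γ₂| + |δ₂| with hP
  have P0 : 0 ≤ P := by positivity
  set e := Real.sqrt (ellConst γ₁ δ₁) with he
  have e0 : 0 < e := Real.sqrt_pos.2 (ellConst_pos hγ₁ hδ₁)
  -- `F` dominates the dispersive part and `G` the nonlinear part, up to the common factor in ε.
  let F : ℝ → ℂ := fun ξ => ((P * ‖wmul (chmul σ (f - g)) ξ‖ : ℝ) : ℂ)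
  let G : ℝ → ℂ := fun ξ => ((lipConst γ B * d * ‖jbInv ξ‖ : ℝ) : ℂ)
  have nF : ∀ ξ, ‖F ξ‖ = P * ‖wmul (chmul σ (f - g)) ξ‖ := fun ξ => by
    rw [Complex.norm_real, Real.norm_of_nonneg (by positivity)]
  have nG : ∀ ξ, ‖G ξ‖ = lipConst γ B * d * ‖jbInv ξ‖ := fun ξ => by
    rw [Complex.norm_real, Real.norm_of_nonneg (by positivity)]
  have mF : MemLp F 2 := memLp_of_norm_le
    (Complex.continuous_ofReal.comp_aestronglyMeasurable (hd.1.norm.const_mul P)) hd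
    fun ξ => (nF ξ).le
  have mG : MemLp G 2 := memLp_of_norm_le
    (Complex.continuous_ofReal.comp_aestronglyMeasurable (memLp_jbInv.1.norm.const_mul _))
    memLp_jbInv fun ξ => (nG ξ).le
  have bF : n2 F ≤ P * d := n2_le_of_norm_le P0 hd fun ξ => (nF ξ).le
  have bG : n2 G ≤ lipConst γ B * d * jbConst :=
    n2_le_of_norm_le (by positivity) memLp_jbInv fun ξ => (nG ξ).le
  have hpt : ∀ ξ, ‖(regRhs σ γ γ₁ γ₂ δ₁ δ₂ ε f - regRhs σ γ γ₁ γ₂ δ₁ δ₂ ε g) ξ‖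
      ≤ (ε⁻¹ * e⁻¹) * ‖F ξ + G ξ‖ := by
    intro ξ
    have nFG : ‖F ξ + G ξ‖
        = P * ‖wmul (chmul σ (f - g)) ξ‖ + lipConst γ B * d * ‖jbInv ξ‖ := by
      rw [← Complex.ofReal_add, Complex.norm_real, Real.norm_of_nonneg (by positivity)]
    have hb := brk_pos ξ
    have hj := jb_pos ξ
    have hr := rsymb_pos hγ₁ hδ₁ ξ
    have w1 : reg ε ξ * (rsymb γ₁ δ₁ ξ)⁻¹ ≤ ε⁻¹ * (brk ξ)⁻¹ * (e * brk ξ)⁻¹ :=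
      mul_le_mul (reg_le hε hε1 ξ) (inv_anti₀ (by positivity) (le_rsymb hγ₁ hδ₁ ξ))
        (by positivity) (by positivity)
    have eq : (regRhs σ γ γ₁ γ₂ δ₁ δ₂ ε f - regRhs σ γ γ₁ γ₂ δ₁ δ₂ ε g) ξ
        = ((reg ε ξ * (rsymb γ₁ δ₁ ξ)⁻¹ : ℝ) : ℂ) *
          (-Complex.I * ((2 * Real.pi * ξ : ℝ) : ℂ) *
          (((1 - γ₂ * (2 * Real.pi * ξ) ^ 2 + δ₂ * (2 * Real.pi * ξ) ^ 4 : ℝ) : ℂ)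
              * chmul σ (f - g) ξ
            + (chmul σ (nonlin γ f) ξ - chmul σ (nonlin γ g) ξ))) := by
      simp only [Pi.sub_apply, regRhs, chmul_rhs]
      rw [show chmul σ (f - g) ξ = chmul σ f ξ - chmul σ g ξ from chmul_sub σ f g ξ]
      ring
    rw [eq, nFG, norm_mul, norm_mul, norm_mul, norm_neg, Complex.norm_I, one_mul,
      Complex.norm_real, Complex.norm_real, Real.norm_of_nonneg
      (mul_pos (reg_pos hε.le ξ) (inv_pos.2 hr)).le, Real.norm_eq_abs]
    have s1 : ‖((1 - γ₂ * (2 * Real.pi * ξ) ^ 2 + δ₂ * (2 * Real.pi * ξ) ^ 4 : ℝ) : ℂ)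
              * chmul σ (f - g) ξ + (chmul σ (nonlin γ f) ξ - chmul σ (nonlin γ g) ξ)‖
        ≤ P * brk ξ ^ 2 * ‖chmul σ (f - g) ξ‖ + brk ξ * (lipConst γ B * d) := by
      refine (norm_add_le _ _).trans (add_le_add ?_ (norm_chmul_nonlin_sub_le hf hg nf ng ξ))
      rw [norm_mul, Complex.norm_real, Real.norm_eq_abs]
      exact mul_le_mul_of_nonneg_right (abs_dispersion_le ξ) (norm_nonneg _)
    have s2 := abs_k_le_jb ξ
    calc _ ≤ (ε⁻¹ * (brk ξ)⁻¹ * (e * brk ξ)⁻¹) * (jb ξ *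
          (P * brk ξ ^ 2 * ‖chmul σ (f - g) ξ‖ + brk ξ * (lipConst γ B * d))) := by
          gcongr
      _ = (ε⁻¹ * e⁻¹) * (P * (jb ξ * ‖chmul σ (f - g) ξ‖)
            + lipConst γ B * d * (jb ξ)⁻¹) := by
          have : brk ξ = jb ξ * jb ξ := (jb_mul_self ξ).symm
          rw [this]
          field_simp
      _ ≤ _ := by
          rw [norm_wmul, norm_jbInv]
          have : jb ξ ≤ brk ξ := by
            rw [← jb_mul_self]; exact le_mul_of_one_le_left hj.le (one_le_jb ξ)
          gcongr
  have hmeas := (aestronglyMeasurable_regRhs (σ := σ) (γ := γ) (γ₂ := γ₂) (δ₂ := δ₂)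
    hγ₁ hδ₁ hε.le hf).sub
    (aestronglyMeasurable_regRhs (σ := σ) (γ := γ) (γ₂ := γ₂) (δ₂ := δ₂) hγ₁ hδ₁ hε.le hg)
  refine ⟨memLp_of_norm_le hmeas (mF.add mG) hpt, ?_⟩
  have c0 : 0 ≤ ε⁻¹ * e⁻¹ := by positivity
  refine (n2_le_of_norm_le c0 (mF.add mG) hpt).trans ?_
  rw [regLip, ← he, ← hP, mul_assoc (ε⁻¹ * e⁻¹)]
  refine mul_le_mul_of_nonneg_left ?_ c0
  refine (n2_add_le mF mG).trans ((add_le_add bF bG).trans (le_of_eq ?_))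
  ring

/-- The Lipschitz bound is compared with the zero function, at which the right-hand side vanishes.
-/
theorem memLp_regRhs (hγ₁ : 0 < γ₁) (hδ₁ : 0 < δ₁) {ε : ℝ} (hε : 0 < ε) (hε1 : ε ≤ 1)
    {g : ℝ → ℂ} (hg : MemLp (wmul (chmul σ g)) 2) :
    MemLp (regRhs σ γ γ₁ γ₂ δ₁ δ₂ ε g) 2 := by
  have z : wmul (chmul σ (0 : ℝ → ℂ)) = 0 := by ext ξ; simp [wmul, chmul]
  have h0 : MemLp (wmul (chmul σ (0 : ℝ → ℂ))) 2 := by rw [z]; exact MemLp.zero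
  have n0 : n2 (wmul (chmul σ (0 : ℝ → ℂ))) ≤ n2 (wmul (chmul σ g)) := by
    rw [z]; simp [n2]
  have h := (regRhs_sub_bound (γ := γ) (γ₂ := γ₂) (δ₂ := δ₂) hγ₁ hδ₁ hε hε1 hg h0 le_rfl n0).1
  have k0 : kmul (0 : ℝ → ℂ) = 0 := by ext ξ; simp [kmul]
  have r0 : regRhs σ γ γ₁ γ₂ δ₁ δ₂ ε (0 : ℝ → ℂ) = 0 := by
    ext ξ
    simp [regRhs, chmul, rhs, nonlin, k0, conv]
  rwa [r0, sub_zero] at h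

end flow

/-! ### Weak solutions and the regularized energy balance -/

/-- A solution of the equation on the Fourier side. -/
structure FourierSolution (σ γ γ₁ γ₂ δ₁ δ₂ T : ℝ) (g : ℝ → ℝ → ℂ) : Prop where
  mem : ∀ t ∈ Icc 0 T, MemLp (wmul (chmul σ (g t))) 2
  cont : ∀ t ∈ Icc 0 T,
    Tendsto (fun r => n2 (wmul (chmul σ (g r - g t)))) (𝓝[Icc 0 T] t) (𝓝 0)
  herm : ∀ t ∈ Icc 0 T, ∀ᵐ ξ, g t (-ξ) = conj (g t ξ)
  weak : ∀ θ : ℝ → ℂ, ContDiff ℝ ∞ θ → HasCompactSupport θ → ∀ t ∈ Icc 0 T,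
    HasDerivWithinAt (fun r => ∫ ξ, g r ξ * ((symb γ₁ δ₁ ξ : ℂ) * θ ξ))
      (∫ ξ, rhs γ γ₂ δ₂ (g t) ξ * θ ξ) (Icc 0 T) t

namespace FourierSolution

variable {σ γ γ₁ γ₂ δ₁ δ₂ T : ℝ} {g : ℝ → ℝ → ℂ}

theorem continuousOn_norm (S : FourierSolution σ γ γ₁ γ₂ δ₁ δ₂ T g) :
    ContinuousOn (fun t => n2 (wmul (chmul σ (g t)))) (Icc 0 T) := by
  intro t ht
  rw [ContinuousWithinAt, tendsto_iff_dist_tendsto_zero]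
  refine squeeze_zero' (Eventually.of_forall fun r => dist_nonneg) ?_ (S.cont t ht)
  filter_upwards [self_mem_nhdsWithin] with r hr
  have h := abs_norm_sub_norm_le (toL2 (wmul (chmul σ (g r)))) (toL2 (wmul (chmul σ (g t))))
  rwa [toL2_sub (S.mem r hr) (S.mem t ht), norm_toL2 (S.mem r hr), norm_toL2 (S.mem t ht),
    norm_toL2 ((S.mem r hr).sub (S.mem t ht)), ← wmul_chmul_sub] at h

theorem exists_bound (S : FourierSolution σ γ γ₁ γ₂ δ₁ δ₂ T g) :
    ∃ B, ∀ t ∈ Icc 0 T, n2 (wmul (chmul σ (g t))) ≤ B := by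
  obtain ⟨B, hB⟩ := isCompact_Icc.exists_bound_of_continuousOn S.continuousOn_norm
  exact ⟨B, fun t ht => (le_abs_self _).trans (hB t ht)⟩

theorem continuousOn_regRhs (S : FourierSolution σ γ γ₁ γ₂ δ₁ δ₂ T g) (hγ₁ : 0 < γ₁)
    (hδ₁ : 0 < δ₁) {ε : ℝ} (hε : 0 < ε) (hε1 : ε ≤ 1) :
    ContinuousOn (fun t => toL2 (regRhs σ γ γ₁ γ₂ δ₁ δ₂ ε (g t))) (Icc 0 T) := by
  obtain ⟨B, hB⟩ := S.exists_bound
  intro t ht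
  rw [ContinuousWithinAt, tendsto_iff_norm_sub_tendsto_zero]
  have h0 := (S.cont t ht).const_mul (regLip γ γ₁ γ₂ δ₁ δ₂ ε B)
  rw [mul_zero] at h0
  refine squeeze_zero' (Eventually.of_forall fun r => norm_nonneg _) ?_ h0
  filter_upwards [self_mem_nhdsWithin] with r hr
  obtain ⟨h1, h2⟩ := regRhs_sub_bound (γ := γ) (γ₂ := γ₂) (δ₂ := δ₂) hγ₁ hδ₁ hε hε1
    (S.mem r hr) (S.mem t ht) (hB r hr) (hB t ht)
  rwa [toL2_sub (memLp_regRhs hγ₁ hδ₁ hε hε1 (S.mem r hr))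
    (memLp_regRhs hγ₁ hδ₁ hε hε1 (S.mem t ht)), norm_toL2 h1]

theorem hasDerivWithinAt_regState (S : FourierSolution σ γ γ₁ γ₂ δ₁ δ₂ T g) (hγ₁ : 0 < γ₁)
    (hδ₁ : 0 < δ₁) {ε : ℝ} (hε : 0 < ε) (hε1 : ε ≤ 1) {t : ℝ} (ht : t ∈ Icc 0 T) :
    HasDerivWithinAt (fun r => toL2 (regState σ γ₁ δ₁ ε (g r)))
      (toL2 (regRhs σ γ γ₁ γ₂ δ₁ δ₂ ε (g t))) (Icc 0 T) t := by
  refine hasDerivWithinAt_of_weak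
    (h := fun t => toL2 (regRhs σ γ γ₁ γ₂ δ₁ δ₂ ε (g t)))
    (Lp.dense_hasCompactSupport_contDiff (F := ℂ) (μ := (volume : Measure ℝ)) (p := 2)
      (by norm_num)) (convex_Icc 0 T) (S.continuousOn_regRhs hγ₁ hδ₁ hε hε1) ?_ ht
  rintro d ⟨k, hdk, hkc, hks⟩ s hs
  -- `M` is the multiplier occurring in `regRhs`. Multiplied by the symbol it becomes the multiplier
  -- of `regState`, because the symbol is the square of `rsymb`.
  let M : ℝ → ℂ := fun ξ => ((reg ε ξ * (rsymb γ₁ δ₁ ξ)⁻¹ *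
    Real.cosh (σ * (2 * Real.pi * ξ)) : ℝ) : ℂ)
  have hM : ContDiff ℝ ∞ M := by
    refine Complex.ofRealCLM.contDiff.comp (((contDiff_reg hε.le).mul
      ((contDiff_rsymb hγ₁ hδ₁).inv fun ξ => (rsymb_pos hγ₁ hδ₁ ξ).ne')).mul ?_)
    exact Real.contDiff_cosh.comp (by fun_prop)
  let θ : ℝ → ℂ := fun ξ => M ξ * conj (k ξ)
  have hθ : ContDiff ℝ ∞ θ := hM.mul (Complex.conjCLE.contDiff.comp hks)
  have hθc : HasCompactSupport θ :=
    (hkc.comp_left (g := fun z : ℂ => conj z) (by simp)).mul_left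
  have inn : ∀ {F : ℝ → ℂ}, MemLp F 2 → inner ℂ d (toL2 F) = ∫ ξ, conj (k ξ) * F ξ := by
    intro F hF
    rw [L2.inner_def]
    refine integral_congr_ae ?_
    filter_upwards [hdk, coeFn_toL2 hF] with ξ h1 h2
    rw [h1, h2, RCLike.inner_apply, mul_comm]
  have e1 : ∀ r ∈ Icc 0 T, inner ℂ d (toL2 (regState σ γ₁ δ₁ ε (g r)))
      = ∫ ξ, g r ξ * ((symb γ₁ δ₁ ξ : ℂ) * θ ξ) := by
    intro r hr
    rw [inn (memLp_regState hγ₁ hδ₁ hε.le (S.mem r hr))]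
    refine integral_congr_ae (Eventually.of_forall fun ξ => ?_)
    have hr0 : (rsymb γ₁ δ₁ ξ : ℂ) ≠ 0 := by exact_mod_cast (rsymb_pos hγ₁ hδ₁ ξ).ne'
    simp only [regState, chmul, θ, M, ← rsymb_mul_self hγ₁ hδ₁ ξ]
    push_cast
    field_simp
  have e2 : inner ℂ d (toL2 (regRhs σ γ γ₁ γ₂ δ₁ δ₂ ε (g s)))
      = ∫ ξ, rhs γ γ₂ δ₂ (g s) ξ * θ ξ := by
    rw [inn (memLp_regRhs hγ₁ hδ₁ hε hε1 (S.mem s hs))]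
    refine integral_congr_ae (Eventually.of_forall fun ξ => ?_)
    simp only [regRhs, chmul, θ, M]
    push_cast
    ring
  rw [e2]
  exact (S.weak θ hθ hθc s hs).congr e1 (e1 s hs)

/-- The factors `rsymb` and its inverse cancel. The dispersive part is an imaginary multiple of
|a|², so the real part sees only the nonlinearity. -/
theorem re_inner_regState_regRhs (S : FourierSolution σ γ γ₁ γ₂ δ₁ δ₂ T g) (hγ₁ : 0 < γ₁)
    (hδ₁ : 0 < δ₁) {ε : ℝ} (hε : 0 < ε) (hε1 : ε ≤ 1) {t : ℝ} (ht : t ∈ Icc 0 T) :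
    (inner ℂ (toL2 (regState σ γ₁ δ₁ ε (g t))) (toL2 (regRhs σ γ γ₁ γ₂ δ₁ δ₂ ε (g t)))).re
      = ∫ ξ, reg ε ξ ^ 2 * (flux σ γ (g t) ξ).re := by
  have h1 := memLp_regState (γ₁ := γ₁) (δ₁ := δ₁) hγ₁ hδ₁ hε.le (S.mem t ht)
  have h2 := memLp_regRhs (γ := γ) (γ₂ := γ₂) (δ₂ := δ₂) hγ₁ hδ₁ hε hε1 (S.mem t ht)
  rw [inner_toL2 h1 h2]
  have hi : Integrable fun ξ => conj (regState σ γ₁ δ₁ ε (g t) ξ)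
      * regRhs σ γ γ₁ γ₂ δ₁ δ₂ ε (g t) ξ := integrable_mul_of_memLp h1.star h2
  have := integral_re hi
  simp only [RCLike.re_to_complex] at this
  rw [← this]
  refine integral_congr_ae (Eventually.of_forall fun ξ => ?_)
  have hr0 : rsymb γ₁ δ₁ ξ ≠ 0 := (rsymb_pos hγ₁ hδ₁ ξ).ne'
  have e : conj (regState σ γ₁ δ₁ ε (g t) ξ) * regRhs σ γ γ₁ γ₂ δ₁ δ₂ ε (g t) ξ
      = ((reg ε ξ ^ 2 : ℝ) : ℂ) * flux σ γ (g t) ξ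
        + (((reg ε ξ ^ 2 * -(2 * Real.pi * ξ) *
          (1 - γ₂ * (2 * Real.pi * ξ) ^ 2 + δ₂ * (2 * Real.pi * ξ) ^ 4)) *
          ‖chmul σ (g t) ξ‖ ^ 2 : ℝ) : ℂ) * Complex.I := by
    have hn : ((‖chmul σ (g t) ξ‖ ^ 2 : ℝ) : ℂ)
        = conj (chmul σ (g t) ξ) * chmul σ (g t) ξ := by
      rw [← Complex.normSq_eq_norm_sq, Complex.normSq_eq_conj_mul_self]
    have hr1 : (rsymb γ₁ δ₁ ξ : ℂ) ≠ 0 := by exact_mod_cast hr0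
    rw [Complex.ofReal_mul _ (‖chmul σ (g t) ξ‖ ^ 2), hn, regState, regRhs, chmul_rhs, flux,
      map_mul, Complex.conj_ofReal]
    push_cast
    field_simp
    ring
  simp only [e, Complex.add_re, Complex.re_ofReal_mul, Complex.I_re, mul_zero, add_zero]

/-- The time derivative of the regularized energy. -/
theorem hasDerivWithinAt_regEnergy (S : FourierSolution σ γ γ₁ γ₂ δ₁ δ₂ T g) (hγ₁ : 0 < γ₁)
    (hδ₁ : 0 < δ₁) {ε : ℝ} (hε : 0 < ε) (hε1 : ε ≤ 1) {t : ℝ} (ht : t ∈ Icc 0 T) :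
    HasDerivWithinAt (fun r => ‖toL2 (regState σ γ₁ δ₁ ε (g r))‖ ^ 2)
      (2 * ∫ ξ, reg ε ξ ^ 2 * (flux σ γ (g t) ξ).re) (Icc 0 T) t := by
  have h := S.hasDerivWithinAt_regState hγ₁ hδ₁ hε hε1 ht
  have h2 := HasDerivWithinAt.inner ℂ h h
  have h3 := Complex.reCLM.hasFDerivAt.comp_hasDerivWithinAt t h2
  have e := S.re_inner_regState_regRhs hγ₁ hδ₁ hε hε1 ht
  refine (h3.congr (fun r _ => ?_) ?_).congr_deriv ?_
  · simp only [Function.comp_apply, Complex.reCLM_apply]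
    exact (inner_self_eq_norm_sq (𝕜 := ℂ) _).symm
  · simp only [Function.comp_apply, Complex.reCLM_apply]
    exact (inner_self_eq_norm_sq (𝕜 := ℂ) _).symm
  · rw [Complex.reCLM_apply, Complex.add_re, e, ← e]
    have := inner_re_symm (𝕜 := ℂ) (toL2 (regRhs σ γ γ₁ γ₂ δ₁ δ₂ ε (g t)))
      (toL2 (regState σ γ₁ δ₁ ε (g t)))
    simp only [RCLike.re_to_complex] at this
    rw [this]; ring

/-- Supplies integrability in time for the fundamental theorem of calculus and measurability in time
for the limit ε → 0. -/
theorem continuousOn_integral_flux (S : FourierSolution σ γ γ₁ γ₂ δ₁ δ₂ T g) (hγ₁ : 0 < γ₁)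
    (hδ₁ : 0 < δ₁) {ε : ℝ} (hε : 0 < ε) (hε1 : ε ≤ 1) :
    ContinuousOn (fun t => ∫ ξ, reg ε ξ ^ 2 * (flux σ γ (g t) ξ).re) (Icc 0 T) := by
  have h1 : ContinuousOn (fun t => toL2 (regState σ γ₁ δ₁ ε (g t))) (Icc 0 T) := fun t ht =>
    (S.hasDerivWithinAt_regState hγ₁ hδ₁ hε hε1 ht).continuousWithinAt
  have h2 := h1.inner (𝕜 := ℂ) (S.continuousOn_regRhs hγ₁ hδ₁ hε hε1)
  refine (Complex.continuous_re.comp_continuousOn h2).congr fun t ht => ?_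
  exact (S.re_inner_regState_regRhs hγ₁ hδ₁ hε hε1 ht).symm

theorem regEnergy_sub (S : FourierSolution σ γ γ₁ γ₂ δ₁ δ₂ T g) (hγ₁ : 0 < γ₁)
    (hδ₁ : 0 < δ₁) {ε : ℝ} (hε : 0 < ε) (hε1 : ε ≤ 1) {t : ℝ} (ht : t ∈ Icc 0 T) :
    n2 (regState σ γ₁ δ₁ ε (g t)) ^ 2 - n2 (regState σ γ₁ δ₁ ε (g 0)) ^ 2
      = 2 * ∫ r in (0 : ℝ)..t, ∫ ξ, reg ε ξ ^ 2 * (flux σ γ (g r) ξ).re := by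
  have h0 : (0 : ℝ) ∈ Icc 0 T := ⟨le_rfl, ht.1.trans ht.2⟩
  have hsub : Icc 0 t ⊆ Icc 0 T := Icc_subset_Icc_right ht.2
  rw [← norm_toL2 (memLp_regState hγ₁ hδ₁ hε.le (S.mem t ht)),
    ← norm_toL2 (memLp_regState hγ₁ hδ₁ hε.le (S.mem 0 h0)), ← intervalIntegral.integral_const_mul]
  refine (intervalIntegral.integral_eq_sub_of_hasDeriv_right
    (f := fun r => ‖toL2 (regState σ γ₁ δ₁ ε (g r))‖ ^ 2) ?_ ?_ ?_).symm
  · rw [uIcc_of_le ht.1]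
    exact fun r hr => (S.hasDerivWithinAt_regEnergy hγ₁ hδ₁ hε hε1 (hsub hr)).continuousWithinAt.mono
      hsub
  · rw [min_eq_left ht.1, max_eq_right ht.1]
    intro r hr
    have hr' : r ∈ Ioo 0 T := ⟨hr.1, hr.2.trans_le ht.2⟩
    exact ((S.hasDerivWithinAt_regEnergy hγ₁ hδ₁ hε hε1 (Ioo_subset_Icc_self hr')).hasDerivAt
      (Icc_mem_nhds hr'.1 hr'.2)).hasDerivWithinAt
  · refine ContinuousOn.intervalIntegrable ?_
    rw [uIcc_of_le ht.1]
    exact ((S.continuousOn_integral_flux hγ₁ hδ₁ hε hε1).mono hsub).const_mul 2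

end FourierSolution

/-! ### The energy on the Fourier side -/

/-- The modified energy in terms of the Fourier transform. -/
def fourierEnergy (γ₁ δ₁ σ : ℝ) (g : ℝ → ℂ) : ℝ :=
  (1 / 2) * ∫ ξ, symb γ₁ δ₁ ξ * ‖chmul σ g ξ‖ ^ 2

section limit

variable {σ γ γ₁ γ₂ δ₁ δ₂ T : ℝ}

theorem tendsto_reg (ξ : ℝ) : Tendsto (fun n : ℕ => reg (1 / ((n : ℝ) + 1)) ξ) atTop (𝓝 1) := by
  have h := ((tendsto_one_div_add_atTop_nhds_zero_nat (𝕜 := ℝ)).mul_const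
    ((2 * Real.pi * ξ) ^ 2)).const_add 1
  have h2 := h.inv₀ (by simp)
  simpa [reg] using h2

theorem norm_regState_sq (hγ₁ : 0 < γ₁) (hδ₁ : 0 < δ₁) {ε : ℝ} (hε : 0 ≤ ε) (g : ℝ → ℂ) (ξ : ℝ) :
    ‖regState σ γ₁ δ₁ ε g ξ‖ ^ 2 = reg ε ξ ^ 2 * (symb γ₁ δ₁ ξ * ‖chmul σ g ξ‖ ^ 2) := by
  rw [regState, norm_mul, Complex.norm_real, Real.norm_of_nonneg
    (mul_pos (reg_pos hε ξ) (rsymb_pos hγ₁ hδ₁ ξ)).le, ← rsymb_mul_self hγ₁ hδ₁ ξ]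
  ring

theorem integrable_symb_mul (hγ₁ : 0 < γ₁) (hδ₁ : 0 < δ₁) {g : ℝ → ℂ}
    (hg : MemLp (wmul (chmul σ g)) 2) :
    Integrable fun ξ => symb γ₁ δ₁ ξ * ‖chmul σ g ξ‖ ^ 2 := by
  -- At ε = 0 the regularizing factor is 1.
  refine ((memLp_regState hγ₁ hδ₁ le_rfl hg).integrable_norm_pow (by norm_num)).congr
    (Eventually.of_forall fun ξ => ?_)
  simp only
  rw [norm_regState_sq hγ₁ hδ₁ le_rfl]
  simp [reg]

theorem tendsto_reg_sq_mul {f : ℝ → ℝ} (hf : Integrable f) :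
    Tendsto (fun n : ℕ => ∫ ξ, reg (1 / ((n : ℝ) + 1)) ξ ^ 2 * f ξ) atTop (𝓝 (∫ ξ, f ξ)) := by
  refine tendsto_integral_of_dominated_convergence (fun ξ => ‖f ξ‖) (fun n => ?_) hf.norm
    (fun n => Eventually.of_forall fun ξ => ?_) (Eventually.of_forall fun ξ => ?_)
  · exact ((contDiff_reg (by positivity)).continuous.pow 2).aestronglyMeasurable.mul hf.1
  · have h0 := reg_pos (ε := 1 / ((n : ℝ) + 1)) (by positivity) ξ
    have h1 := reg_le_one (ε := 1 / ((n : ℝ) + 1)) (by positivity) ξ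
    rw [norm_mul, norm_pow, Real.norm_of_nonneg h0.le]
    exact mul_le_of_le_one_left (norm_nonneg _) (pow_le_one₀ h0.le h1)
  · simpa using ((tendsto_reg ξ).pow 2).mul_const (f ξ)

theorem tendsto_n2_regState (hγ₁ : 0 < γ₁) (hδ₁ : 0 < δ₁) {g : ℝ → ℂ}
    (hg : MemLp (wmul (chmul σ g)) 2) :
    Tendsto (fun n : ℕ => n2 (regState σ γ₁ δ₁ (1 / ((n : ℝ) + 1)) g) ^ 2) atTop
      (𝓝 (2 * fourierEnergy γ₁ δ₁ σ g)) := by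
  have h := tendsto_reg_sq_mul (integrable_symb_mul hγ₁ hδ₁ hg)
  rw [fourierEnergy, ← mul_assoc, show (2 : ℝ) * (1 / 2) = 1 by norm_num, one_mul]
  refine h.congr fun n => ?_
  rw [← integral_norm_sq_eq (memLp_regState hγ₁ hδ₁ (by positivity) hg)]
  exact integral_congr_ae (Eventually.of_forall fun ξ =>
    (norm_regState_sq hγ₁ hδ₁ (by positivity) g ξ).symm)

theorem fourierEnergy_bounds (hγ₁ : 0 < γ₁) (hδ₁ : 0 < δ₁) {g : ℝ → ℂ}
    (hg : MemLp (wmul (chmul σ g)) 2) :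
    ellConst γ₁ δ₁ / 2 * n2 (wmul (chmul σ g)) ^ 2 ≤ fourierEnergy γ₁ δ₁ σ g ∧
    fourierEnergy γ₁ δ₁ σ g ≤ (1 + γ₁ + δ₁) / 2 * n2 (wmul (chmul σ g)) ^ 2 := by
  have hi := hg.integrable_norm_pow (p := 2) (by norm_num)
  have hs := integrable_symb_mul hγ₁ hδ₁ hg
  rw [← integral_norm_sq_eq hg, fourierEnergy]
  have l : ∫ ξ, ellConst γ₁ δ₁ * ‖wmul (chmul σ g) ξ‖ ^ 2
      ≤ ∫ ξ, symb γ₁ δ₁ ξ * ‖chmul σ g ξ‖ ^ 2 := by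
    refine integral_mono (hi.const_mul _) hs fun ξ => ?_
    simp only [norm_wmul, mul_pow, ← mul_assoc]
    exact mul_le_mul_of_nonneg_right (ellConst_mul_le_symb ξ) (by positivity)
  have u : ∫ ξ, symb γ₁ δ₁ ξ * ‖chmul σ g ξ‖ ^ 2
      ≤ ∫ ξ, (1 + γ₁ + δ₁) * ‖wmul (chmul σ g) ξ‖ ^ 2 := by
    refine integral_mono hs (hi.const_mul _) fun ξ => ?_
    simp only [norm_wmul, mul_pow, ← mul_assoc]
    exact mul_le_mul_of_nonneg_right (symb_le hγ₁ hδ₁ ξ) (by positivity)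
  rw [integral_const_mul] at l u
  constructor <;> linarith

theorem abs_integral_re_le {f : ℝ → ℂ} (hf : Integrable f) : |∫ ξ, (f ξ).re| ≤ ‖∫ ξ, f ξ‖ := by
  have h := integral_re hf
  simp only [RCLike.re_to_complex] at h
  rw [h]
  exact Complex.abs_re_le_norm _

namespace FourierSolution

variable {g : ℝ → ℝ → ℂ}

/-- The balance law of the modified energy. -/
theorem fourierEnergy_sub (S : FourierSolution σ (7 / 48) γ₁ γ₂ δ₁ δ₂ T g) (hσ : 0 ≤ σ)
    (hγ₁ : 0 < γ₁) (hδ₁ : 0 < δ₁) {t : ℝ} (ht : t ∈ Icc 0 T) :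
    fourierEnergy γ₁ δ₁ σ (g t) - fourierEnergy γ₁ δ₁ σ (g 0)
      = ∫ r in (0 : ℝ)..t, ∫ ξ, (flux σ (7 / 48) (g r) ξ).re := by
  obtain ⟨B, hB⟩ := S.exists_bound
  have h0 : (0 : ℝ) ∈ Icc 0 T := ⟨le_rfl, ht.1.trans ht.2⟩
  have hsub : uIoc 0 t ⊆ Icc 0 T := by
    rw [uIoc_of_le ht.1]
    exact fun r hr => ⟨hr.1.le, hr.2.trans ht.2⟩
  have hpos : ∀ n : ℕ, 0 < 1 / ((n : ℝ) + 1) := fun n => by positivity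
  have hle : ∀ n : ℕ, 1 / ((n : ℝ) + 1) ≤ 1 := fun n => by
    rw [div_le_one (by positivity)]
    linarith [(Nat.cast_nonneg n : (0 : ℝ) ≤ n)]
  have hl := (tendsto_n2_regState hγ₁ hδ₁ (S.mem t ht)).sub
    (tendsto_n2_regState hγ₁ hδ₁ (S.mem 0 h0))
  have hr : Tendsto (fun n : ℕ => ∫ r in (0 : ℝ)..t,
      ∫ ξ, reg (1 / ((n : ℝ) + 1)) ξ ^ 2 * (flux σ (7 / 48) (g r) ξ).re) atTop
      (𝓝 (∫ r in (0 : ℝ)..t, ∫ ξ, (flux σ (7 / 48) (g r) ξ).re)) := by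
    -- The dominating constant is the absolute bound on the flux, uniform in time and in ε since the
    -- norm is bounded on [0, T] and the regularizing factor is at most 1.
    refine intervalIntegral.tendsto_integral_filter_of_dominated_convergence
      (fun _ => 4 * (jbConst * B ^ 3 + jbConst ^ 2 * B ^ 4))
      (Eventually.of_forall fun n => ?_) (Eventually.of_forall fun n => ?_)
      intervalIntegrable_const ?_
    · exact ((S.continuousOn_integral_flux hγ₁ hδ₁ (hpos n) (hle n)).mono
        hsub).aestronglyMeasurable measurableSet_uIoc
    · refine Eventually.of_forall fun r hr => ?_
      obtain ⟨hi, hn, -⟩ := flux_estimate hσ (S.mem r (hsub hr)) (S.herm r (hsub hr))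
      refine (norm_integral_le_integral_norm _).trans ?_
      have C0 := jbConst_nonneg
      have X0 := n2_nonneg (wmul (chmul σ (g r)))
      have XB := hB r (hsub hr)
      calc _ ≤ ∫ ξ, ‖flux σ (7 / 48) (g r) ξ‖ := by
            refine integral_mono_of_nonneg (Eventually.of_forall fun ξ => norm_nonneg _) hi.norm
              (Eventually.of_forall fun ξ => ?_)
            have h1 := reg_pos (hpos n).le ξ
            simp only [norm_mul, norm_pow, Real.norm_of_nonneg h1.le]
            exact (mul_le_of_le_one_left (norm_nonneg _)
              (pow_le_one₀ h1.le (reg_le_one (hpos n).le ξ))).trans (Complex.abs_re_le_norm _)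
        _ ≤ _ := hn
        _ ≤ _ := by gcongr
    · refine Eventually.of_forall fun r hr => ?_
      exact tendsto_reg_sq_mul (flux_estimate hσ (S.mem r (hsub hr)) (S.herm r (hsub hr))).1.re
  have hu := tendsto_nhds_unique hl ((hr.const_mul 2).congr fun n =>
    (S.regEnergy_sub hγ₁ hδ₁ (hpos n) (hle n) ht).symm)
  linarith

theorem abs_fourierEnergy_sub_le (S : FourierSolution σ (7 / 48) γ₁ γ₂ δ₁ δ₂ T g) (hσ : 0 ≤ σ)
    (hγ₁ : 0 < γ₁) (hδ₁ : 0 < δ₁) {t : ℝ} (ht : t ∈ Icc 0 T) :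
    |fourierEnergy γ₁ δ₁ σ (g t) - fourierEnergy γ₁ δ₁ σ (g 0)|
      ≤ ∫ r in (0 : ℝ)..t, (min 1 σ) ^ 2 * (2 * jbConst * n2 (wmul (chmul σ (g r))) ^ 3
        + jbConst ^ 2 * n2 (wmul (chmul σ (g r))) ^ 4) := by
  rw [S.fourierEnergy_sub hσ hγ₁ hδ₁ ht, ← Real.norm_eq_abs]
  have hsub : Icc 0 t ⊆ Icc 0 T := Icc_subset_Icc_right ht.2
  refine intervalIntegral.norm_integral_le_of_norm_le ht.1
    (Eventually.of_forall fun r hr => ?_) ?_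
  · have hr' := hsub (Ioc_subset_Icc_self hr)
    obtain ⟨hi, -, hn⟩ := flux_estimate hσ (S.mem r hr') (S.herm r hr')
    exact (abs_integral_re_le hi).trans hn
  · refine ContinuousOn.intervalIntegrable ?_
    rw [uIcc_of_le ht.1]
    have hc := S.continuousOn_norm.mono hsub
    exact (((hc.pow 3).const_mul _).add ((hc.pow 4).const_mul _)).const_mul _

end FourierSolution

end limit

/-! ### Passage to the Fourier side -/

section bridge

variable {σ γ γ₁ γ₂ δ₁ δ₂ T : ℝ}

theorem cosh_mul_abs (σ k : ℝ) : Real.cosh (σ * |k|) = Real.cosh (σ * k) := by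
  rcases abs_choice k with h | h <;> rw [h]
  rw [mul_neg, Real.cosh_neg]

theorem weight_two (σ ξ : ℝ) :
    weight σ 2 (2 * Real.pi * ξ) = Real.cosh (σ * (2 * Real.pi * ξ)) * brk ξ := by
  rw [weight, Real.rpow_two, Real.sq_sqrt (by positivity), cosh_mul_abs, brk]

theorem weight_two_mul (σ : ℝ) (g : ℝ → ℂ) :
    (fun ξ : ℝ => (weight σ 2 (2 * Real.pi * ξ) : ℂ) * g ξ) = wmul (chmul σ g) := by
  ext ξ
  rw [weight_two, wmul, chmul]
  push_cast
  ring

theorem MemH.memLp {f : L2} (h : MemH σ 2 f) : MemLp (wmul (chmul σ (hat f))) 2 := by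
  rw [← weight_two_mul]; exact h

theorem normH_eq (f : L2) : normH σ 2 f = n2 (wmul (chmul σ (hat f))) := by
  rw [← weight_two_mul, normH, n2]

theorem wmul_chmul_congr {f g : ℝ → ℂ} (h : f =ᵐ[volume] g) :
    n2 (wmul (chmul σ f)) = n2 (wmul (chmul σ g)) := by
  rw [n2, n2, eLpNorm_congr_ae]
  filter_upwards [h] with ξ hξ
  rw [wmul, wmul, chmul, chmul, hξ]

theorem hat_dx {f : L2} (h : MemLp (kmul (hat f)) 2) :
    ∀ᵐ ξ, hat (dx f) ξ = Complex.I * kmul (hat f) ξ := by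
  have hd : InDomain (fun ξ => Complex.I * ξ) f := by
    refine (h.const_mul Complex.I).ae_eq (Eventually.of_forall fun ξ => ?_)
    simp only [kmul]; ring
  filter_upwards [hat_multiplier (fun ξ => Complex.I * ξ) (by simp) f hd] with ξ h1
  rw [dx, h1, kmul]; ring

theorem hat_coshD {f : L2} (h : MemLp (chmul σ (hat f)) 2) :
    ∀ᵐ ξ, hat (coshD σ f) ξ = chmul σ (hat f) ξ := by
  have e : ∀ ξ : ℝ, ((Real.cosh (σ * |2 * Real.pi * ξ|) : ℝ) : ℂ) * hat f ξ
      = chmul σ (hat f) ξ := fun ξ => by rw [cosh_mul_abs, chmul]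
  have hd : InDomain (fun ξ => ((Real.cosh (σ * |ξ|) : ℝ) : ℂ)) f :=
    h.ae_eq (Eventually.of_forall fun ξ => (e ξ).symm)
  filter_upwards [hat_multiplier _ (fun ξ => by rw [abs_neg, Complex.conj_ofReal]) f hd]
    with ξ h1
  rw [coshD, h1, e]

theorem kmul_congr {f g : ℝ → ℂ} (h : f =ᵐ[volume] g) : kmul f =ᵐ[volume] kmul g := by
  filter_upwards [h] with ξ hξ
  rw [kmul, kmul, hξ]

theorem integrable_coe_sq (f : L2) : Integrable fun x => f x ^ 2 :=
  (Lp.memLp f).integrable_sq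

/-- Plancherel applied to each of the three terms. The square-integrability of `ka` and of `k²a`
ensures that neither `coshD` nor `dx` takes its default value 0. -/
theorem energy_eq {f : L2} (h : MemH σ 2 f) :
    energy γ₁ δ₁ σ f = fourierEnergy γ₁ δ₁ σ (hat f) := by
  obtain ⟨a2, ka2, -⟩ := bounds_self h.memLp
  obtain ⟨-, kka2, -⟩ := bounds_kmul h.memLp
  have h1 := hat_coshD a2
  have m1 : MemLp (kmul (hat (coshD σ f))) 2 := ka2.ae_eq (kmul_congr h1).symm
  have h2 : ∀ᵐ ξ, hat (dx (coshD σ f)) ξ = Complex.I * kmul (chmul σ (hat f)) ξ := by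
    filter_upwards [hat_dx m1, kmul_congr h1] with ξ e1 e2
    rw [e1, e2]
  have e3 : ∀ᵐ ξ, kmul (hat (dx (coshD σ f))) ξ
      = Complex.I * kmul (kmul (chmul σ (hat f))) ξ := by
    filter_upwards [h2] with ξ e
    simp only [kmul] at e ⊢
    rw [e]; ring
  have m2 : MemLp (kmul (hat (dx (coshD σ f)))) 2 :=
    (kka2.const_mul Complex.I).ae_eq (e3.mono fun ξ h => h.symm)
  have h3 : ∀ᵐ ξ, hat (dx (dx (coshD σ f))) ξ
      = Complex.I * (Complex.I * kmul (kmul (chmul σ (hat f))) ξ) := by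
    filter_upwards [hat_dx m2, e3] with ξ e1 e2
    rw [e1, e2]
  have i1 := integrable_coe_sq (coshD σ f)
  have i2 := (integrable_coe_sq (dx (coshD σ f))).const_mul γ₁
  have i3 := (integrable_coe_sq (dx (dx (coshD σ f)))).const_mul δ₁
  have i12 : Integrable fun x => coshD σ f x ^ 2 + γ₁ * dx (coshD σ f) x ^ 2 := i1.add i2
  rw [energy, fourierEnergy, integral_add i12 i3, integral_add i1 i2, integral_const_mul,
    integral_const_mul, integral_sq_eq_integral_hat, integral_sq_eq_integral_hat,
    integral_sq_eq_integral_hat, integral_congr_ae (h1.mono fun ξ h => congrArg (‖·‖ ^ 2) h),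
    integral_congr_ae (h2.mono fun ξ h => congrArg (‖·‖ ^ 2) h),
    integral_congr_ae (h3.mono fun ξ h => congrArg (‖·‖ ^ 2) h)]
  have j1 := a2.integrable_norm_pow (p := 2) (by norm_num)
  have j2 := (ka2.integrable_norm_pow (p := 2) (by norm_num)).const_mul γ₁
  have j3 := (kka2.integrable_norm_pow (p := 2) (by norm_num)).const_mul δ₁
  have j12 : Integrable fun ξ => ‖chmul σ (hat f) ξ‖ ^ 2
      + γ₁ * ‖kmul (chmul σ (hat f)) ξ‖ ^ 2 := j1.add j2
  simp only [norm_mul, Complex.norm_I, one_mul]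
  rw [← integral_const_mul, ← integral_const_mul, ← integral_add j1 j2,
    ← integral_add j12 j3]
  refine congrArg (1 / 2 * ·) (integral_congr_ae (Eventually.of_forall fun ξ => ?_))
  simp only [norm_kmul, symb]
  have := sq_abs (2 * Real.pi * ξ)
  have h4 : |2 * Real.pi * ξ| ^ 4 = (2 * Real.pi * ξ) ^ 4 := by
    rw [show 4 = 2 * 2 from rfl, pow_mul, pow_mul, this]
  rw [← this, ← h4]
  ring

theorem hasFourier_hat {f : L2} (hf : Integrable (hat f)) : HasFourier f (hat f) :=
  ⟨hf, coe_ae_eq_fourierInv f hf⟩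

theorem hasFourier_dx {f : L2} (h2 : MemLp (kmul (hat f)) 2) (h1 : Integrable (kmul (hat f))) :
    HasFourier (dx f) (fun ξ => Complex.I * kmul (hat f) ξ) := by
  have e := hat_dx h2
  have hi : Integrable (fun ξ => Complex.I * kmul (hat f) ξ) := h1.const_mul _
  refine ⟨hi, ?_⟩
  filter_upwards [coe_ae_eq_fourierInv (dx f) (hi.congr (e.mono fun ξ h => h.symm))] with x hx
  rw [hx, Real.fourierInv_eq, Real.fourierInv_eq]
  refine integral_congr_ae ?_
  filter_upwards [e] with ξ hξ
  rw [hξ]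

theorem fourierSolution {η₀ : L2} {η : ℝ → L2} (hc : ContInH σ 2 T η)
    (hs : IsSolution γ γ₁ γ₂ δ₁ δ₂ T η₀ η) :
    FourierSolution σ γ γ₁ γ₂ δ₁ δ₂ T (fun t => hat (η t)) where
  mem t ht := (hc t ht).1.memLp
  cont t ht := by
    refine (hc t ht).2.congr fun r => ?_
    rw [normH_eq]
    refine wmul_chmul_congr ?_
    rw [hat_sub]
    exact Lp.coeFn_sub _ _
  herm t _ := hat_neg_ae (η t)
  weak θ hθ hcs t ht := by
    refine hs.hasDerivWithinAt_hat (fun r hr => ?_) (fun r hr => ?_) θ hθ hcs ht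
    · exact hasFourier_hat (integrable_of_chmul (bounds_self (hc r hr).1.memLp).2.2.1)
    · obtain ⟨h2, -, h1, -⟩ := bounds_kmul (hc r hr).1.memLp
      rw [kmul_chmul] at h1 h2
      exact hasFourier_dx (memLp_of_chmul h2) (integrable_of_chmul h1)

end bridge

/-! ### The continuity argument -/

section bootstrap

variable {X : ℝ → ℝ} {c₁ c₂ a b e T : ℝ}

/-- At the first time at which X reaches R, the integrand has been at most its value at R, so the
integral inequality contradicts the smallness assumption. -/
theorem lt_of_integral_bound {R : ℝ} (hT : 0 ≤ T) (hX : ContinuousOn X (Icc 0 T))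
    (hX0 : ∀ t ∈ Icc 0 T, 0 ≤ X t) (hc₁ : 0 < c₁) (ha : 0 ≤ a) (hb : 0 ≤ b) (hR : X 0 < R)
    (hE : ∀ t ∈ Icc 0 T, c₁ * X t ^ 2 ≤ e + ∫ r in (0 : ℝ)..t, (a * X r ^ 3 + b * X r ^ 4))
    (hsmall : e + T * (a * R ^ 3 + b * R ^ 4) < c₁ * R ^ 2) :
    ∀ t ∈ Icc 0 T, X t < R := by
  by_contra! hcon
  have R0 : 0 ≤ R := (hX0 0 ⟨le_rfl, hT⟩).trans hR.le
  have hK : IsCompact (Icc 0 T ∩ X ⁻¹' Ici R) :=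
    isCompact_Icc.of_isClosed_subset (hX.preimage_isClosed_of_isClosed isClosed_Icc isClosed_Ici)
      inter_subset_left
  obtain ⟨t, ⟨ht, hRt⟩, hmin⟩ := hK.exists_isLeast hcon
  have hlt : ∀ r ∈ Ioo 0 t, X r ≤ R := fun r hr => by
    by_contra! h
    exact absurd (hmin ⟨⟨hr.1.le, hr.2.le.trans ht.2⟩, h.le⟩) (not_le.2 hr.2)
  have hsub : Icc 0 t ⊆ Icc 0 T := Icc_subset_Icc_right ht.2
  have hc := hX.mono hsub
  have hi : IntervalIntegrable (fun r => a * X r ^ 3 + b * X r ^ 4) volume 0 t := by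
    refine ContinuousOn.intervalIntegrable ?_
    rw [uIcc_of_le ht.1]
    exact ((hc.pow 3).const_mul _).add ((hc.pow 4).const_mul _)
  have hint : ∫ r in (0 : ℝ)..t, (a * X r ^ 3 + b * X r ^ 4)
      ≤ ∫ r in (0 : ℝ)..t, (a * R ^ 3 + b * R ^ 4) := by
    refine intervalIntegral.integral_mono_on_of_le_Ioo ht.1 hi intervalIntegrable_const
      fun r hr => ?_
    have h0 := hX0 r (hsub (Ioo_subset_Icc_self hr))
    have h1 := hlt r hr
    gcongr
  rw [intervalIntegral.integral_const, smul_eq_mul, sub_zero] at hint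
  have h1 : t * (a * R ^ 3 + b * R ^ 4) ≤ T * (a * R ^ 3 + b * R ^ 4) :=
    mul_le_mul_of_nonneg_right ht.2 (by positivity)
  have h2 : c₁ * R ^ 2 ≤ c₁ * X t ^ 2 := by
    have : R ≤ X t := hRt
    gcongr
  linarith [hE t ht]

/-- The barrier argument is run at levels κY with Y slightly larger than X(0), since it needs strict
inequalities and X(0) may vanish; then Y decreases to X(0). -/
theorem le_mul_of_integral_bound {κ : ℝ} (hT : 0 ≤ T) (hX : ContinuousOn X (Icc 0 T))
    (hX0 : ∀ t ∈ Icc 0 T, 0 ≤ X t) (hc₁ : 0 < c₁) (hc₂ : 0 < c₂) (ha : 0 ≤ a) (hb : 0 ≤ b)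
    (hκ : 1 ≤ κ) (hκ2 : c₁ + c₂ ≤ c₁ * κ ^ 2) (he : e ≤ c₂ * X 0 ^ 2)
    (hE : ∀ t ∈ Icc 0 T, c₁ * X t ^ 2 ≤ e + ∫ r in (0 : ℝ)..t, (a * X r ^ 3 + b * X r ^ 4))
    (hsmall : T ≤ c₁ / (a * κ ^ 3 + b * κ ^ 4 + 1) * ((1 + X 0) ^ 2)⁻¹) :
    ∀ t ∈ Icc 0 T, X t ≤ κ * X 0 := by
  have x0 : 0 ≤ X 0 := hX0 0 ⟨le_rfl, hT⟩
  have κ0 : 0 < κ := one_pos.trans_le hκ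
  intro t ht
  rw [← div_le_iff₀' κ0]
  refine le_of_forall_pos_le_add fun d hd => ?_
  rw [div_le_iff₀' κ0]
  -- The cap at 1 keeps Y ≤ 1 + X(0), the quantity in the time restriction.
  set Y := X 0 + min d 1 with hY
  have m0 : 0 < min d 1 := lt_min hd one_pos
  have Y0 : 0 < Y := by positivity
  have Y1 : Y ≤ 1 + X 0 := by rw [hY, add_comm]; gcongr; exact min_le_right _ _
  have XY : X 0 < Y := by linarith
  have hlt := lt_of_integral_bound (R := κ * Y) hT hX hX0 hc₁ ha hb
    (XY.trans_le (le_mul_of_one_le_left Y0.le hκ)) hE ?_ t ht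
  · refine hlt.le.trans ?_
    exact mul_le_mul_of_nonneg_left (add_le_add_right (min_le_left d 1) _) κ0.le
  set D := a * κ ^ 3 + b * κ ^ 4 with hD
  have D0 : 0 ≤ D := by positivity
  have p : 0 < (1 + X 0) ^ 2 := by positivity
  have hTY : T * (1 + X 0) ^ 2 * (D + 1) ≤ c₁ := by
    rw [← div_eq_mul_inv, le_div_iff₀ p, le_div_iff₀ (by positivity)] at hsmall
    exact hsmall
  -- After Y² is taken out, Y and Y² remain from the cubic and quartic terms. Both are at most (1 +
  -- X(0))², whence the power -2 in the length of the time interval.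
  have s1 : a * (κ * Y) ^ 3 + b * (κ * Y) ^ 4 ≤ D * ((1 + X 0) ^ 2 * Y ^ 2) := by
    have y1 : Y ≤ (1 + X 0) ^ 2 := by nlinarith
    have y2 : Y ^ 2 ≤ (1 + X 0) ^ 2 := by gcongr
    calc _ = a * κ ^ 3 * (Y * Y ^ 2) + b * κ ^ 4 * (Y ^ 2 * Y ^ 2) := by ring
      _ ≤ a * κ ^ 3 * ((1 + X 0) ^ 2 * Y ^ 2) + b * κ ^ 4 * ((1 + X 0) ^ 2 * Y ^ 2) := by gcongr
      _ = _ := by rw [hD]; ring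
  have s2 : T * (a * (κ * Y) ^ 3 + b * (κ * Y) ^ 4) ≤ c₁ * Y ^ 2 := by
    calc _ ≤ T * (D * ((1 + X 0) ^ 2 * Y ^ 2)) := by gcongr
      _ = T * (1 + X 0) ^ 2 * D * Y ^ 2 := by ring
      _ ≤ T * (1 + X 0) ^ 2 * (D + 1) * Y ^ 2 := by gcongr; linarith
      _ ≤ _ := by gcongr
  have s3 : e < c₂ * Y ^ 2 := he.trans_lt (by gcongr)
  have s4 : (c₁ + c₂) * Y ^ 2 ≤ c₁ * κ ^ 2 * Y ^ 2 := by gcongr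
  linarith

end bootstrap

/-! ### The almost conservation law -/

/-- The almost conservation law on the Fourier side. -/
theorem FourierSolution.abs_fourierEnergy_sub_le_of_small {σ γ₁ γ₂ δ₁ δ₂ T κ : ℝ}
    {g : ℝ → ℝ → ℂ} (S : FourierSolution σ (7 / 48) γ₁ γ₂ δ₁ δ₂ T g) (hσ : 0 ≤ σ)
    (hγ₁ : 0 < γ₁) (hδ₁ : 0 < δ₁) (hκ : 1 ≤ κ)
    (hκ2 : ellConst γ₁ δ₁ / 2 + (1 + γ₁ + δ₁) / 2 ≤ ellConst γ₁ δ₁ / 2 * κ ^ 2)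
    (hsmall : T ≤ ellConst γ₁ δ₁ / 2 / (2 * jbConst * κ ^ 3 + jbConst ^ 2 * κ ^ 4 + 1) *
      ((1 + n2 (wmul (chmul σ (g 0)))) ^ 2)⁻¹) {t : ℝ} (ht : t ∈ Icc 0 T) :
    |fourierEnergy γ₁ δ₁ σ (g t) - fourierEnergy γ₁ δ₁ σ (g 0)|
      ≤ σ ^ 2 * T * (2 * jbConst * (κ * n2 (wmul (chmul σ (g 0)))) ^ 3
        + jbConst ^ 2 * (κ * n2 (wmul (chmul σ (g 0)))) ^ 4) := by
  have hT : 0 ≤ T := ht.1.trans ht.2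
  have h0 : (0 : ℝ) ∈ Icc 0 T := ⟨le_rfl, hT⟩
  have C0 := jbConst_nonneg
  set X : ℝ → ℝ := fun t => n2 (wmul (chmul σ (g t))) with hX
  have X0 : ∀ t, 0 ≤ X t := fun t => n2_nonneg _
  have m1 : (min 1 σ) ^ 2 ≤ 1 := pow_le_one₀ (le_min zero_le_one hσ) (min_le_left _ _)
  have mσ : (min 1 σ) ^ 2 ≤ σ ^ 2 :=
    pow_le_pow_left₀ (le_min zero_le_one hσ) (min_le_right _ _) 2
  have I0 : ∀ t ∈ Icc 0 T, 0 ≤ ∫ r in (0 : ℝ)..t, (2 * jbConst * X r ^ 3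
      + jbConst ^ 2 * X r ^ 4) := fun t ht =>
    intervalIntegral.integral_nonneg ht.1 fun r _ => by have := X0 r; positivity
  have hb : ∀ t ∈ Icc 0 T, |fourierEnergy γ₁ δ₁ σ (g t) - fourierEnergy γ₁ δ₁ σ (g 0)|
      ≤ (min 1 σ) ^ 2 * ∫ r in (0 : ℝ)..t, (2 * jbConst * X r ^ 3 + jbConst ^ 2 * X r ^ 4) := by
    intro t ht
    rw [← intervalIntegral.integral_const_mul]
    exact S.abs_fourierEnergy_sub_le hσ hγ₁ hδ₁ ht
  -- Here min(1, σ)² is replaced by 1, so the admissible time does not depend on σ; the factor σ²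
  -- enters only in the final estimate.
  have hle := le_mul_of_integral_bound (X := X) (c₂ := (1 + γ₁ + δ₁) / 2) hT S.continuousOn_norm
    (fun t _ => X0 t) (half_pos (ellConst_pos hγ₁ hδ₁)) (by positivity)
    (a := 2 * jbConst) (b := jbConst ^ 2) (by positivity) (by positivity) hκ hκ2
    (fourierEnergy_bounds hγ₁ hδ₁ (S.mem 0 h0)).2 (fun t ht => by
      have h1 := (fourierEnergy_bounds hγ₁ hδ₁ (S.mem t ht)).1
      have h2 := (le_abs_self _).trans ((hb t ht).trans
        (mul_le_of_le_one_left (I0 t ht) m1))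
      simp only [hX] at h2 ⊢
      linarith) hsmall
  refine (hb t ht).trans ?_
  rw [mul_assoc]
  refine mul_le_mul mσ ?_ (I0 t ht) (sq_nonneg σ)
  have κ0 : 0 ≤ κ := zero_le_one.trans hκ
  have x0 := X0 0
  have hsub : Icc 0 t ⊆ Icc 0 T := Icc_subset_Icc_right ht.2
  have hc := S.continuousOn_norm.mono hsub
  have hint : ∫ r in (0 : ℝ)..t, (2 * jbConst * X r ^ 3 + jbConst ^ 2 * X r ^ 4)
      ≤ ∫ r in (0 : ℝ)..t, (2 * jbConst * (κ * X 0) ^ 3 + jbConst ^ 2 * (κ * X 0) ^ 4) := by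
    refine intervalIntegral.integral_mono_on ht.1 (ContinuousOn.intervalIntegrable ?_)
      intervalIntegrable_const fun r hr => ?_
    · rw [uIcc_of_le ht.1]
      exact ((hc.pow 3).const_mul _).add ((hc.pow 4).const_mul _)
    · have h1 := hle r (hsub hr)
      have h2 := X0 r
      gcongr
  rw [intervalIntegral.integral_const, smul_eq_mul, sub_zero] at hint
  exact hint.trans (mul_le_mul_of_nonneg_right ht.2 (by positivity))

/-- Coercivity gives x ≤ c^(-1/2) E^(1/2); the powers x³ and x⁴ then produce E^(3/2) and E^(1/2) ·
E^(3/2). -/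
theorem cubic_quartic_le_rpow {c E x a b : ℝ} (hc : 0 < c) (hx : 0 ≤ x) (ha : 0 ≤ a) (hb : 0 ≤ b)
    (hE : c * x ^ 2 ≤ E) :
    a * x ^ 3 + b * x ^ 4 ≤ (a * (Real.sqrt c)⁻¹ ^ 3 + b * (Real.sqrt c)⁻¹ ^ 4) *
      ((1 + E ^ (1 / 2 : ℝ)) * E ^ (3 / 2 : ℝ)) := by
  have E0 : 0 ≤ E := (by positivity : 0 ≤ c * x ^ 2).trans hE
  have h3 : E ^ (3 / 2 : ℝ) = Real.sqrt E ^ 3 := by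
    rw [Real.sqrt_eq_rpow, ← Real.rpow_natCast, ← Real.rpow_mul E0]; norm_num
  rw [h3, ← Real.sqrt_eq_rpow]
  have s0 := Real.sqrt_pos.2 hc
  have hs := Real.sqrt_le_sqrt hE
  rw [Real.sqrt_mul hc.le, Real.sqrt_sq hx] at hs
  set s := Real.sqrt E with hs'
  have s1 : 0 ≤ s := Real.sqrt_nonneg _
  set q := (Real.sqrt c)⁻¹ with hq
  have q0 : 0 < q := inv_pos.2 s0
  have hxs : x ≤ q * s := by
    rw [hq, ← div_eq_inv_mul, le_div_iff₀' s0]; exact hs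
  calc _ ≤ a * (q * s) ^ 3 + b * (q * s) ^ 4 := by gcongr
    _ = a * q ^ 3 * s ^ 3 + b * q ^ 4 * (s * s ^ 3) := by ring
    _ ≤ a * q ^ 3 * ((1 + s) * s ^ 3) + b * q ^ 4 * ((1 + s) * s ^ 3) := by
      gcongr
      · exact le_mul_of_one_le_left (by positivity) (by linarith)
      · linarith
    _ = _ := by ring

end KdVBBM

end

open KdVBBM in
theorem theorem3 (γ₁ γ₂ δ₁ δ₂ : ℝ) (hγ₁ : 0 < γ₁) (hδ₁ : 0 < δ₁) :
    ∃ c₀ C : ℝ, 0 < c₀ ∧ 0 < C ∧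
      ∀ (σ T : ℝ) (η₀ : KdVBBM.L2) (η : ℝ → KdVBBM.L2),
        0 ≤ σ → KdVBBM.MemH σ 2 η₀ →
        0 < T → T ≤ c₀ * ((1 + KdVBBM.normH σ 2 η₀) ^ 2)⁻¹ →
        KdVBBM.ContInH σ 2 T η →
        KdVBBM.IsSolution (7 / 48) γ₁ γ₂ δ₁ δ₂ T η₀ η →
        ∃ S : ℝ,
          IsLUB ((fun t => KdVBBM.energy γ₁ δ₁ σ (η t)) '' Set.Icc 0 T) S ∧
          |S - KdVBBM.energy γ₁ δ₁ σ η₀| ≤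
            C * (σ ^ 2 * T *
              ((1 + KdVBBM.energy γ₁ δ₁ σ η₀ ^ (1 / 2 : ℝ)) *
                KdVBBM.energy γ₁ δ₁ σ η₀ ^ (3 / 2 : ℝ))) := by
  set c₁ := ellConst γ₁ δ₁ / 2 with hc₁
  set c₂ := (1 + γ₁ + δ₁) / 2 with hc₂
  have c₁0 : 0 < c₁ := half_pos (ellConst_pos hγ₁ hδ₁)
  have c₂0 : 0 < c₂ := by positivity
  -- Chosen so that c₁κ = c₁ + c₂, which with κ ≥ 1 gives the inequality between c₁ + c₂ and c₁κ²
  -- required by the continuity argument.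
  set κ := 1 + c₂ / c₁ with hκ
  have κ1 : 1 ≤ κ := by rw [hκ]; linarith [(by positivity : 0 ≤ c₂ / c₁)]
  have κ2 : c₁ + c₂ ≤ c₁ * κ ^ 2 := by
    calc c₁ + c₂ = c₁ * κ := by rw [hκ]; field_simp
      _ ≤ c₁ * κ ^ 2 := by gcongr; exact le_self_pow₀ κ1 (by norm_num)
  have j0 := jbConst_nonneg
  set A := 2 * jbConst * κ ^ 3 * (Real.sqrt c₁)⁻¹ ^ 3
    + jbConst ^ 2 * κ ^ 4 * (Real.sqrt c₁)⁻¹ ^ 4 with hA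
  -- The added 1 makes both the denominator and the constant C positive using only `jbConst` ≥ 0.
  refine ⟨c₁ / (2 * jbConst * κ ^ 3 + jbConst ^ 2 * κ ^ 4 + 1), A + 1, by positivity,
    by positivity, ?_⟩
  intro σ T η₀ η hσ hη₀ hT hsmall hcont hsol
  have h0 : (0 : ℝ) ∈ Set.Icc 0 T := ⟨le_rfl, hT.le⟩
  have S := fourierSolution hcont hsol
  have eE : ∀ t ∈ Set.Icc 0 T, energy γ₁ δ₁ σ (η t) = fourierEnergy γ₁ δ₁ σ (hat (η t)) :=
    fun t ht => energy_eq (hcont t ht).1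
  rw [← hsol.initial] at hsmall ⊢
  rw [normH_eq] at hsmall
  set x := n2 (wmul (chmul σ (hat (η 0)))) with hx
  set E₀ := energy γ₁ δ₁ σ (η 0) with hE₀
  set b := (A + 1) * (σ ^ 2 * T * ((1 + E₀ ^ (1 / 2 : ℝ)) * E₀ ^ (3 / 2 : ℝ))) with hb
  have hl : c₁ * x ^ 2 ≤ E₀ := by
    rw [hE₀, eE 0 h0]; exact (fourierEnergy_bounds hγ₁ hδ₁ (S.mem 0 h0)).1
  have E₀0 : 0 ≤ E₀ := (by positivity : 0 ≤ c₁ * x ^ 2).trans hl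
  have bound : ∀ t ∈ Set.Icc 0 T, |energy γ₁ δ₁ σ (η t) - E₀| ≤ b := by
    intro t ht
    rw [hE₀, eE t ht, eE 0 h0]
    refine (S.abs_fourierEnergy_sub_le_of_small hσ hγ₁ hδ₁ κ1 κ2 hsmall ht).trans ?_
    have hq := cubic_quartic_le_rpow (a := 2 * jbConst * κ ^ 3) (b := jbConst ^ 2 * κ ^ 4)
      c₁0 (n2_nonneg _) (by positivity) (by positivity) hl
    calc _ = σ ^ 2 * T * (2 * jbConst * κ ^ 3 * x ^ 3 + jbConst ^ 2 * κ ^ 4 * x ^ 4) := by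
          ring
      _ ≤ σ ^ 2 * T * (A * ((1 + E₀ ^ (1 / 2 : ℝ)) * E₀ ^ (3 / 2 : ℝ))) := by gcongr
      _ = A * (σ ^ 2 * T * ((1 + E₀ ^ (1 / 2 : ℝ)) * E₀ ^ (3 / 2 : ℝ))) := by ring
      _ ≤ b := by rw [hb]; gcongr; linarith
  have hub : E₀ + b ∈ upperBounds ((fun t => energy γ₁ δ₁ σ (η t)) '' Set.Icc 0 T) := by
    rintro _ ⟨t, ht, rfl⟩
    linarith [(abs_le.1 (bound t ht)).2]
  -- The energies are bounded above by E₀ + b, so the supremum exists without any continuity of the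
  -- energy. It is at least E₀, attained at t = 0, so the absolute value can be dropped.
  have hL := isLUB_csSup (Set.Nonempty.image _ ⟨0, h0⟩) ⟨_, hub⟩
  refine ⟨_, hL, ?_⟩
  have h1 := hL.1 ⟨0, h0, rfl⟩
  have h2 := hL.2 hub
  rw [abs_of_nonneg (sub_nonneg.2 h1)]
  linarith
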